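/- **Calculus.** Time grades are natural numbers $\tau$. Fix a set of base types $\mathsf b$; ground types are $A ::= \mathsf b \mid \mathsf{unit} \mid A\times A' \mid [\tau]A$, and value types are $X ::= \mathsf b\mid\mathsf{unit}\mid X\times Y\mid [\tau]X\mid X\to Y!\tau$. Fix constants $\mathsf f:(A_1,\dots,A_n)\to B$ and a set $\mathcal O$ of operations $\mathsf{op}:A_{\mathsf{op}}\rightsquigarrow B_{\mathsf{op}}!\tau_{\mathsf{op}}$, all with ground types. Contexts are $\Gamma ::= \cdot\mid\Gamma,x{:}X\mid\Gamma,\langle\tau\rangle$; $\mathsf{time}\,\Gamma$ is the sum of the $\tau$ in $\Gamma$, and $\Gamma-\tau$ is $\Gamma$ for $\tau=0$ and otherwise removes from the right $\tau$ worth of modalities, with the variables met on the way: $\cdot-\tau=\cdot$, $(\Gamma,x{:}X)-\tau=\Gamma-\tau$, and $(\Gamma,\langle\tau'\rangle)-\tau$ is $\Gamma,\langle\tau'-\tau\rangle$ if $\tau\le\tau'$ and $\Gamma-(\tau-\tau')$ otherwise. Well-typed values $\Gamma\vdash V:X$ are: variables of $\Gamma$; $\mathsf f(V_1,\dots,V_n)$;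 $()$; $(V,W)$; $\mathsf{fun}(x{:}X)\mapsto M$; and $\mathsf{box}_\tau V:[\tau]X$ for $\Gamma,\langle\tau\rangle\vdash V:X$. Well-typed computations $\Gamma\vdash M:X!\tau$ are: $\mathsf{return}\,V:X!0$; $\mathsf{let}\,x=M\,\mathsf{in}\,N:Y!(\tau+\tau')$ for $M:X!\tau$ and $\Gamma,\langle\tau\rangle,x{:}X\vdash N:Y!\tau'$; $V\,W$; $\mathsf{match}\,V\,\mathsf{with}\,(x,y)\mapsto N$; $\mathsf{op}\,V\,(x.M):X!(\tau_{\mathsf{op}}+\tau)$ for $\Gamma,\langle\tau_{\mathsf{op}}\rangle,x{:}B_{\mathsf{op}}\vdash M:X!\tau$; $\mathsf{delay}\,\tau\,M:X!(\tau+\tau')$ for $\Gamma,\langle\tau\rangle\vdash M:X!\tau'$; $\mathsf{handle}\,M\,\mathsf{with}\,H\,\mathsf{to}\,x\,\mathsf{in}\,N:Y!(\tau+\tau')$ for $M:X!\tau$, $\Gamma,\langle\tau\rangle,x{:}X\vdash N:Y!\tau'$ and operation clauses $\Gamma,x{:}A_{\mathsf{op}},k{:}[\tau_{\mathsf{op}}](B_{\mathsf{op}}\to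 Y!\tau'')\vdash M_{\mathsf{op}}:Y!(\tau_{\mathsf{op}}+\tau'')$ for all $\mathsf{op}$ and all $\tau''$; and $\mathsf{unbox}_\tau V\,\mathsf{as}\,x\,\mathsf{in}\,N:Y!\tau'$ for $\tau\le\mathsf{time}\,\Gamma$, $\Gamma-\tau\vdash V:[\tau]X$ and $\Gamma,x{:}X\vdash N:Y!\tau'$. **Equational theory.** $\equiv$ is the least relation on well-typed terms of the same context and type that is an equivalence, a congruence and closed under substitution, and contains: $()\equiv V$; $\mathsf{fun}(x)\mapsto V\,x\equiv V$; $(\mathsf{fun}(x)\mapsto M)\,V\equiv M[V/x]$; $\mathsf{match}\,(V,W)\,\mathsf{with}\,(x,y)\mapsto N\equiv N[V/x,W/y]$; $\mathsf{match}\,V\,\mathsf{with}\,(x,y)\mapsto N[(x,y)/z]\equiv N[V/z]$; $\mathsf{let}\,x=\mathsf{return}\,V\,\mathsf{in}\,N\equiv N[V/x]$; associativity of $\mathsf{let}$; $\mathsf{let}\,x=M\,\mathsf{in}\,\mathsf{return}\,x\equiv M$; $\mathsf{let}\,x=\mathsf{op}\,V\,(y.M)\,\mathsf{in}\,N\equiv\mathsf{op}\,V\,(y.\,\mathsf{let}\,x=M\,\mathsf{in}\,N)$;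 $\mathsf{let}\,x=\mathsf{delay}\,\tau\,M\,\mathsf{in}\,N\equiv\mathsf{delay}\,\tau\,(\mathsf{let}\,x=M\,\mathsf{in}\,N)$; $\mathsf{handle}\,(\mathsf{return}\,V)\,\mathsf{with}\,H\,\mathsf{to}\,x\,\mathsf{in}\,N\equiv N[V/x]$; $\mathsf{handle}\,(\mathsf{op}\,V\,(y.M))\,\mathsf{with}\,H\,\mathsf{to}\,x\,\mathsf{in}\,N\equiv M_{\mathsf{op}}[V/x,\ \mathsf{box}_{\tau_{\mathsf{op}}}(\mathsf{fun}(y)\mapsto\mathsf{handle}\,M\,\mathsf{with}\,H\,\mathsf{to}\,x\,\mathsf{in}\,N)/k]$; $\mathsf{handle}\,(\mathsf{delay}\,\tau\,M)\,\mathsf{with}\,H\,\mathsf{to}\,x\,\mathsf{in}\,N\equiv\mathsf{delay}\,\tau\,(\mathsf{handle}\,M\,\mathsf{with}\,H\,\mathsf{to}\,x\,\mathsf{in}\,N)$; $\mathsf{unbox}_\tau(\mathsf{box}_\tau V)\,\mathsf{as}\,x\,\mathsf{in}\,N\equiv N[V/x]$; $\mathsf{unbox}_\tau V\,\mathsf{as}\,x\,\mathsf{in}\,N[\mathsf{box}_\tau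 x/y]\equiv N[V/y]$. The *extended* theory has in addition $$\mathsf{delay}\,0\,M\equiv M,\qquad \mathsf{delay}\,\tau\,(\mathsf{delay}\,\tau'\,M)\equiv\mathsf{delay}\,(\tau+\tau')\,M .$$ **Models.** A model is a category $\mathbb C$ with finite products, exponentials $\Rightarrow$, and products indexed by $\mathcal O$ and by $\mathbb N$, together with the following. (i) Strong monoidal functors $[-]:(\mathbb N,\le)\to[\mathbb C,\mathbb C]$ and $\langle-\rangle:(\mathbb N,\le)^{\mathrm{op}}\to[\mathbb C,\mathbb C]$, with natural isomorphisms $\varepsilon:[0]A\cong A$, $\delta:[\tau_1+\tau_2]A\cong[\tau_1][\tau_2]A$, $\eta:A\cong\langle0\rangle A$, $\mu:\langle\tau_1\rangle\langle\tau_2\rangle A\cong\langle\tau_1+\tau_2\rangle A$ that satisfy the unit and associativity laws and are monotone in the grades. (ii) Adjunctions $\langle\tau\rangle\dashv[\tau]$, with units $\eta^{\dashv}_{\tau}$ and counits $\varepsilon^{\dashv}_{\tau}$, compatible with (i): up to the identifications of $\tau_1+\tau_2$ with $\tau_2+\tau_1$, $$[\tau](\langle0\le\tau\rangle)\circ\eta^{\dashv}_{\tau}\circ\eta^{-1}\circ\varepsilon=[0\le\tau],\qquad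 \langle0\rangle([0\le\tau])\circ\eta\circ\varepsilon^{-1}\circ\varepsilon^{\dashv}_{\tau}=\langle0\le\tau\rangle,$$ $$[\tau_1][\tau_2](\mu)\circ[\tau_1](\eta^{\dashv}_{\tau_2})\circ\eta^{\dashv}_{\tau_1}=\delta\circ\eta^{\dashv}_{\tau_1+\tau_2},\qquad \varepsilon^{\dashv}_{\tau_1}\circ\langle\tau_1\rangle(\varepsilon^{\dashv}_{\tau_2})\circ\langle\tau_1\rangle\langle\tau_2\rangle(\delta)=\varepsilon^{\dashv}_{\tau_1+\tau_2}\circ\mu .$$ (iii) An $\mathbb N$-graded monad $(T,\eta^T,\mu^T)$ on $\mathbb C$ with a natural strength $\mathsf{str}:[\tau]A\times T\,\tau\,B\to T\,\tau\,(A\times B)$ satisfying the laws of a graded strength (for $\eta^T$, for $\mu^T$ via $\delta^{-1}$, for the second projection, and for associativity of $\times$). (iv) Objects $[\![\mathsf b]\!]$ and morphisms $[\![\mathsf f]\!]:[\![A_1]\!]\times\dots\times[\![A_n]\!]\to[\![B]\!]$, where $[\![\mathsf{unit}]\!]=1$, $[\![X\times Y]\!]=[\![X]\!]\times[\![Y]\!]$,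 $[\![[\tau]X]\!]=[\tau][\![X]\!]$ and $[\![X\to Y!\tau]\!]=[\![X]\!]\Rightarrow T\,\tau\,[\![Y]\!]$. (v) Morphisms $\mathsf{op}^T:[\![A_{\mathsf{op}}]\!]\times[\tau_{\mathsf{op}}]([\![B_{\mathsf{op}}]\!]\Rightarrow T\,\tau\,A)\to T\,(\tau_{\mathsf{op}}+\tau)\,A$ and $\mathsf{delay}^T_{A,\tau'}\,\tau:[\tau](T\,\tau'\,A)\to T\,(\tau+\tau')\,A$, natural in $A$ and commuting with $\mu^T$ and $\mathsf{str}$ (algebraicity). (vi) Morphisms $\chi_{A,\tau,\tau'}:\prod_{\mathsf{op}}\prod_{\tau''}\big(([\![A_{\mathsf{op}}]\!]\times[\tau_{\mathsf{op}}]([\![B_{\mathsf{op}}]\!]\Rightarrow T\,\tau''\,A))\Rightarrow T\,(\tau_{\mathsf{op}}+\tau'')\,A\big)\to(T\,\tau\,(T\,\tau'\,A)\Rightarrow T\,(\tau+\tau')\,A)$ which, when uncurried, send $\eta^T$ to the identity, commute with $\mathsf{delay}^T$, and replace $\mathsf{op}^T$ by the given clause for $\mathsf{op}$ at grade $\tau''=\tau+\tau'$,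 applied to the recursively handled continuation of grade $\tau$. **Interpretation.** Put $[\![\cdot]\!]1=1$, $[\![\Gamma,x{:}X]\!]1=[\![\Gamma]\!]1\times[\![X]\!]$ and $[\![\Gamma,\langle\tau\rangle]\!]1=\langle\tau\rangle([\![\Gamma]\!]1)$. Well-typed terms are interpreted by recursion as morphisms $[\![V]\!]:[\![\Gamma]\!]1\to[\![X]\!]$ and $[\![M]\!]:[\![\Gamma]\!]1\to T\,\tau\,[\![X]\!]$. A variable $x$ in $\Gamma,x{:}X,\Gamma'$ is interpreted by collapsing the modalities of $\Gamma'$ to $\langle\mathsf{time}\,\Gamma'\rangle$, applying $\langle\tau\rangle A\xrightarrow{\langle0\le\tau\rangle}\langle0\rangle A\cong A$ for $\tau=\mathsf{time}\,\Gamma'$, and projecting; constants, unit, pairs, functions, application and $\mathsf{match}$ by the cartesian closed structure; and $$[\![\mathsf{box}_\tau V]\!]=[\tau]([\![V]\!])\circ\eta^{\dashv},\quad [\![\mathsf{return}\,V]\!]=\eta^T\circ[\![V]\!],\quad [\![\mathsf{let}\,x=M\,\mathsf{in}\,N]\!]=\mu^T\circ T\,\tau\,([\![N]\!])\circ\mathsf{str}\circ\langle\eta^{\dashv},[\![M]\!]\rangle,$$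 $$[\![\mathsf{op}\,V\,(x.M)]\!]=\mathsf{op}^T\circ(\mathrm{id}\times[\tau_{\mathsf{op}}](\mathsf{curry}\,[\![M]\!]))\circ\langle[\![V]\!],\eta^{\dashv}\rangle,\quad [\![\mathsf{delay}\,\tau\,M]\!]=\mathsf{delay}^T\,\tau\circ[\tau]([\![M]\!])\circ\eta^{\dashv},$$ $$[\![\mathsf{handle}\,M\,\mathsf{with}\,H\,\mathsf{to}\,x\,\mathsf{in}\,N]\!]=\mathsf{uncurry}(\chi)\circ\big\langle[\![H]\!],\ T\,\tau\,([\![N]\!])\circ\mathsf{str}\circ\langle\eta^{\dashv},[\![M]\!]\rangle\big\rangle,$$ with $[\![H]\!]$ the tuple of the curried interpretations of the clauses, and $$[\![\mathsf{unbox}_\tau V\,\mathsf{as}\,x\,\mathsf{in}\,N]\!]=[\![N]\!]\circ\big\langle\mathrm{id},\ \varepsilon^{\dashv}\circ\langle\tau\rangle([\![V]\!])\circ\mathrm{p}\big\rangle,$$ with $\mathrm{p}:[\![\Gamma]\!]1\to\langle\tau\rangle([\![\Gamma-\tau]\!]1)$ collapsing $\tau$ worth of modalities of $\Gamma$. **Theorem.**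 Let a model be given whose delay operations satisfy, for all $A,\tau,\tau',\tau''$ (identifying $T\,(0+\tau)$ with $T\,\tau$ and $T\,(\tau+(\tau'+\tau''))$ with $T\,((\tau+\tau')+\tau'')$), $$\mathsf{delay}^T_{A,\tau}\,0=\varepsilon_{T\,\tau\,A},\qquad \mathsf{delay}^T_{A,\tau'+\tau''}\,\tau\circ[\tau]\big(\mathsf{delay}^T_{A,\tau''}\,\tau'\big)=\mathsf{delay}^T_{A,\tau''}\,(\tau+\tau')\circ\delta^{-1}_{T\,\tau''A,\tau,\tau'} .$$ Then the interpretation is sound for the extended equational theory: if $\Gamma\vdash V\equiv W:X$ is derivable in it, then $[\![V]\!]=[\![W]\!]$, and if $\Gamma\vdash M\equiv N:X!\tau$ is derivable in it, then $[\![M]\!]=[\![N]\!]$. -/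

import Mathlib

open CategoryTheory CategoryTheory.Limits MonoidalCategory CartesianMonoidalCategory

universe w v u

noncomputable section

namespace LambdaTau

/-! ## Types and signatures -/

/-- Ground types `A ::= b | unit | A × B | [τ] A` over a set of base types. -/
inductive GTy (B : Type w) : Type w
  | base : B → GTy B
  | unit : GTy B
  | prod : GTy B → GTy B → GTy B
  | box : ℕ → GTy B → GTy B

/-- Value types: ground types, closed under products, the temporal resource type `[τ] X`, and
function types `X → Y ! τ`. A computation type `X ! τ` is a value type with a time grade. -/
inductive Ty (B : Type w) : Type w
  | base : B → Ty B
  | unit : Ty B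
  | prod : Ty B → Ty B → Ty B
  | box : ℕ → Ty B → Ty B
  | func : Ty B → Ty B → ℕ → Ty B

/-- Every ground type is a value type. -/
def GTy.toTy {B : Type w} : GTy B → Ty B
  | .base b => .base b
  | .unit => .unit
  | .prod A A' => .prod A.toTy A'.toTy
  | .box τ A => .box τ A.toTy

/-- Base types, constants `f : (A₁, …, Aₙ) → B` and operations `op : A_op ⇝ B_op ! τ_op`, all of
whose types are ground. -/
structure Signature where
  Base : Type w
  Const : Type w
  arity : Const → ℕ
  dom : (f : Const) → Fin (arity f) → GTy Base
  cod : Const → GTy Base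
  Op : Type w
  arg : Op → GTy Base
  res : Op → GTy Base
  dur : Op → ℕ

/-! ## Contexts, variables, renamings -/

/-- Temporal contexts `Γ ::= · | Γ, x : X | Γ, ⟨τ⟩` (variables are nameless). -/
inductive Ctx (B : Type w) : Type w
  | nil : Ctx B
  | snoc : Ctx B → Ty B → Ctx B
  | mod : Ctx B → ℕ → Ctx B

section Contexts

variable {B : Type w}

/-- The time captured by a context. -/
def Ctx.time : Ctx B → ℕ
  | .nil => 0
  | .snoc Γ _ => Γ.time
  | .mod Γ τ => Γ.time + τ

/-- The "time travelling" operation `Γ - τ`. -/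
def Ctx.minus : Ctx B → ℕ → Ctx B
  | Γ, 0 => Γ
  | .nil, _ + 1 => .nil
  | .snoc Γ _, n + 1 => Γ.minus (n + 1)
  | .mod Γ τ', n + 1 =>
      if n + 1 ≤ τ' then .mod Γ (τ' - (n + 1)) else Γ.minus (n + 1 - τ')

/-- `Var Γ X`: the variables of type `X` in `Γ`, i.e. the decompositions `Γ = Γ₁, x : X, Γ₂`. -/
inductive Var : Ctx B → Ty B → Type w
  | here {Γ : Ctx B} {X : Ty B} : Var (Γ.snoc X) X
  | there {Γ : Ctx B} {X Y : Ty B} : Var Γ X → Var (Γ.snoc Y) X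
  | skip {Γ : Ctx B} {X : Ty B} {τ : ℕ} : Var Γ X → Var (Γ.mod τ) X

/-- The context `Γ₁` to the left of the variable in `Γ = Γ₁, x : X, Γ₂`. -/
def Var.before : {Γ : Ctx B} → {X : Ty B} → Var Γ X → Ctx B
  | .snoc Γ _, _, .here => Γ
  | _, _, .there x => x.before
  | _, _, .skip x => x.before

/-- The context `Γ₂` to the right of the variable in `Γ = Γ₁, x : X, Γ₂`. -/
def Var.after : {Γ : Ctx B} → {X : Ty B} → Var Γ X → Ctx B
  | _, _, .here => .nil
  | .snoc _ Y, _, .there x => x.after.snoc Y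
  | .mod _ τ, _, .skip x => x.after.mod τ

/-- How long ago a variable was brought into scope: the time captured by `x.after`. -/
def Var.age : {Γ : Ctx B} → {X : Ty B} → Var Γ X → ℕ
  | _, _, .here => 0
  | _, _, .there x => x.age
  | .mod _ τ, _, .skip x => x.age + τ

/-- A variable of `Γ - τ`, seen as a variable of `Γ`. -/
def Var.ofMinus : (Γ : Ctx B) → (τ : ℕ) → {X : Ty B} → Var (Γ.minus τ) X → Var Γ X
  | .nil, 0, _, x => x
  | .snoc _ _, 0, _, x => x
  | .mod _ _, 0, _, x => x
  | .nil, _ + 1, _, x => x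
  | .snoc Γ _, n + 1, _, x => .there (Var.ofMinus Γ (n + 1) x)
  | .mod Γ τ', n + 1, X, x =>
      iteInduction (c := n + 1 ≤ τ') (t := Ctx.mod Γ (τ' - (n + 1))) (e := Γ.minus (n + 1 - τ'))
        (motive := fun Δ => Var Δ X → Var (Γ.mod τ') X)
        (fun _ y => match y with
          | .skip z => .skip z)
        (fun _ y => .skip (Var.ofMinus Γ (n + 1 - τ') y)) x

/-- A variable of `Γ` that was brought into scope at least `τ` ago survives in `Γ - τ`. -/
def Var.toMinus : {Γ : Ctx B} → {X : Ty B} → (x : Var Γ X) → (τ : ℕ) → τ ≤ x.age →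
    Var (Γ.minus τ) X
  | _, _, .here, 0, _ => .here
  | _, _, .there x, 0, _ => .there x
  | _, _, .skip x, 0, _ => .skip x
  | _, _, .here, n + 1, h => absurd h (Nat.not_succ_le_zero n)
  | _, _, .there x, n + 1, h => x.toMinus (n + 1) h
  | .mod Γ τ', X, .skip x, n + 1, h =>
      iteInduction (c := n + 1 ≤ τ') (t := Ctx.mod Γ (τ' - (n + 1))) (e := Γ.minus (n + 1 - τ'))
        (motive := fun Δ => Var Δ X)
        (fun _ => .skip x)
        (fun _ => x.toMinus (n + 1 - τ') (Nat.sub_le_of_le_add h))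

theorem Var.age_ofMinus : (Γ : Ctx B) → (τ : ℕ) → {X : Ty B} → (x : Var (Γ.minus τ) X) →
    (Var.ofMinus Γ τ x).age = x.age + τ
  | .nil, 0, _, x => nomatch x
  | .snoc _ _, 0, _, _ => rfl
  | .mod _ _, 0, _, _ => rfl
  | .nil, _ + 1, _, x => nomatch x
  | .snoc Γ _, n + 1, _, x => Var.age_ofMinus Γ (n + 1) x
  | .mod Γ τ', n + 1, X, x => by
      have key : ∀ (d : Decidable (n + 1 ≤ τ'))
          (x : Var (@ite _ (n + 1 ≤ τ') d (Ctx.mod Γ (τ' - (n + 1))) (Γ.minus (n + 1 - τ'))) X),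
          (iteInduction (c := n + 1 ≤ τ') (t := Ctx.mod Γ (τ' - (n + 1)))
            (e := Γ.minus (n + 1 - τ'))
            (motive := fun Δ => Var Δ X → Var (Γ.mod τ') X)
            (fun _ y => match y with
              | .skip z => .skip z)
            (fun _ y => .skip (Var.ofMinus Γ (n + 1 - τ') y)) x).age = x.age + (n + 1) := by
        intro d x
        cases d with
        | isTrue h =>
          cases x with
          | skip z =>
            change z.age + τ' = z.age + (τ' - (n + 1)) + (n + 1)
            omega
        | isFalse h =>
          change (Var.ofMinus Γ (n + 1 - τ') x).age + τ' = _
          rw [Var.age_ofMinus Γ (n + 1 - τ') x]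
          change x.age + (n + 1 - τ') + τ' = x.age + (n + 1)
          omega
      exact key _ x

theorem Var.age_toMinus : {Γ : Ctx B} → {X : Ty B} → (x : Var Γ X) → (τ : ℕ) →
    (h : τ ≤ x.age) → (x.toMinus τ h).age = x.age - τ
  | _, _, .here, 0, _ => rfl
  | _, _, .there _, 0, _ => rfl
  | _, _, .skip _, 0, _ => rfl
  | _, _, .here, n + 1, h => absurd h (Nat.not_succ_le_zero n)
  | _, _, .there x, n + 1, h => Var.age_toMinus x (n + 1) h
  | .mod Γ τ', X, .skip x, n + 1, h => by
      have key : ∀ (d : Decidable (n + 1 ≤ τ')),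
          (iteInduction (c := n + 1 ≤ τ') (t := Ctx.mod Γ (τ' - (n + 1)))
            (e := Γ.minus (n + 1 - τ'))
            (motive := fun Δ => Var Δ X)
            (fun _ => .skip x)
            (fun _ => x.toMinus (n + 1 - τ') (Nat.sub_le_of_le_add h))).age
          = x.age + τ' - (n + 1) := by
        intro d
        cases d with
        | isTrue h' =>
          change x.age + (τ' - (n + 1)) = x.age + τ' - (n + 1)
          omega
        | isFalse h' =>
          change (x.toMinus (n + 1 - τ') _).age = _
          rw [Var.age_toMinus x]
          omega
      exact key _

theorem Ctx.time_minus : (Γ : Ctx B) → (τ : ℕ) → (Γ.minus τ).time = Γ.time - τ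
  | .nil, 0 => rfl
  | .snoc _ _, 0 => rfl
  | .mod _ _, 0 => rfl
  | .nil, n + 1 => (Nat.zero_sub (n + 1)).symm
  | .snoc Γ _, n + 1 => Ctx.time_minus Γ (n + 1)
  | .mod Γ τ', n + 1 => by
      rw [Ctx.minus]
      split
      · change Γ.time + (τ' - (n + 1)) = Γ.time + τ' - (n + 1)
        omega
      · rw [Ctx.time_minus Γ]
        change Γ.time - (n + 1 - τ') = Γ.time + τ' - (n + 1)
        omega

/-- Renamings `Γ ⇝ Δ`: type-preserving maps of variables under which variables do not become
younger and no time gets lost. -/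
structure Ren (Γ Δ : Ctx B) where
  map : {X : Ty B} → Var Γ X → Var Δ X
  age_le : ∀ {X : Ty B} (x : Var Γ X), x.age ≤ (map x).age
  time_le : Γ.time ≤ Δ.time

namespace Ren

variable {Γ Δ Θ : Ctx B}

def comp (ρ : Ren Γ Δ) (ρ' : Ren Δ Θ) : Ren Γ Θ where
  map x := ρ'.map (ρ.map x)
  age_le x := (ρ.age_le x).trans (ρ'.age_le _)
  time_le := ρ.time_le.trans ρ'.time_le

/-- `Γ ⇝ Γ, x : X`. -/
def wk (X : Ty B) : Ren Γ (Γ.snoc X) where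
  map x := .there x
  age_le _ := le_rfl
  time_le := le_rfl

/-- `Γ ⇝ Γ, ⟨τ⟩`. -/
def toMod (τ : ℕ) : Ren Γ (Γ.mod τ) where
  map x := .skip x
  age_le _ := Nat.le_add_right _ _
  time_le := Nat.le_add_right _ _

/-- `Γ, x : X ⇝ Δ, x : X` from `Γ ⇝ Δ`. -/
def snoc (ρ : Ren Γ Δ) (X : Ty B) : Ren (Γ.snoc X) (Δ.snoc X) where
  map x := match x with
    | .here => .here
    | .there y => .there (ρ.map y)
  age_le x := match x with
    | .here => le_rfl
    | .there y => ρ.age_le y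
  time_le := ρ.time_le

/-- `Γ, ⟨τ⟩ ⇝ Δ, ⟨τ⟩` from `Γ ⇝ Δ`. -/
def mod (ρ : Ren Γ Δ) (τ : ℕ) : Ren (Γ.mod τ) (Δ.mod τ) where
  map x := match x with
    | .skip y => .skip (ρ.map y)
  age_le x := match x with
    | .skip y => Nat.add_le_add_right (ρ.age_le y) τ
  time_le := Nat.add_le_add_right ρ.time_le τ

/-- `Γ, ⟨0⟩ ⇝ Γ`. -/
def eta : Ren (Γ.mod 0) Γ where
  map x := match x with
    | .skip y => y
  age_le x := match x with
    | .skip _ => le_rfl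
  time_le := le_rfl

/-- `Γ, ⟨τ + τ'⟩ ⇝ Γ, ⟨τ⟩, ⟨τ'⟩`. -/
def mu (τ τ' : ℕ) : Ren (Γ.mod (τ + τ')) ((Γ.mod τ).mod τ') where
  map x := match x with
    | .skip y => .skip (.skip y)
  age_le x := match x with
    | .skip _ => (Nat.add_assoc _ _ _).ge
  time_le := (Nat.add_assoc _ _ _).ge

/-- `Γ, ⟨τ⟩, ⟨τ'⟩ ⇝ Γ, ⟨τ + τ'⟩`. -/
def muInv (τ τ' : ℕ) : Ren ((Γ.mod τ).mod τ') (Γ.mod (τ + τ')) where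
  map x := match x with
    | .skip (.skip y) => .skip y
  age_le x := match x with
    | .skip (.skip _) => (Nat.add_assoc _ _ _).le
  time_le := (Nat.add_assoc _ _ _).le

/-- `Γ, ⟨τ + τ'⟩ ⇝ Γ, ⟨τ⟩, x : X, ⟨τ'⟩`. -/
def under (τ τ' : ℕ) (X : Ty B) : Ren (Γ.mod (τ + τ')) (((Γ.mod τ).snoc X).mod τ') :=
  (mu τ τ').comp ((wk X).mod τ')

/-- `Γ - τ ⇝ Γ`. -/
def ofMinus (τ : ℕ) : Ren (Γ.minus τ) Γ where
  map x := Var.ofMinus Γ τ x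
  age_le x := by rw [Var.age_ofMinus]; exact Nat.le_add_right _ _
  time_le := by rw [Ctx.time_minus]; exact Nat.sub_le _ _

/-- `(Γ - τ), ⟨τ⟩ ⇝ Γ`, provided that `Γ` captures at least `τ` time. -/
def minusMod (τ : ℕ) (h : τ ≤ Γ.time) : Ren ((Γ.minus τ).mod τ) Γ where
  map x := match x with
    | .skip y => Var.ofMinus Γ τ y
  age_le x := match x with
    | .skip y => (Var.age_ofMinus Γ τ y).ge
  time_le := by
    change (Γ.minus τ).time + τ ≤ Γ.time
    rw [Ctx.time_minus, Nat.sub_add_cancel h]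

/-- `Γ - τ ⇝ Δ - τ` from `Γ ⇝ Δ`. -/
def minus (ρ : Ren Γ Δ) (τ : ℕ) : Ren (Γ.minus τ) (Δ.minus τ) where
  map x := (ρ.map (Var.ofMinus Γ τ x)).toMinus τ (by
    have h₁ := Var.age_ofMinus Γ τ x
    have h₂ := ρ.age_le (Var.ofMinus Γ τ x)
    omega)
  age_le x := by
    have h₁ := Var.age_ofMinus Γ τ x
    have h₂ := ρ.age_le (Var.ofMinus Γ τ x)
    rw [Var.age_toMinus]
    omega
  time_le := by
    rw [Ctx.time_minus, Ctx.time_minus]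
    exact Nat.sub_le_sub_right ρ.time_le τ

end Ren

/-- `Pos Γ₀ X Γ Δ` says that `Γ = Γ₀, x : X, Γ'` and `Δ = Γ₀, Γ'` for some `Γ'`, i.e. that `x` can be
substituted in `Γ` by a value in `Γ₀`, leading to `Δ`. The case `gone` stands for contexts from
which `x` has already been removed, by the operation `Γ - τ`. -/
inductive Pos (Γ₀ : Ctx B) (X : Ty B) : Ctx B → Ctx B → Type w
  | gone {Γ : Ctx B} : Pos Γ₀ X Γ Γ
  | here : Pos Γ₀ X (Γ₀.snoc X) Γ₀
  | snoc {Γ Δ : Ctx B} (Y : Ty B) : Pos Γ₀ X Γ Δ → Pos Γ₀ X (Γ.snoc Y) (Δ.snoc Y)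
  | mod {Γ Δ : Ctx B} (τ : ℕ) : Pos Γ₀ X Γ Δ → Pos Γ₀ X (Γ.mod τ) (Δ.mod τ)

theorem Pos.time_eq {Γ₀ : Ctx B} {X : Ty B} : {Γ Δ : Ctx B} → Pos Γ₀ X Γ Δ → Γ.time = Δ.time
  | _, _, .gone => rfl
  | _, _, .here => rfl
  | _, _, .snoc _ p => p.time_eq
  | _, _, .mod τ p => congrArg (· + τ) p.time_eq

def Pos.atZero (X : Ty B) : (Γ₀ : Ctx B) → Pos Γ₀ X (Γ₀.snoc X) (Γ₀.minus 0)
  | .nil => .here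
  | .snoc _ _ => .here
  | .mod _ _ => .here

def Pos.ite {Γ₀ : Ctx B} {X : Ty B} {Γ Γ' Δ Δ' : Ctx B} {c : Prop} (d : Decidable c)
    (p : c → Pos Γ₀ X Γ Δ) (q : ¬ c → Pos Γ₀ X Γ' Δ') :
    Pos Γ₀ X (if c then Γ else Γ') (if c then Δ else Δ') :=
  match d with
  | .isTrue h => p h
  | .isFalse h => q h

/-- Time travelling in both contexts; `x` is gone once one has travelled to before it. -/
def Pos.minus {Γ₀ : Ctx B} {X : Ty B} : {Γ Δ : Ctx B} → Pos Γ₀ X Γ Δ → (τ : ℕ) →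
    Pos Γ₀ X (Γ.minus τ) (Δ.minus τ)
  | _, _, .gone, _ => .gone
  | _, _, .here, 0 => Pos.atZero X Γ₀
  | _, _, .snoc Y p, 0 => .snoc Y p
  | _, _, .mod τ' p, 0 => .mod τ' p
  | _, _, .here, _ + 1 => .gone
  | _, _, .snoc _ p, n + 1 => p.minus (n + 1)
  | .mod Γ _, .mod Δ _, .mod τ' p, n + 1 =>
      Pos.ite (c := n + 1 ≤ τ') (Γ := .mod Γ (τ' - (n + 1))) (Δ := .mod Δ (τ' - (n + 1)))
        inferInstance (fun _ => .mod _ p) (fun _ => p.minus (n + 1 - τ'))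

end Contexts

/-! ## Terms -/

section Terms

variable (S : Signature.{w})

mutual

/-- Well-typed values `Γ ⊢ V : X`. -/
inductive Val : Ctx S.Base → Ty S.Base → Type w
  | var {Γ : Ctx S.Base} {X : Ty S.Base} (x : Var Γ X) : Val Γ X
  | const {Γ : Ctx S.Base} (f : S.Const) (V : (i : Fin (S.arity f)) → Val Γ (S.dom f i).toTy) :
      Val Γ (S.cod f).toTy
  | unit {Γ : Ctx S.Base} : Val Γ .unit
  | pair {Γ : Ctx S.Base} {X Y : Ty S.Base} (V : Val Γ X) (W : Val Γ Y) : Val Γ (.prod X Y)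
  | lam {Γ : Ctx S.Base} {X Y : Ty S.Base} {τ : ℕ} (M : Comp (Γ.snoc X) Y τ) :
      Val Γ (.func X Y τ)
  | box {Γ : Ctx S.Base} {X : Ty S.Base} (τ : ℕ) (V : Val (Γ.mod τ) X) : Val Γ (.box τ X)

/-- Well-typed computations `Γ ⊢ M : X ! σ`. Where the typing rule produces a compound grade, the
constructor takes an equation for the grade `σ`. In `handle`, there is an operation clause for
every operation and every execution time `τ''` of the continuation. -/
inductive Comp : Ctx S.Base → Ty S.Base → ℕ → Type w
  | ret {Γ : Ctx S.Base} {X : Ty S.Base} (V : Val Γ X) : Comp Γ X 0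
  | letin {Γ : Ctx S.Base} {X Y : Ty S.Base} {τ τ' σ : ℕ} (h : σ = τ + τ')
      (M : Comp Γ X τ) (N : Comp ((Γ.mod τ).snoc X) Y τ') : Comp Γ Y σ
  | app {Γ : Ctx S.Base} {X Y : Ty S.Base} {τ : ℕ} (V : Val Γ (.func X Y τ)) (W : Val Γ X) :
      Comp Γ Y τ
  | pm {Γ : Ctx S.Base} {X Y Z : Ty S.Base} {τ : ℕ} (V : Val Γ (.prod X Y))
      (N : Comp ((Γ.snoc X).snoc Y) Z τ) : Comp Γ Z τ
  | opcall {Γ : Ctx S.Base} {X : Ty S.Base} {τ σ : ℕ} (o : S.Op) (h : σ = S.dur o + τ)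
      (V : Val Γ (S.arg o).toTy) (M : Comp ((Γ.mod (S.dur o)).snoc (S.res o).toTy) X τ) :
      Comp Γ X σ
  | delay {Γ : Ctx S.Base} {X : Ty S.Base} {τ' σ : ℕ} (τ : ℕ) (h : σ = τ + τ')
      (M : Comp (Γ.mod τ) X τ') : Comp Γ X σ
  | handle {Γ : Ctx S.Base} {X Y : Ty S.Base} {τ τ' σ : ℕ} (h : σ = τ + τ')
      (M : Comp Γ X τ)
      (H : (o : S.Op) → (τ'' : ℕ) →
        Comp ((Γ.snoc (S.arg o).toTy).snoc (.box (S.dur o) (.func (S.res o).toTy Y τ''))) Y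
          (S.dur o + τ''))
      (N : Comp ((Γ.mod τ).snoc X) Y τ') : Comp Γ Y σ
  | unbox {Γ : Ctx S.Base} {X Y : Ty S.Base} {τ' : ℕ} (τ : ℕ) (h : τ ≤ Γ.time)
      (V : Val (Γ.minus τ) (.box τ X)) (N : Comp (Γ.snoc X) Y τ') : Comp Γ Y τ'

end

variable {S}

/-- The operation clauses of an effect handler `H`. -/
abbrev Clauses (S : Signature.{w}) (Γ : Ctx S.Base) (Y : Ty S.Base) : Type w :=
  (o : S.Op) → (τ'' : ℕ) →
    Comp S ((Γ.snoc (S.arg o).toTy).snoc (.box (S.dur o) (.func (S.res o).toTy Y τ''))) Y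
      (S.dur o + τ'')

mutual

/-- The action of renamings on values. -/
def Val.ren {Γ Δ : Ctx S.Base} {X : Ty S.Base} (V : Val S Γ X) (ρ : Ren Γ Δ) : Val S Δ X :=
  match V with
  | .var x => .var (ρ.map x)
  | .const f V => .const f (fun i => (V i).ren ρ)
  | .unit => .unit
  | .pair V W => .pair (V.ren ρ) (W.ren ρ)
  | .lam M => .lam (M.ren (ρ.snoc _))
  | .box τ V => .box τ (V.ren (ρ.mod τ))

/-- The action of renamings on computations. -/
def Comp.ren {Γ Δ : Ctx S.Base} {X : Ty S.Base} {σ : ℕ} (M : Comp S Γ X σ) (ρ : Ren Γ Δ) :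
    Comp S Δ X σ :=
  match M with
  | .ret V => .ret (V.ren ρ)
  | .letin h M N => .letin h (M.ren ρ) (N.ren ((ρ.mod _).snoc _))
  | .app V W => .app (V.ren ρ) (W.ren ρ)
  | .pm V N => .pm (V.ren ρ) (N.ren ((ρ.snoc _).snoc _))
  | .opcall o h V M => .opcall o h (V.ren ρ) (M.ren ((ρ.mod _).snoc _))
  | .delay τ h M => .delay τ h (M.ren (ρ.mod τ))
  | .handle h M H N =>
      .handle h (M.ren ρ) (fun o τ'' => (H o τ'').ren ((ρ.snoc _).snoc _))
        (N.ren ((ρ.mod _).snoc _))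
  | .unbox τ h V N => .unbox τ (h.trans ρ.time_le) (V.ren (ρ.minus τ)) (N.ren (ρ.snoc _))

end

/-- Substituting `W` in a variable. -/
def Var.subst {Γ₀ : Ctx S.Base} {X : Ty S.Base} (W : Val S Γ₀ X) :
    {Γ Δ : Ctx S.Base} → {Y : Ty S.Base} → Var Γ Y → Pos Γ₀ X Γ Δ → Val S Δ Y
  | _, _, _, x, .gone => .var x
  | _, _, _, .here, .here => W
  | _, _, _, .there x, .here => .var x
  | _, _, _, .here, .snoc _ _ => .var .here
  | _, _, _, .there x, .snoc Y p => (Var.subst W x p).ren (.wk Y)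
  | _, _, _, .skip x, .mod τ p => (Var.subst W x p).ren (.toMod τ)

mutual

/-- The substitution `V[W/x]` in values, for the variable `x` at the given position. -/
def Val.subst {Γ₀ Γ Δ : Ctx S.Base} {X Y : Ty S.Base} (V : Val S Γ Y) (W : Val S Γ₀ X)
    (p : Pos Γ₀ X Γ Δ) : Val S Δ Y :=
  match V with
  | .var x => x.subst W p
  | .const f V => .const f (fun i => (V i).subst W p)
  | .unit => .unit
  | .pair V V' => .pair (V.subst W p) (V'.subst W p)
  | .lam M => .lam (M.subst W (p.snoc _))
  | .box τ V => .box τ (V.subst W (p.mod τ))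

/-- The substitution `M[W/x]` in computations, for the variable `x` at the given position. -/
def Comp.subst {Γ₀ Γ Δ : Ctx S.Base} {X Y : Ty S.Base} {σ : ℕ} (M : Comp S Γ Y σ)
    (W : Val S Γ₀ X) (p : Pos Γ₀ X Γ Δ) : Comp S Δ Y σ :=
  match M with
  | .ret V => .ret (V.subst W p)
  | .letin h M N => .letin h (M.subst W p) (N.subst W ((p.mod _).snoc _))
  | .app V V' => .app (V.subst W p) (V'.subst W p)
  | .pm V N => .pm (V.subst W p) (N.subst W ((p.snoc _).snoc _))
  | .opcall o h V M => .opcall o h (V.subst W p) (M.subst W ((p.mod _).snoc _))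
  | .delay τ h M => .delay τ h (M.subst W (p.mod τ))
  | .handle h M H N =>
      .handle h (M.subst W p) (fun o τ'' => (H o τ'').subst W ((p.snoc _).snoc _))
        (N.subst W ((p.mod _).snoc _))
  | .unbox τ h V N =>
      .unbox τ (h.trans p.time_eq.le) (V.subst W (p.minus τ)) (N.subst W (p.snoc _))

end

/-- `N[V/x]` for the last variable `x` of the context. -/
def Comp.subst₁ {Γ : Ctx S.Base} {X Y : Ty S.Base} {σ : ℕ} (N : Comp S (Γ.snoc X) Y σ)
    (V : Val S Γ X) : Comp S Γ Y σ :=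
  N.subst V .here

/-- `N[V/x, W/y]` for the last two variables `x`, `y` of the context. -/
def Comp.subst₂ {Γ : Ctx S.Base} {X Y Z : Ty S.Base} {σ : ℕ}
    (N : Comp S ((Γ.snoc X).snoc Y) Z σ) (V : Val S Γ X) (W : Val S Γ Y) : Comp S Γ Z σ :=
  (N.subst₁ (W.ren (.wk X))).subst₁ V

/-- The action of renamings on operation clauses. -/
def Clauses.ren {Γ Δ : Ctx S.Base} {Y : Ty S.Base} (H : Clauses S Γ Y) (ρ : Ren Γ Δ) :
    Clauses S Δ Y :=
  fun o τ'' => (H o τ'').ren ((ρ.snoc _).snoc _)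

/-! ## Equational theory -/

/-- Sets of additional equations between computations. -/
abbrev Axioms (S : Signature.{w}) : Type w :=
  (Γ : Ctx S.Base) → (X : Ty S.Base) → (σ : ℕ) → Comp S Γ X σ → Comp S Γ X σ → Prop

mutual

/-- `Γ ⊢ V ≡ W : X`, in the equational theory of the calculus extended with the equations `Ax`. -/
inductive ValEq (Ax : Axioms S) : {Γ : Ctx S.Base} → {X : Ty S.Base} →
    Val S Γ X → Val S Γ X → Prop
  -- equivalence, congruence, substitutivity
  | refl {Γ : Ctx S.Base} {X : Ty S.Base} (V : Val S Γ X) : ValEq Ax V V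
  | symm {Γ : Ctx S.Base} {X : Ty S.Base} {V W : Val S Γ X} : ValEq Ax V W → ValEq Ax W V
  | trans {Γ : Ctx S.Base} {X : Ty S.Base} {V W U : Val S Γ X} :
      ValEq Ax V W → ValEq Ax W U → ValEq Ax V U
  | const {Γ : Ctx S.Base} (f : S.Const) {V V' : (i : Fin (S.arity f)) → Val S Γ (S.dom f i).toTy} :
      (∀ i, ValEq Ax (V i) (V' i)) → ValEq Ax (.const f V) (.const f V')
  | pair {Γ : Ctx S.Base} {X Y : Ty S.Base} {V V' : Val S Γ X} {W W' : Val S Γ Y} :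
      ValEq Ax V V' → ValEq Ax W W' → ValEq Ax (.pair V W) (.pair V' W')
  | lam {Γ : Ctx S.Base} {X Y : Ty S.Base} {τ : ℕ} {M M' : Comp S (Γ.snoc X) Y τ} :
      CompEq Ax M M' → ValEq Ax (.lam M) (.lam M')
  | box {Γ : Ctx S.Base} {X : Ty S.Base} (τ : ℕ) {V V' : Val S (Γ.mod τ) X} :
      ValEq Ax V V' → ValEq Ax (.box τ V) (.box τ V')
  | subst {Γ₀ Γ Δ : Ctx S.Base} {X Y : Ty S.Base} {V V' : Val S Γ Y} {W W' : Val S Γ₀ X}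
      (p : Pos Γ₀ X Γ Δ) : ValEq Ax V V' → ValEq Ax W W' → ValEq Ax (V.subst W p) (V'.subst W' p)
  -- unit and function types
  | unit_eta {Γ : Ctx S.Base} (V : Val S Γ .unit) : ValEq Ax .unit V
  | func_eta {Γ : Ctx S.Base} {X Y : Ty S.Base} {τ : ℕ} (V : Val S Γ (.func X Y τ)) :
      ValEq Ax (.lam (.app (V.ren (.wk X)) (.var .here))) V

/-- `Γ ⊢ M ≡ N : X ! σ`, in the equational theory of the calculus extended with the equations
`Ax`. -/
inductive CompEq (Ax : Axioms S) : {Γ : Ctx S.Base} → {X : Ty S.Base} → {σ : ℕ} →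
    Comp S Γ X σ → Comp S Γ X σ → Prop
  -- additional equations
  | ax {Γ : Ctx S.Base} {X : Ty S.Base} {σ : ℕ} {M N : Comp S Γ X σ} :
      Ax Γ X σ M N → CompEq Ax M N
  -- equivalence, congruence, substitutivity
  | refl {Γ : Ctx S.Base} {X : Ty S.Base} {σ : ℕ} (M : Comp S Γ X σ) : CompEq Ax M M
  | symm {Γ : Ctx S.Base} {X : Ty S.Base} {σ : ℕ} {M N : Comp S Γ X σ} :
      CompEq Ax M N → CompEq Ax N M
  | trans {Γ : Ctx S.Base} {X : Ty S.Base} {σ : ℕ} {M N P : Comp S Γ X σ} :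
      CompEq Ax M N → CompEq Ax N P → CompEq Ax M P
  | ret {Γ : Ctx S.Base} {X : Ty S.Base} {V V' : Val S Γ X} :
      ValEq Ax V V' → CompEq Ax (.ret V) (.ret V')
  | letin {Γ : Ctx S.Base} {X Y : Ty S.Base} {τ τ' σ : ℕ} (h : σ = τ + τ')
      {M M' : Comp S Γ X τ} {N N' : Comp S ((Γ.mod τ).snoc X) Y τ'} :
      CompEq Ax M M' → CompEq Ax N N' → CompEq Ax (.letin h M N) (.letin h M' N')
  | app {Γ : Ctx S.Base} {X Y : Ty S.Base} {τ : ℕ} {V V' : Val S Γ (.func X Y τ)}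
      {W W' : Val S Γ X} :
      ValEq Ax V V' → ValEq Ax W W' → CompEq Ax (.app V W) (.app V' W')
  | pm {Γ : Ctx S.Base} {X Y Z : Ty S.Base} {τ : ℕ} {V V' : Val S Γ (.prod X Y)}
      {N N' : Comp S ((Γ.snoc X).snoc Y) Z τ} :
      ValEq Ax V V' → CompEq Ax N N' → CompEq Ax (.pm V N) (.pm V' N')
  | opcall {Γ : Ctx S.Base} {X : Ty S.Base} {τ σ : ℕ} (o : S.Op) (h : σ = S.dur o + τ)
      {V V' : Val S Γ (S.arg o).toTy}
      {M M' : Comp S ((Γ.mod (S.dur o)).snoc (S.res o).toTy) X τ} :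
      ValEq Ax V V' → CompEq Ax M M' → CompEq Ax (.opcall o h V M) (.opcall o h V' M')
  | delay {Γ : Ctx S.Base} {X : Ty S.Base} {τ' σ : ℕ} (τ : ℕ) (h : σ = τ + τ')
      {M M' : Comp S (Γ.mod τ) X τ'} :
      CompEq Ax M M' → CompEq Ax (.delay τ h M) (.delay τ h M')
  | handle {Γ : Ctx S.Base} {X Y : Ty S.Base} {τ τ' σ : ℕ} (h : σ = τ + τ')
      {M M' : Comp S Γ X τ} {H H' : Clauses S Γ Y} {N N' : Comp S ((Γ.mod τ).snoc X) Y τ'} :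
      CompEq Ax M M' → (∀ o τ'', CompEq Ax (H o τ'') (H' o τ'')) → CompEq Ax N N' →
      CompEq Ax (.handle h M H N) (.handle h M' H' N')
  | unbox {Γ : Ctx S.Base} {X Y : Ty S.Base} {τ' : ℕ} (τ : ℕ) (h : τ ≤ Γ.time)
      {V V' : Val S (Γ.minus τ) (.box τ X)} {N N' : Comp S (Γ.snoc X) Y τ'} :
      ValEq Ax V V' → CompEq Ax N N' → CompEq Ax (.unbox τ h V N) (.unbox τ h V' N')
  | subst {Γ₀ Γ Δ : Ctx S.Base} {X Y : Ty S.Base} {σ : ℕ} {M M' : Comp S Γ Y σ}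
      {W W' : Val S Γ₀ X} (p : Pos Γ₀ X Γ Δ) :
      CompEq Ax M M' → ValEq Ax W W' → CompEq Ax (M.subst W p) (M'.subst W' p)
  -- function and product types
  | func_beta {Γ : Ctx S.Base} {X Y : Ty S.Base} {τ : ℕ} (M : Comp S (Γ.snoc X) Y τ)
      (V : Val S Γ X) : CompEq Ax (.app (.lam M) V) (M.subst₁ V)
  | prod_beta {Γ : Ctx S.Base} {X Y Z : Ty S.Base} {τ : ℕ} (V : Val S Γ X) (W : Val S Γ Y)
      (N : Comp S ((Γ.snoc X).snoc Y) Z τ) : CompEq Ax (.pm (.pair V W) N) (N.subst₂ V W)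
  | prod_eta {Γ : Ctx S.Base} {X Y Z : Ty S.Base} {τ : ℕ} (V : Val S Γ (.prod X Y))
      (N : Comp S (Γ.snoc (.prod X Y)) Z τ) :
      CompEq Ax
        (.pm V ((N.ren (((Ren.wk X).comp (.wk Y)).snoc _)).subst₁
          (.pair (.var (.there .here)) (.var .here))))
        (N.subst₁ V)
  -- sequential composition
  | let_ret {Γ : Ctx S.Base} {X Y : Ty S.Base} {τ : ℕ} (V : Val S Γ X)
      (N : Comp S ((Γ.mod 0).snoc X) Y τ) :
      CompEq Ax (.letin (Nat.zero_add τ).symm (.ret V) N) ((N.ren (Ren.eta.snoc X)).subst₁ V)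
  | let_let {Γ : Ctx S.Base} {X Y Z : Ty S.Base} {τ₁ τ₂ τ₃ : ℕ} (M : Comp S Γ X τ₁)
      (N : Comp S ((Γ.mod τ₁).snoc X) Y τ₂) (P : Comp S ((Γ.mod (τ₁ + τ₂)).snoc Y) Z τ₃) :
      CompEq Ax
        (.letin rfl (.letin rfl M N) P)
        (.letin (Nat.add_assoc τ₁ τ₂ τ₃) M
          (.letin rfl N (P.ren ((Ren.under τ₁ τ₂ X).snoc Y))))
  | let_eta {Γ : Ctx S.Base} {X : Ty S.Base} {τ : ℕ} (M : Comp S Γ X τ) :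
      CompEq Ax (.letin rfl M (.ret (.var .here))) M
  -- algebraicity
  | let_op {Γ : Ctx S.Base} {X Y : Ty S.Base} {τ τ' : ℕ} (o : S.Op) (V : Val S Γ (S.arg o).toTy)
      (M : Comp S ((Γ.mod (S.dur o)).snoc (S.res o).toTy) X τ)
      (N : Comp S ((Γ.mod (S.dur o + τ)).snoc X) Y τ') :
      CompEq Ax
        (.letin rfl (.opcall o rfl V M) N)
        (.opcall o (Nat.add_assoc (S.dur o) τ τ') V
          (.letin rfl M (N.ren ((Ren.under (S.dur o) τ _).snoc X))))
  | let_delay {Γ : Ctx S.Base} {X Y : Ty S.Base} {τ τ' τ'' : ℕ} (M : Comp S (Γ.mod τ) X τ')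
      (N : Comp S ((Γ.mod (τ + τ')).snoc X) Y τ'') :
      CompEq Ax
        (.letin rfl (.delay τ rfl M) N)
        (.delay τ (Nat.add_assoc τ τ' τ'') (.letin rfl M (N.ren ((Ren.mu τ τ').snoc X))))
  -- effect handling
  | handle_ret {Γ : Ctx S.Base} {X Y : Ty S.Base} {τ : ℕ} (V : Val S Γ X) (H : Clauses S Γ Y)
      (N : Comp S ((Γ.mod 0).snoc X) Y τ) :
      CompEq Ax
        (.handle (Nat.zero_add τ).symm (.ret V) H N)
        ((N.ren (Ren.eta.snoc X)).subst₁ V)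
  | handle_op {Γ : Ctx S.Base} {X Y : Ty S.Base} {τ τ' : ℕ} (o : S.Op)
      (V : Val S Γ (S.arg o).toTy) (M : Comp S ((Γ.mod (S.dur o)).snoc (S.res o).toTy) X τ)
      (H : Clauses S Γ Y) (N : Comp S ((Γ.mod (S.dur o + τ)).snoc X) Y τ') :
      CompEq Ax
        (.handle (Nat.add_assoc (S.dur o) τ τ').symm (.opcall o rfl V M) H N)
        ((H o (τ + τ')).subst₂ V
          (.box (S.dur o) (.lam
            (.handle rfl M
              (Clauses.ren H ((Ren.toMod (S.dur o)).comp (.wk _)))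
              (N.ren ((Ren.under (S.dur o) τ _).snoc X))))))
  | handle_delay {Γ : Ctx S.Base} {X Y : Ty S.Base} {τ τ' τ'' : ℕ} (M : Comp S (Γ.mod τ) X τ')
      (H : Clauses S Γ Y) (N : Comp S ((Γ.mod (τ + τ')).snoc X) Y τ'') :
      CompEq Ax
        (.handle rfl (.delay τ rfl M) H N)
        (.delay τ (Nat.add_assoc τ τ' τ'')
          (.handle rfl M (Clauses.ren H (.toMod τ)) (N.ren ((Ren.mu τ τ').snoc X))))
  -- temporal resource types
  | box_beta {Γ : Ctx S.Base} {X Y : Ty S.Base} {σ : ℕ} (τ : ℕ) (h : τ ≤ Γ.time)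
      (V : Val S ((Γ.minus τ).mod τ) X) (N : Comp S (Γ.snoc X) Y σ) :
      CompEq Ax (.unbox τ h (.box τ V) N) (N.subst₁ (V.ren (.minusMod τ h)))
  | box_eta {Γ : Ctx S.Base} {X Y : Ty S.Base} {σ : ℕ} (τ : ℕ) (h : τ ≤ Γ.time)
      (V : Val S (Γ.minus τ) (.box τ X)) (N : Comp S (Γ.snoc (.box τ X)) Y σ) :
      CompEq Ax
        (.unbox τ h V ((N.ren ((Ren.wk X).snoc _)).subst₁ (.box τ (.var (.skip .here)))))
        (N.subst₁ (V.ren (.ofMinus τ)))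

end

/-- The two equations for delays: `delay 0 M ≡ M` and
`delay τ (delay τ' M) ≡ delay (τ + τ') M`. -/
inductive DelayAx : Axioms S
  | zero {Γ : Ctx S.Base} {X : Ty S.Base} {σ : ℕ} (M : Comp S (Γ.mod 0) X σ) :
      DelayAx Γ X σ (.delay 0 (Nat.zero_add σ).symm M) (M.ren .eta)
  | add {Γ : Ctx S.Base} {X : Ty S.Base} (τ τ' : ℕ) {σ : ℕ}
      (M : Comp S ((Γ.mod τ).mod τ') X σ) :
      DelayAx Γ X (τ + (τ' + σ))
        (.delay τ rfl (.delay τ' rfl M))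
        (.delay (τ + τ') (Nat.add_assoc τ τ' σ).symm (M.ren (.muInv τ τ')))

end Terms

/-! ## The abstract model structure -/

section Semantics

variable {C : Type u} [Category.{v} C]

/-- The component `[τ₁ ≤ τ₂]_A : [τ₁] A ⟶ [τ₂] A` of a functor `[-] : (ℕ, ≤) ⥤ [C, C]`. For
`τ₁ = τ₂`, this is the identification of equal objects. -/
abbrev futLE (F : ℕ ⥤ C ⥤ C) {τ₁ τ₂ : ℕ} (h : τ₁ ≤ τ₂) (A : C) :
    (F.obj τ₁).obj A ⟶ (F.obj τ₂).obj A :=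
  (F.map (homOfLE h)).app A

/-- The component `⟨τ₁ ≤ τ₂⟩_A : ⟨τ₂⟩ A ⟶ ⟨τ₁⟩ A` of a functor `⟨-⟩ : (ℕ, ≤)ᵒᵖ ⥤ [C, C]`. For
`τ₁ = τ₂`, this is the identification of equal objects. -/
abbrev pastLE (P : ℕᵒᵖ ⥤ C ⥤ C) {τ₁ τ₂ : ℕ} (h : τ₁ ≤ τ₂) (A : C) :
    (P.obj (Opposite.op τ₂)).obj A ⟶ (P.obj (Opposite.op τ₁)).obj A :=
  (P.map (homOfLE h).op).app A

variable (C) in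
/-- Modalities: a strong monoidal functor `[-] : (ℕ, ≤) ⥤ [C, C]`, a strong monoidal functor
`⟨-⟩ : (ℕ, ≤)ᵒᵖ ⥤ [C, C]`, and adjunctions `⟨τ⟩ ⊣ [τ]` compatible with the monoidal structures. -/
structure Modalities where
  Fut : ℕ ⥤ C ⥤ C
  ε : Fut.obj 0 ≅ 𝟭 C
  δ : (τ₁ τ₂ : ℕ) → Fut.obj (τ₁ + τ₂) ≅ Fut.obj τ₂ ⋙ Fut.obj τ₁
  δ_zero_left : ∀ (τ : ℕ) (A : C),
    (δ 0 τ).hom.app A ≫ ε.hom.app ((Fut.obj τ).obj A) = futLE Fut (Nat.zero_add τ).le A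
  δ_zero_right : ∀ (τ : ℕ) (A : C),
    (δ τ 0).hom.app A ≫ (Fut.obj τ).map (ε.hom.app A) = 𝟙 _
  δ_assoc : ∀ (τ₁ τ₂ τ₃ : ℕ) (A : C),
    (δ (τ₁ + τ₂) τ₃).hom.app A ≫ (δ τ₁ τ₂).hom.app ((Fut.obj τ₃).obj A) =
      futLE Fut (Nat.add_assoc τ₁ τ₂ τ₃).le A ≫ (δ τ₁ (τ₂ + τ₃)).hom.app A ≫
        (Fut.obj τ₁).map ((δ τ₂ τ₃).hom.app A)
  δ_mono : ∀ {τ₁ τ₁' τ₂ τ₂' : ℕ} (h₁ : τ₁ ≤ τ₁') (h₂ : τ₂ ≤ τ₂') (A : C),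
    (δ τ₁ τ₂).hom.app A ≫ futLE Fut h₁ ((Fut.obj τ₂).obj A) ≫
        (Fut.obj τ₁').map (futLE Fut h₂ A) =
      futLE Fut (Nat.add_le_add h₁ h₂) A ≫ (δ τ₁' τ₂').hom.app A
  Past : ℕᵒᵖ ⥤ C ⥤ C
  η : 𝟭 C ≅ Past.obj (Opposite.op 0)
  μ : (τ₁ τ₂ : ℕ) →
    Past.obj (Opposite.op τ₂) ⋙ Past.obj (Opposite.op τ₁) ≅ Past.obj (Opposite.op (τ₁ + τ₂))
  μ_zero_left : ∀ (τ : ℕ) (A : C),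
    η.hom.app ((Past.obj (Opposite.op τ)).obj A) ≫ (μ 0 τ).hom.app A =
      pastLE Past (Nat.zero_add τ).le A
  μ_zero_right : ∀ (τ : ℕ) (A : C),
    (Past.obj (Opposite.op τ)).map (η.hom.app A) ≫ (μ τ 0).hom.app A = 𝟙 _
  μ_assoc : ∀ (τ₁ τ₂ τ₃ : ℕ) (A : C),
    (μ τ₁ τ₂).hom.app ((Past.obj (Opposite.op τ₃)).obj A) ≫ (μ (τ₁ + τ₂) τ₃).hom.app A =
      (Past.obj (Opposite.op τ₁)).map ((μ τ₂ τ₃).hom.app A) ≫ (μ τ₁ (τ₂ + τ₃)).hom.app A ≫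
        pastLE Past (Nat.add_assoc τ₁ τ₂ τ₃).le A
  μ_mono : ∀ {τ₁ τ₁' τ₂ τ₂' : ℕ} (h₁ : τ₁ ≤ τ₁') (h₂ : τ₂ ≤ τ₂') (A : C),
    pastLE Past h₁ ((Past.obj (Opposite.op τ₂')).obj A) ≫
        (Past.obj (Opposite.op τ₁)).map (pastLE Past h₂ A) ≫ (μ τ₁ τ₂).hom.app A =
      (μ τ₁' τ₂').hom.app A ≫ pastLE Past (Nat.add_le_add h₁ h₂) A
  adj : (τ : ℕ) → Past.obj (Opposite.op τ) ⊣ Fut.obj τ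
  unit_zero_le : ∀ (τ : ℕ) (A : C),
    ε.hom.app ((Past.obj (Opposite.op 0)).obj A) ≫ η.inv.app A ≫ (adj τ).unit.app A ≫
        (Fut.obj τ).map (pastLE Past (Nat.zero_le τ) A) =
      futLE Fut (Nat.zero_le τ) ((Past.obj (Opposite.op 0)).obj A)
  counit_zero_le : ∀ (τ : ℕ) (A : C),
    (adj τ).counit.app A ≫ ε.inv.app A ≫ η.hom.app ((Fut.obj 0).obj A) ≫
        (Past.obj (Opposite.op 0)).map (futLE Fut (Nat.zero_le τ) A) =
      pastLE Past (Nat.zero_le τ) ((Fut.obj τ).obj A)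
  unit_add : ∀ (τ₁ τ₂ : ℕ) (A : C),
    (adj τ₁).unit.app A ≫
        (Fut.obj τ₁).map ((adj τ₂).unit.app ((Past.obj (Opposite.op τ₁)).obj A)) ≫
        (Fut.obj τ₁).map ((Fut.obj τ₂).map
          ((μ τ₂ τ₁).hom.app A ≫ pastLE Past (Nat.add_comm τ₁ τ₂).le A)) =
      (adj (τ₁ + τ₂)).unit.app A ≫
        (δ τ₁ τ₂).hom.app ((Past.obj (Opposite.op (τ₁ + τ₂))).obj A)
  counit_add : ∀ (τ₁ τ₂ : ℕ) (A : C),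
    (Past.obj (Opposite.op τ₁)).map ((Past.obj (Opposite.op τ₂)).map
          (futLE Fut (Nat.add_comm τ₁ τ₂).le A ≫ (δ τ₂ τ₁).hom.app A)) ≫
        (Past.obj (Opposite.op τ₁)).map ((adj τ₂).counit.app ((Fut.obj τ₁).obj A)) ≫
        (adj τ₁).counit.app A =
      (μ τ₁ τ₂).hom.app ((Fut.obj (τ₁ + τ₂)).obj A) ≫ (adj (τ₁ + τ₂)).counit.app A

namespace Modalities

/-- The functor `[τ]`. -/
abbrev F (K : Modalities C) (τ : ℕ) : C ⥤ C := K.Fut.obj τ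

/-- The functor `⟨τ⟩`. -/
abbrev P (K : Modalities C) (τ : ℕ) : C ⥤ C := K.Past.obj (Opposite.op τ)

/-- The counit-like `⟨τ⟩ A ⟶ ⟨0⟩ A ≅ A`. -/
def epsPast (K : Modalities C) (τ : ℕ) (A : C) : (K.P τ).obj A ⟶ A :=
  pastLE K.Past (Nat.zero_le τ) A ≫ K.η.inv.app A

/-- The morphism `[τ] A × [τ] B ⟶ [τ] (A × B)` by which the right adjoint `[τ]` preserves binary
products. -/
def m [CartesianMonoidalCategory C] (K : Modalities C) (τ : ℕ) (A B : C) :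
    (K.F τ).obj A ⊗ (K.F τ).obj B ⟶ (K.F τ).obj (A ⊗ B) :=
  (K.adj τ).homEquiv _ _
    (lift ((K.P τ).map (fst _ _) ≫ (K.adj τ).counit.app A)
      ((K.P τ).map (snd _ _) ≫ (K.adj τ).counit.app B))

end Modalities

variable [CartesianMonoidalCategory C]

/-- The identification of `T τ A` and `T τ' A` for `τ = τ'`. -/
abbrev castT (T : ℕ → C ⥤ C) {τ τ' : ℕ} (h : τ = τ') (A : C) :
    (T τ).obj A ⟶ (T τ').obj A :=
  eqToHom (by rw [h])

/-- `[-]`-strong graded monads. -/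
structure StrongGradedMonad (K : Modalities C) where
  T : ℕ → C ⥤ C
  η : 𝟭 C ⟶ T 0
  μ : (τ₁ τ₂ : ℕ) → (T τ₂ ⋙ T τ₁ ⟶ T (τ₁ + τ₂))
  str : (τ : ℕ) → (A B : C) → ((K.F τ).obj A ⊗ (T τ).obj B ⟶ (T τ).obj (A ⊗ B))
  η_μ : ∀ (τ : ℕ) (A : C),
    η.app ((T τ).obj A) ≫ (μ 0 τ).app A = castT T (Nat.zero_add τ).symm A
  map_η_μ : ∀ (τ : ℕ) (A : C), (T τ).map (η.app A) ≫ (μ τ 0).app A = 𝟙 _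
  μ_assoc : ∀ (τ₁ τ₂ τ₃ : ℕ) (A : C),
    (μ τ₁ τ₂).app ((T τ₃).obj A) ≫ (μ (τ₁ + τ₂) τ₃).app A ≫
        castT T (Nat.add_assoc τ₁ τ₂ τ₃) A =
      (T τ₁).map ((μ τ₂ τ₃).app A) ≫ (μ τ₁ (τ₂ + τ₃)).app A
  str_natural : ∀ (τ : ℕ) {A A' B B' : C} (f : A ⟶ A') (g : B ⟶ B'),
    ((K.F τ).map f ⊗ₘ (T τ).map g) ≫ str τ A' B' = str τ A B ≫ (T τ).map (f ⊗ₘ g)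
  str_η : ∀ (A B : C), (K.ε.inv.app A ⊗ₘ η.app B) ≫ str 0 A B = η.app (A ⊗ B)
  str_snd : ∀ (τ : ℕ) (A B : C), str τ A B ≫ (T τ).map (snd A B) = snd _ _
  str_μ : ∀ (τ₁ τ₂ : ℕ) (A B : C),
    str τ₁ ((K.F τ₂).obj A) ((T τ₂).obj B) ≫ (T τ₁).map (str τ₂ A B) ≫
        (μ τ₁ τ₂).app (A ⊗ B) =
      ((K.δ τ₁ τ₂).inv.app A ⊗ₘ (μ τ₁ τ₂).app B) ≫ str (τ₁ + τ₂) A B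
  str_assoc : ∀ (τ : ℕ) (A B D : C),
    (α_ _ _ _).inv ≫ (K.m τ A B ▷ (T τ).obj D) ≫ str τ (A ⊗ B) D ≫
        (T τ).map (α_ A B D).hom =
      ((K.F τ).obj A ◁ str τ B D) ≫ str τ A (B ⊗ D)

variable [MonoidalClosed C]

/-- Currying `A × X ⟶ Y` to `A ⟶ (X ⟹ Y)`. -/
def curryR {A X Y : C} (f : A ⊗ X ⟶ Y) : A ⟶ (ihom X).obj Y :=
  MonoidalClosed.curry (lift (snd X A) (fst X A) ≫ f)

/-- Uncurrying `A ⟶ (X ⟹ Y)` to `A × X ⟶ Y`. -/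
def uncurryR {A X Y : C} (g : A ⟶ (ihom X).obj Y) : A ⊗ X ⟶ Y :=
  lift (snd A X) (fst A X) ≫ MonoidalClosed.uncurry g

/-- The morphism `A × (B ⟹ Z) ⟶ (B ⟹ A × Z)` pushing `A` under the exponential. -/
def pushUnder (A B Z : C) : A ⊗ (ihom B).obj Z ⟶ (ihom B).obj (A ⊗ Z) :=
  curryR ((α_ _ _ _).hom ≫ (A ◁ uncurryR (𝟙 ((ihom B).obj Z))))

/-- The swap `A × (B × D) ⟶ B × (A × D)`. -/
def swapMid (A B D : C) : A ⊗ (B ⊗ D) ⟶ B ⊗ (A ⊗ D) :=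
  lift (snd _ _ ≫ fst _ _) (lift (fst _ _) (snd _ _ ≫ snd _ _))

/-- Interpretation of value types. Ground types do not mention `T`, so that on them this is also
the interpretation of ground types. -/
def tyObj {B : Type w} (K : Modalities C) (T : ℕ → C ⥤ C) (base : B → C) : Ty B → C
  | .base b => base b
  | .unit => 𝟙_ C
  | .prod X Y => tyObj K T base X ⊗ tyObj K T base Y
  | .box τ X => (K.F τ).obj (tyObj K T base X)
  | .func X Y τ => (ihom (tyObj K T base X)).obj ((T τ).obj (tyObj K T base Y))

variable (C) (S : Signature.{w})

/-- The part of a model that determines the interpretation of types. -/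
structure TypeModel where
  K : Modalities C
  G : StrongGradedMonad K
  base : S.Base → C

variable {C} {S}

namespace TypeModel

variable (N : TypeModel C S)

abbrev F (τ : ℕ) : C ⥤ C := N.K.F τ

abbrev P (τ : ℕ) : C ⥤ C := N.K.P τ

abbrev T (τ : ℕ) : C ⥤ C := N.G.T τ

/-- The interpretation of a value type. -/
abbrev ty (X : Ty S.Base) : C := tyObj N.K N.G.T N.base X

/-- The interpretation of the argument type of an operation. -/
abbrev argObj (o : S.Op) : C := N.ty (S.arg o).toTy

/-- The interpretation of the result type of an operation. -/
abbrev resObj (o : S.Op) : C := N.ty (S.res o).toTy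

/-- The domain `A_op × [τ_op] (B_op ⟹ T τ A)` of the algebraic operation `op`. -/
abbrev opDom (o : S.Op) (τ : ℕ) (A : C) : C :=
  N.argObj o ⊗ (N.F (S.dur o)).obj ((ihom (N.resObj o)).obj ((N.T τ).obj A))

/-- The object `(A_op × [τ_op] (B_op ⟹ T τ A)) ⟹ T (τ_op + τ) A` of operation clauses for `op`. -/
abbrev clauseObj (o : S.Op) (τ : ℕ) (A : C) : C :=
  (ihom (N.opDom o τ A)).obj ((N.T (S.dur o + τ)).obj A)

variable [HasProductsOfShape S.Op C] [HasProductsOfShape ℕ C]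

/-- The product of all `clauseObj o τ A`, for `o` an operation and `τ` a time grade. -/
abbrev handlerObj (A : C) : C :=
  ∏ᶜ fun o : S.Op => ∏ᶜ fun τ : ℕ => N.clauseObj o τ A

end TypeModel

variable (C S) in
/-- Models: in addition to the data interpreting types, there are interpretations of the constants,
algebraic operations for all `op` and for `delay`, and handling morphisms `χ`. -/
structure Model [HasProductsOfShape S.Op C] [HasProductsOfShape ℕ C] extends TypeModel C S where
  const : (f : S.Const) →
    ((∏ᶜ fun i : Fin (S.arity f) => toTypeModel.ty (S.dom f i).toTy) ⟶
      toTypeModel.ty (S.cod f).toTy)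
  op : (o : S.Op) → (τ : ℕ) →
    (toTypeModel.T τ ⋙ ihom (toTypeModel.resObj o) ⋙ toTypeModel.F (S.dur o) ⋙
      tensorLeft (toTypeModel.argObj o) ⟶ toTypeModel.T (S.dur o + τ))
  delay : (τ τ' : ℕ) → (toTypeModel.T τ' ⋙ toTypeModel.F τ ⟶ toTypeModel.T (τ + τ'))
  op_μ : ∀ (o : S.Op) (τ τ' : ℕ) (A : C),
    (op o τ).app ((G.T τ').obj A) ≫ (G.μ (S.dur o + τ) τ').app A =
      (toTypeModel.argObj o ◁
          (K.F (S.dur o)).map ((ihom (toTypeModel.resObj o)).map ((G.μ τ τ').app A))) ≫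
        (op o (τ + τ')).app A ≫ castT G.T (Nat.add_assoc (S.dur o) τ τ').symm A
  delay_μ : ∀ (τ τ' τ'' : ℕ) (A : C),
    (delay τ τ').app ((G.T τ'').obj A) ≫ (G.μ (τ + τ') τ'').app A =
      (K.F τ).map ((G.μ τ' τ'').app A) ≫ (delay τ (τ' + τ'')).app A ≫
        castT G.T (Nat.add_assoc τ τ' τ'').symm A
  op_str : ∀ (o : S.Op) (τ : ℕ) (A B : C),
    ((K.F (S.dur o + τ)).obj A ◁ (op o τ).app B) ≫ G.str (S.dur o + τ) A B =
      swapMid _ _ _ ≫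
        (toTypeModel.argObj o ◁
          (((K.δ (S.dur o) τ).hom.app A ▷ _) ≫
            K.m (S.dur o) ((K.F τ).obj A) ((ihom (toTypeModel.resObj o)).obj ((G.T τ).obj B)) ≫
            (K.F (S.dur o)).map (pushUnder _ _ _) ≫
            (K.F (S.dur o)).map ((ihom (toTypeModel.resObj o)).map (G.str τ A B)))) ≫
        (op o τ).app (A ⊗ B)
  delay_str : ∀ (τ τ' : ℕ) (A B : C),
    ((K.F (τ + τ')).obj A ◁ (delay τ τ').app B) ≫ G.str (τ + τ') A B =
      ((K.δ τ τ').hom.app A ▷ _) ≫ K.m τ ((K.F τ').obj A) ((G.T τ').obj B) ≫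
        (K.F τ).map (G.str τ' A B) ≫ (delay τ τ').app (A ⊗ B)
  χ : (τ τ' : ℕ) → (A : C) →
    (toTypeModel.handlerObj A ⟶ (ihom ((G.T τ).obj ((G.T τ').obj A))).obj ((G.T (τ + τ')).obj A))
  χ_η : ∀ (τ : ℕ) (A : C),
    (toTypeModel.handlerObj A ◁ G.η.app ((G.T τ).obj A)) ≫ uncurryR (χ 0 τ A) =
      snd _ _ ≫ castT G.T (Nat.zero_add τ).symm A
  χ_delay : ∀ (τ τ' τ'' : ℕ) (A : C),
    (toTypeModel.handlerObj A ◁ (delay τ τ').app ((G.T τ'').obj A)) ≫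
        uncurryR (χ (τ + τ') τ'' A) =
      ((K.adj τ).unit.app (toTypeModel.handlerObj A) ▷ _) ≫
        K.m τ ((K.P τ).obj (toTypeModel.handlerObj A)) ((G.T τ').obj ((G.T τ'').obj A)) ≫
        (K.F τ).map (K.epsPast τ (toTypeModel.handlerObj A) ▷ _) ≫
        (K.F τ).map (uncurryR (χ τ' τ'' A)) ≫
        (delay τ (τ' + τ'')).app A ≫ castT G.T (Nat.add_assoc τ τ' τ'').symm A
  χ_op : ∀ (o : S.Op) (τ τ' : ℕ) (A : C),
    (toTypeModel.handlerObj A ◁ (op o τ).app ((G.T τ').obj A)) ≫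
        uncurryR (χ (S.dur o + τ) τ' A) =
      lift (fst _ _ ≫ Pi.π (fun o : S.Op => ∏ᶜ fun τ : ℕ => toTypeModel.clauseObj o τ A) o ≫
          Pi.π (fun τ : ℕ => toTypeModel.clauseObj o τ A) (τ + τ')) (𝟙 _) ≫
        (toTypeModel.clauseObj o (τ + τ') A ◁
          (swapMid _ _ _ ≫
            (toTypeModel.argObj o ◁
              (((K.adj (S.dur o)).unit.app (toTypeModel.handlerObj A) ▷ _) ≫
                K.m (S.dur o) ((K.P (S.dur o)).obj (toTypeModel.handlerObj A))
                  ((ihom (toTypeModel.resObj o)).obj ((G.T τ).obj ((G.T τ').obj A))) ≫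
                (K.F (S.dur o)).map (K.epsPast (S.dur o) (toTypeModel.handlerObj A) ▷ _) ≫
                (K.F (S.dur o)).map (pushUnder _ _ _) ≫
                (K.F (S.dur o)).map
                  ((ihom (toTypeModel.resObj o)).map (uncurryR (χ τ τ' A))))))) ≫
        uncurryR (𝟙 (toTypeModel.clauseObj o (τ + τ') A)) ≫
        castT G.T (Nat.add_assoc (S.dur o) τ τ').symm A

/-! ## Interpretation of terms -/

namespace TypeModel

/-- The interpretation of contexts: the action on objects of the functor `⟦Γ⟧`. -/
def ctx (N : TypeModel C S) : Ctx S.Base → C → C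
  | .nil, A => A
  | .snoc Γ X, A => N.ctx Γ A ⊗ N.ty X
  | .mod Γ τ, A => (N.P τ).obj (N.ctx Γ A)

/-- The morphism `⟦Γ₁, x : X, Γ₂⟧ A ⟶ ⟦Γ₂⟧ (⟦Γ₁⟧ A × ⟦X⟧)`. -/
def split (N : TypeModel C S) (A : C) : {Γ : Ctx S.Base} → {X : Ty S.Base} → (x : Var Γ X) →
    (N.ctx Γ A ⟶ N.ctx x.after (N.ctx x.before A ⊗ N.ty X))
  | .snoc _ _, _, .here => 𝟙 _
  | .snoc _ Y, _, .there x => N.split A x ▷ N.ty Y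
  | .mod _ τ, _, .skip x => (N.P τ).map (N.split A x)

/-- The morphism `⟦Γ⟧ A ⟶ ⟨time Γ⟩ A` collapsing all temporal modalities in `Γ`. -/
def collapse (N : TypeModel C S) (A : C) : (Γ : Ctx S.Base) → (N.ctx Γ A ⟶ (N.P Γ.time).obj A)
  | .nil => N.K.η.hom.app A
  | .snoc Γ _ => fst _ _ ≫ N.collapse A Γ
  | .mod Γ τ =>
      (N.P τ).map (N.collapse A Γ) ≫ (N.K.μ τ Γ.time).hom.app A ≫
        pastLE N.K.Past (Nat.add_comm Γ.time τ).le A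

/-- The morphism `⟦Γ⟧ A ⟶ ⟨τ⟩ (⟦Γ - τ⟧ A)` collapsing `τ` worth of modalities in `Γ`. -/
def pra (N : TypeModel C S) (A : C) : (Γ : Ctx S.Base) → (τ : ℕ) → τ ≤ Γ.time →
    (N.ctx Γ A ⟶ (N.P τ).obj (N.ctx (Γ.minus τ) A))
  | .nil, 0, _ => N.K.η.hom.app _
  | .snoc Γ X, 0, _ => N.K.η.hom.app (N.ctx (Γ.snoc X) A)
  | .mod Γ τ', 0, _ => N.K.η.hom.app (N.ctx (Γ.mod τ') A)
  | .nil, n + 1, h => absurd h (Nat.not_succ_le_zero n)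
  | .snoc Γ _, n + 1, h => fst _ _ ≫ N.pra A Γ (n + 1) h
  | .mod Γ τ', n + 1, h =>
      iteInduction (c := n + 1 ≤ τ') (t := Ctx.mod Γ (τ' - (n + 1))) (e := Γ.minus (n + 1 - τ'))
        (motive := fun Δ => (N.ctx (Γ.mod τ') A ⟶ (N.P (n + 1)).obj (N.ctx Δ A)))
        (fun h' =>
          pastLE N.K.Past (Nat.add_sub_of_le h').le (N.ctx Γ A) ≫
            (N.K.μ (n + 1) (τ' - (n + 1))).inv.app (N.ctx Γ A))
        (fun h' =>
          (N.P τ').map (N.pra A Γ (n + 1 - τ') (Nat.sub_le_of_le_add h)) ≫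
            (N.K.μ τ' (n + 1 - τ')).hom.app _ ≫
            pastLE N.K.Past (Nat.add_sub_of_le (Nat.le_of_not_le h')).ge _)

/-- The interpretation of variables. -/
def var (N : TypeModel C S) {Γ : Ctx S.Base} {X : Ty S.Base} (x : Var Γ X) : N.ctx Γ (𝟙_ C) ⟶ N.ty X :=
  N.split (𝟙_ C) x ≫ N.collapse _ x.after ≫ N.K.epsPast x.after.time _ ≫ snd _ _

end TypeModel

namespace Model

variable [HasProductsOfShape S.Op C] [HasProductsOfShape ℕ C]

mutual

/-- The interpretation of values `Γ ⊢ V : X` as morphisms `⟦Γ⟧ 1 ⟶ ⟦X⟧`. -/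
def val (N : Model C S) {Γ : Ctx S.Base} {X : Ty S.Base} (V : Val S Γ X) : N.ctx Γ (𝟙_ C) ⟶ N.ty X :=
  match V with
  | .var x => N.var x
  | .const f V => Pi.lift (fun i => N.val (V i)) ≫ N.const f
  | .unit => toUnit _
  | .pair V W => lift (N.val V) (N.val W)
  | .lam M => curryR (N.comp M)
  | .box τ V => (N.K.adj τ).unit.app _ ≫ (N.F τ).map (N.val V)

/-- The interpretation of computations `Γ ⊢ M : X ! σ` as morphisms `⟦Γ⟧ 1 ⟶ T σ ⟦X⟧`. -/
def comp (N : Model C S) {Γ : Ctx S.Base} {X : Ty S.Base} {σ : ℕ} (M : Comp S Γ X σ) :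
    N.ctx Γ (𝟙_ C) ⟶ (N.T σ).obj (N.ty X) :=
  match M with
  | .ret V => N.val V ≫ N.G.η.app _
  | .letin (τ := τ) (τ' := τ') h M M' =>
      lift ((N.K.adj τ).unit.app _) (N.comp M) ≫ N.G.str τ _ _ ≫
        (N.T τ).map (N.comp M') ≫ (N.G.μ τ τ').app _ ≫ castT N.T h.symm _
  | .app V W => lift (N.val V) (N.val W) ≫ uncurryR (𝟙 _)
  | .pm V M => lift (𝟙 _) (N.val V) ≫ (α_ _ _ _).inv ≫ N.comp M
  | .opcall (τ := τ) o h V M =>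
      lift (N.val V) ((N.K.adj (S.dur o)).unit.app _) ≫
        (N.argObj o ◁ (N.F (S.dur o)).map (curryR (N.comp M))) ≫
        (N.op o τ).app _ ≫ castT N.T h.symm _
  | .delay (τ' := τ') τ h M =>
      (N.K.adj τ).unit.app _ ≫ (N.F τ).map (N.comp M) ≫ (N.delay τ τ').app _ ≫
        castT N.T h.symm _
  | .handle (Y := Y) (τ := τ) (τ' := τ') h M H M' =>
      lift (𝟙 _) (lift ((N.K.adj τ).unit.app _) (N.comp M)) ≫
        (_ ◁ N.G.str τ _ _) ≫
        (_ ◁ (N.T τ).map (N.comp M')) ≫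
        (Pi.lift (fun o => Pi.lift (fun τ'' =>
          (curryR ((α_ _ _ _).inv ≫ N.comp (H o τ'')) :
            _ ⟶ N.clauseObj o τ'' (N.ty Y)))) ▷ _) ≫
        uncurryR (N.χ τ τ' (N.ty Y)) ≫ castT N.T h.symm _
  | .unbox τ h V M =>
      lift (𝟙 _) (N.pra (𝟙_ C) _ τ h) ≫ (_ ◁ (N.P τ).map (N.val V)) ≫
        (_ ◁ (N.K.adj τ).counit.app _) ≫ N.comp M

end

end Model

end Semantics

end LambdaTau

end

attribute [reducible] LambdaTau.TypeModel.ctx LambdaTau.tyObj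

namespace LambdaTau

section ModalityLemmas

variable {C : Type u} [Category.{v} C]

theorem pastLE_refl (P : ℕᵒᵖ ⥤ C ⥤ C) {τ : ℕ} (h : τ ≤ τ) (A : C) : pastLE P h A = 𝟙 _ := by
  have : (homOfLE h).op = 𝟙 (Opposite.op τ) := Subsingleton.elim _ _
  rw [pastLE, this]; simp

theorem futLE_refl (P : ℕ ⥤ C ⥤ C) {τ : ℕ} (h : τ ≤ τ) (A : C) : futLE P h A = 𝟙 _ := by
  have : homOfLE h = 𝟙 τ := Subsingleton.elim _ _
  rw [futLE, this]; simp

namespace Modalities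

variable (K : Modalities C)

/-! The components of the structure morphisms, with their domains and codomains in normal form. -/

/-- `⟨τ ≤ τ'⟩` at an object. -/
def past {τ τ' : ℕ} (h : τ ≤ τ') (A : C) : (K.P τ').obj A ⟶ (K.P τ).obj A := pastLE K.Past h A

/-- `[τ ≤ τ']` at an object. -/
def fut {τ τ' : ℕ} (h : τ ≤ τ') (A : C) : (K.F τ).obj A ⟶ (K.F τ').obj A := futLE K.Fut h A

def ηh (A : C) : A ⟶ (K.P 0).obj A := K.η.hom.app A

def ηi (A : C) : (K.P 0).obj A ⟶ A := K.η.inv.app A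

def εh (A : C) : (K.F 0).obj A ⟶ A := K.ε.hom.app A

def εi (A : C) : A ⟶ (K.F 0).obj A := K.ε.inv.app A

def μh (τ τ' : ℕ) (A : C) : (K.P τ).obj ((K.P τ').obj A) ⟶ (K.P (τ + τ')).obj A :=
  (K.μ τ τ').hom.app A

def μi (τ τ' : ℕ) (A : C) : (K.P (τ + τ')).obj A ⟶ (K.P τ).obj ((K.P τ').obj A) :=
  (K.μ τ τ').inv.app A

def δh (τ τ' : ℕ) (A : C) : (K.F (τ + τ')).obj A ⟶ (K.F τ).obj ((K.F τ').obj A) :=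
  (K.δ τ τ').hom.app A

def δi (τ τ' : ℕ) (A : C) : (K.F τ).obj ((K.F τ').obj A) ⟶ (K.F (τ + τ')).obj A :=
  (K.δ τ τ').inv.app A

/-- The unit of `⟨τ⟩ ⊣ [τ]`. -/
def un (τ : ℕ) (A : C) : A ⟶ (K.F τ).obj ((K.P τ).obj A) := (K.adj τ).unit.app A

/-- The counit of `⟨τ⟩ ⊣ [τ]`. -/
def co (τ : ℕ) (A : C) : (K.P τ).obj ((K.F τ).obj A) ⟶ A := (K.adj τ).counit.app A

@[simp]
theorem past_refl {τ : ℕ} (h : τ ≤ τ) (A : C) : K.past h A = 𝟙 _ := pastLE_refl _ h A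

@[simp]
theorem fut_refl {τ : ℕ} (h : τ ≤ τ) (A : C) : K.fut h A = 𝟙 _ := futLE_refl _ h A

theorem past_trans {τ₁ τ₂ τ₃ : ℕ} (h : τ₁ ≤ τ₂) (h' : τ₂ ≤ τ₃) (A : C) :
    K.past h' A ≫ K.past h A = K.past (h.trans h') A := by
  rw [past, past, pastLE, pastLE, ← NatTrans.comp_app, ← Functor.map_comp]; rfl

theorem past_natural {τ₁ τ₂ : ℕ} (h : τ₁ ≤ τ₂) {A B : C} (f : A ⟶ B) :
    (K.P τ₂).map f ≫ K.past h B = K.past h A ≫ (K.P τ₁).map f :=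
  (K.Past.map (homOfLE h).op).naturality f

theorem fut_natural {τ₁ τ₂ : ℕ} (h : τ₁ ≤ τ₂) {A B : C} (f : A ⟶ B) :
    (K.F τ₁).map f ≫ K.fut h B = K.fut h A ≫ (K.F τ₂).map f :=
  (K.Fut.map (homOfLE h)).naturality f

theorem ηh_natural {A B : C} (f : A ⟶ B) : f ≫ K.ηh B = K.ηh A ≫ (K.P 0).map f :=
  K.η.hom.naturality f

theorem ηi_natural {A B : C} (f : A ⟶ B) : (K.P 0).map f ≫ K.ηi B = K.ηi A ≫ f :=
  K.η.inv.naturality f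

theorem εh_natural {A B : C} (f : A ⟶ B) : (K.F 0).map f ≫ K.εh B = K.εh A ≫ f :=
  K.ε.hom.naturality f

theorem εi_natural {A B : C} (f : A ⟶ B) : f ≫ K.εi B = K.εi A ≫ (K.F 0).map f :=
  K.ε.inv.naturality f

theorem μh_natural (τ τ' : ℕ) {A B : C} (f : A ⟶ B) :
    (K.P τ).map ((K.P τ').map f) ≫ K.μh τ τ' B = K.μh τ τ' A ≫ (K.P (τ + τ')).map f :=
  (K.μ τ τ').hom.naturality f

theorem μi_natural (τ τ' : ℕ) {A B : C} (f : A ⟶ B) :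
    (K.P (τ + τ')).map f ≫ K.μi τ τ' B = K.μi τ τ' A ≫ (K.P τ).map ((K.P τ').map f) :=
  (K.μ τ τ').inv.naturality f

theorem δi_natural (τ τ' : ℕ) {A B : C} (f : A ⟶ B) :
    (K.F τ).map ((K.F τ').map f) ≫ K.δi τ τ' B = K.δi τ τ' A ≫ (K.F (τ + τ')).map f :=
  (K.δ τ τ').inv.naturality f

theorem un_natural (τ : ℕ) {A B : C} (f : A ⟶ B) :
    f ≫ K.un τ B = K.un τ A ≫ (K.F τ).map ((K.P τ).map f) :=
  (K.adj τ).unit.naturality f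

theorem co_natural (τ : ℕ) {A B : C} (f : A ⟶ B) :
    (K.P τ).map ((K.F τ).map f) ≫ K.co τ B = K.co τ A ≫ f :=
  (K.adj τ).counit.naturality f

@[simp]
theorem map_un_co (τ : ℕ) (A : C) : (K.P τ).map (K.un τ A) ≫ K.co τ ((K.P τ).obj A) = 𝟙 _ :=
  (K.adj τ).left_triangle_components A

@[simp]
theorem ηh_ηi (A : C) : K.ηh A ≫ K.ηi A = 𝟙 _ := Iso.hom_inv_id_app K.η A

@[simp]
theorem ηh_ηi_assoc (A : C) {Z : C} (k : _ ⟶ Z) : K.ηh A ≫ K.ηi A ≫ k = k := by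
  rw [← Category.assoc, ηh_ηi, Category.id_comp]

@[simp]
theorem ηi_ηh (A : C) : K.ηi A ≫ K.ηh A = 𝟙 _ := Iso.inv_hom_id_app K.η A

@[simp]
theorem ηi_ηh_assoc (A : C) {Z : C} (k : _ ⟶ Z) : K.ηi A ≫ K.ηh A ≫ k = k := by
  rw [← Category.assoc, ηi_ηh, Category.id_comp]

@[simp]
theorem εi_εh (A : C) : K.εi A ≫ K.εh A = 𝟙 _ := Iso.inv_hom_id_app K.ε A

@[simp]
theorem εi_εh_assoc (A : C) {Z : C} (k : _ ⟶ Z) : K.εi A ≫ K.εh A ≫ k = k := by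
  rw [← Category.assoc, εi_εh, Category.id_comp]

@[simp]
theorem μh_μi (τ τ' : ℕ) (A : C) : K.μh τ τ' A ≫ K.μi τ τ' A = 𝟙 _ :=
  Iso.hom_inv_id_app (K.μ τ τ') A

@[simp]
theorem μh_μi_assoc (τ τ' : ℕ) (A : C) {Z : C} (k : _ ⟶ Z) : K.μh τ τ' A ≫ K.μi τ τ' A ≫ k = k := by
  rw [← Category.assoc, μh_μi, Category.id_comp]

@[simp]
theorem μi_μh (τ τ' : ℕ) (A : C) : K.μi τ τ' A ≫ K.μh τ τ' A = 𝟙 _ :=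
  Iso.inv_hom_id_app (K.μ τ τ') A

@[simp]
theorem μi_μh_assoc (τ τ' : ℕ) (A : C) {Z : C} (k : _ ⟶ Z) : K.μi τ τ' A ≫ K.μh τ τ' A ≫ k = k := by
  rw [← Category.assoc, μi_μh, Category.id_comp]

@[simp]
theorem δh_δi (τ τ' : ℕ) (A : C) : K.δh τ τ' A ≫ K.δi τ τ' A = 𝟙 _ :=
  Iso.hom_inv_id_app (K.δ τ τ') A

theorem epsPast_eq (τ : ℕ) (A : C) : K.epsPast τ A = K.past (Nat.zero_le τ) A ≫ K.ηi A := rfl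

theorem epsPast_zero (A : C) : K.epsPast 0 A = K.ηi A := by
  rw [epsPast_eq, past_refl, Category.id_comp]

theorem epsPast_natural (τ : ℕ) {A B : C} (f : A ⟶ B) :
    (K.P τ).map f ≫ K.epsPast τ B = K.epsPast τ A ≫ f := by
  rw [epsPast_eq, epsPast_eq, reassoc_of% K.past_natural, ηi_natural, Category.assoc]

theorem past_epsPast {τ τ' : ℕ} (h : τ ≤ τ') (A : C) :
    K.past h A ≫ K.epsPast τ A = K.epsPast τ' A := by
  rw [epsPast_eq, epsPast_eq, reassoc_of% K.past_trans]

theorem μh_mono {τ₁ τ₁' τ₂ τ₂' : ℕ} (h₁ : τ₁ ≤ τ₁') (h₂ : τ₂ ≤ τ₂') (A : C) :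
    K.past h₁ ((K.P τ₂').obj A) ≫ (K.P τ₁).map (K.past h₂ A) ≫ K.μh τ₁ τ₂ A =
      K.μh τ₁' τ₂' A ≫ K.past (Nat.add_le_add h₁ h₂) A :=
  K.μ_mono h₁ h₂ A

theorem μh_assoc (τ₁ τ₂ τ₃ : ℕ) (A : C) :
    K.μh τ₁ τ₂ ((K.P τ₃).obj A) ≫ K.μh (τ₁ + τ₂) τ₃ A =
      (K.P τ₁).map (K.μh τ₂ τ₃ A) ≫ K.μh τ₁ (τ₂ + τ₃) A ≫
        K.past (Nat.add_assoc τ₁ τ₂ τ₃).le A :=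
  K.μ_assoc τ₁ τ₂ τ₃ A

theorem μh_zero_left (τ : ℕ) (A : C) :
    K.μh 0 τ A = K.ηi _ ≫ K.past (Nat.zero_add τ).le A := by
  have h : K.ηh _ ≫ K.μh 0 τ A = K.past (Nat.zero_add τ).le A := K.μ_zero_left τ A
  rw [← h, ηi_ηh_assoc]

theorem μh_zero_right (τ : ℕ) (A : C) : K.μh τ 0 A = (K.P τ).map (K.ηi A) := by
  have h : (K.P τ).map (K.ηh A) ≫ K.μh τ 0 A = 𝟙 _ := K.μ_zero_right τ A
  rw [← Category.comp_id ((K.P τ).map (K.ηi A)), ← h, ← Functor.map_comp_assoc, ηi_ηh,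
    CategoryTheory.Functor.map_id]
  exact (Category.id_comp _).symm

theorem μi_zero_right (τ : ℕ) (A : C) : K.μi τ 0 A = (K.P τ).map (K.ηh A) := by
  rw [← Category.comp_id (K.μi τ 0 A), ← CategoryTheory.Functor.map_id, ← K.ηi_ηh, Functor.map_comp,
    ← μh_zero_right]
  exact K.μi_μh_assoc _ _ _ _

theorem map_μh_μh (τ₁ τ₂ τ₃ : ℕ) (A : C) :
    (K.P τ₁).map (K.μh τ₂ τ₃ A) ≫ K.μh τ₁ (τ₂ + τ₃) A =
      K.μh τ₁ τ₂ ((K.P τ₃).obj A) ≫ K.μh (τ₁ + τ₂) τ₃ A ≫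
        K.past (Nat.add_assoc τ₁ τ₂ τ₃).ge A := by
  rw [reassoc_of% K.μh_assoc, past_trans, past_refl, Category.comp_id]

theorem μi_assoc (τ₁ τ₂ τ₃ : ℕ) (A : C) :
    K.past (Nat.add_assoc τ₁ τ₂ τ₃).ge A ≫ K.μi τ₁ (τ₂ + τ₃) A ≫ (K.P τ₁).map (K.μi τ₂ τ₃ A) ≫
      K.μh τ₁ τ₂ ((K.P τ₃).obj A) = K.μi (τ₁ + τ₂) τ₃ A := by
  have h : K.μi τ₁ (τ₂ + τ₃) A ≫ (K.P τ₁).map (K.μi τ₂ τ₃ A) ≫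
      K.μh τ₁ τ₂ ((K.P τ₃).obj A) ≫ K.μh (τ₁ + τ₂) τ₃ A = K.past (Nat.add_assoc τ₁ τ₂ τ₃).le A := by
    rw [μh_assoc, ← Functor.map_comp_assoc, μi_μh, CategoryTheory.Functor.map_id, Category.id_comp,
      μi_μh_assoc]
  have h' := reassoc_of% h
  rw [← Category.comp_id (K.μh τ₁ τ₂ _), ← K.μh_μi, h', reassoc_of% K.past_trans, past_refl,
    Category.id_comp]

theorem epsPast_left (τ τ' : ℕ) (A : C) :
    K.epsPast τ ((K.P τ').obj A) = K.μh τ τ' A ≫ K.past (Nat.le_add_left τ' τ) A := by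
  have h := reassoc_of% (K.μh_mono (Nat.zero_le τ) (le_refl τ') A)
  replace h := h (K.past (Nat.zero_add τ').ge A)
  simpa [μh_zero_left, past_trans, epsPast_eq] using h

theorem epsPast_right (τ τ' : ℕ) (A : C) :
    (K.P τ).map (K.epsPast τ' A) = K.μh τ τ' A ≫ K.past (Nat.le_add_right τ τ') A := by
  have h := K.μh_mono (le_refl τ) (Nat.zero_le τ') A
  rwa [past_refl, Category.id_comp, μh_zero_right, ← Functor.map_comp] at h

theorem μh_epsPast (τ τ' : ℕ) (A : C) :
    K.μh τ τ' A ≫ K.epsPast (τ + τ') A = K.epsPast τ ((K.P τ').obj A) ≫ K.epsPast τ' A := by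
  rw [epsPast_left, Category.assoc, past_epsPast]

theorem un_epsPast (τ : ℕ) (A : C) :
    K.un τ A ≫ (K.F τ).map (K.epsPast τ A) = K.εi A ≫ K.fut (Nat.zero_le τ) A := by
  have h : K.εh ((K.P 0).obj A) ≫ K.ηi A ≫ K.un τ A ≫ (K.F τ).map (K.past (Nat.zero_le τ) A) =
    K.fut (Nat.zero_le τ) ((K.P 0).obj A) := K.unit_zero_le τ A
  have h' : K.un τ A ≫ (K.F τ).map (K.past (Nat.zero_le τ) A) =
      K.ηh A ≫ K.εi _ ≫ K.fut (Nat.zero_le τ) ((K.P 0).obj A) := by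
    rw [← h, εi_εh_assoc, ηh_ηi_assoc]
  rw [epsPast_eq, Functor.map_comp, reassoc_of% h', ← fut_natural, reassoc_of% K.εi_natural,
    ← Functor.map_comp_assoc, ηh_ηi, CategoryTheory.Functor.map_id, Category.id_comp]

/-- Opening a box and closing it again. -/
theorem co_un_epsPast (τ : ℕ) (A : C) :
    K.co τ A ≫ K.un τ A ≫ (K.F τ).map (K.epsPast τ A) = K.epsPast τ ((K.F τ).obj A) := by
  have h : K.co τ A ≫ K.εi A ≫ K.ηh _ ≫ (K.P 0).map (K.fut (Nat.zero_le τ) A) =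
    K.past (Nat.zero_le τ) ((K.F τ).obj A) := K.counit_zero_le τ A
  rw [un_epsPast, epsPast_eq, ← h]
  simp [ηi_natural]

theorem un_zero (A : C) : K.un 0 A = K.εi A ≫ (K.F 0).map (K.ηh A) := by
  have h := K.un_epsPast 0 A
  rw [epsPast_zero, fut_refl, Category.comp_id] at h
  rw [← h, Category.assoc, ← Functor.map_comp, ηi_ηh, CategoryTheory.Functor.map_id, Category.comp_id]

/-- Future and past accumulate in the same way along the adjunctions. -/
theorem un_δh (τ τ' : ℕ) (A : C) :
    K.un (τ + τ') A ≫ K.δh τ τ' _ =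
      K.un τ A ≫ (K.F τ).map (K.un τ' _) ≫ (K.F τ).map ((K.F τ').map
        (K.μh τ' τ A ≫ K.past (Nat.add_comm τ τ').le A)) :=
  (K.unit_add τ τ' A).symm

section Monoidality

variable [CartesianMonoidalCategory C]

@[simp]
theorem m_fst (τ : ℕ) (A B : C) : K.m τ A B ≫ (K.F τ).map (fst A B) = fst _ _ := by
  rw [m, ← Adjunction.homEquiv_naturality_right, lift_fst]
  exact ((K.adj τ).homEquiv_apply_eq _ _).2 (by simp [Adjunction.homEquiv_counit])

@[simp]
theorem m_snd (τ : ℕ) (A B : C) : K.m τ A B ≫ (K.F τ).map (snd A B) = snd _ _ := by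
  rw [m, ← Adjunction.homEquiv_naturality_right, lift_snd]
  exact ((K.adj τ).homEquiv_apply_eq _ _).2 (by simp [Adjunction.homEquiv_counit])

theorem map_prod_ext (τ : ℕ) {X A B : C} {f g : X ⟶ (K.F τ).obj (A ⊗ B)}
    (h₁ : f ≫ (K.F τ).map (fst A B) = g ≫ (K.F τ).map (fst A B))
    (h₂ : f ≫ (K.F τ).map (snd A B) = g ≫ (K.F τ).map (snd A B)) : f = g := by
  apply ((K.adj τ).homEquiv _ _).symm.injective
  apply CartesianMonoidalCategory.hom_ext
  · rw [← Adjunction.homEquiv_naturality_right_symm, h₁, Adjunction.homEquiv_naturality_right_symm]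
  · rw [← Adjunction.homEquiv_naturality_right_symm, h₂, Adjunction.homEquiv_naturality_right_symm]

theorem lift_map_m (τ : ℕ) {X D A B : C} (h : X ⟶ (K.F τ).obj D) (f : D ⟶ A) (g : D ⟶ B) :
    lift (h ≫ (K.F τ).map f) (h ≫ (K.F τ).map g) ≫ K.m τ A B = h ≫ (K.F τ).map (lift f g) := by
  apply K.map_prod_ext <;> simp [← Functor.map_comp]

end Monoidality

end Modalities

end ModalityLemmas

section TimeTravel

variable {B : Type w}

theorem Ctx.minus_zero (Γ : Ctx B) : Γ.minus 0 = Γ := by cases Γ <;> rfl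

theorem Ctx.minus_snoc (Γ : Ctx B) (X : Ty B) {τ : ℕ} (hτ : 0 < τ) :
    (Γ.snoc X).minus τ = Γ.minus τ := by
  cases τ with
  | zero => exact absurd hτ (lt_irrefl 0)
  | succ n => rfl

theorem Ctx.minus_mod_add (Γ : Ctx B) {τ τ' c : ℕ} (e : τ' = τ + c) :
    (Γ.mod τ').minus τ = Γ.mod c := by
  cases τ with
  | zero => obtain rfl : τ' = c := by omega
            rfl
  | succ n => rw [Ctx.minus, if_pos (by omega)]; congr 1; omega

theorem Ctx.minus_mod_sub (Γ : Ctx B) {τ τ' c : ℕ} (e : τ = τ' + c) (hc : 0 < c) :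
    (Γ.mod τ').minus τ = Γ.minus c := by
  cases τ with
  | zero => omega
  | succ n => rw [Ctx.minus, if_neg (by omega)]; congr 1; omega

/-- `Var.ofMinus`, along an equation for the context `Γ - τ`. -/
def Var.goBack {Γ Δ : Ctx B} {τ : ℕ} (hΔ : Γ.minus τ = Δ) {X : Ty B} (x : Var Δ X) : Var Γ X :=
  Var.ofMinus Γ τ (cast (congrArg (Var · X) hΔ.symm) x)

theorem Var.goBack_zero {Γ : Ctx B} (h : Γ.minus 0 = Γ) {X : Ty B} (x : Var Γ X) :
    Var.goBack h x = x := by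
  cases Γ <;> rfl

theorem Var.goBack_snoc {Γ Δ : Ctx B} {Y : Ty B} {τ : ℕ} (hτ : 0 < τ)
    (h : (Γ.snoc Y).minus τ = Δ) (h' : Γ.minus τ = Δ) {X : Ty B} (x : Var Δ X) :
    Var.goBack h x = .there (Var.goBack h' x) := by
  cases τ with
  | zero => exact absurd hτ (lt_irrefl 0)
  | succ n => rfl

theorem Var.goBack_mod_add {Γ : Ctx B} {τ τ' c : ℕ} (e : τ' = τ + c)
    (h : (Γ.mod τ').minus τ = Γ.mod c) {X : Ty B} (x : Var Γ X) :
    Var.goBack h (.skip x) = .skip x := by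
  cases τ with
  | zero =>
    obtain rfl : τ' = c := by omega
    rfl
  | succ n =>
    have key : ∀ (d : Decidable (n + 1 ≤ τ')) (f : n + 1 ≤ τ' → Var (Γ.mod (τ' - (n + 1))) X → Var (Γ.mod τ') X)
        (g : ¬ n + 1 ≤ τ' → Var (Γ.minus (n + 1 - τ')) X → Var (Γ.mod τ') X)
        (h : @ite _ (n + 1 ≤ τ') d (Ctx.mod Γ (τ' - (n + 1))) (Γ.minus (n + 1 - τ')) = Γ.mod c),
        (∀ h' z, f h' (.skip z) = .skip z) → iteInduction (c := n + 1 ≤ τ') (t := Ctx.mod Γ (τ' - (n + 1)))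
          (e := Γ.minus (n + 1 - τ'))
          (motive := fun Δ => Var Δ X → Var (Γ.mod τ') X)
          f g (cast (congrArg (Var · X) h.symm) (Var.skip x)) =
            .skip x := by
      intro d f g h hfg
      cases d with
      | isTrue h' =>
        obtain rfl : τ' - (n + 1) = c := by omega
        exact hfg _ _
      | isFalse h' => omega
    exact (Var.ofMinus.eq_6 _ _ _ _ _).trans (key _ _ _ h fun _ _ => rfl)

theorem Var.goBack_mod_sub {Γ Δ : Ctx B} {τ τ' c : ℕ} (e : τ = τ' + c) (hc : 0 < c)
    (h : (Γ.mod τ').minus τ = Δ) (h' : Γ.minus c = Δ) {X : Ty B} (x : Var Δ X) :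
    Var.goBack h x = .skip (Var.goBack h' x) := by
  cases τ with
  | zero => omega
  | succ n =>
    obtain rfl : c = n + 1 - τ' := by omega
    subst h'
    have key : ∀ (d : Decidable (n + 1 ≤ τ')) (f : n + 1 ≤ τ' → Var (Γ.mod (τ' - (n + 1))) X → Var (Γ.mod τ') X)
        (g : ¬ n + 1 ≤ τ' → Var (Γ.minus (n + 1 - τ')) X → Var (Γ.mod τ') X)
        (h : @ite _ (n + 1 ≤ τ') d (Ctx.mod Γ (τ' - (n + 1))) (Γ.minus (n + 1 - τ')) =
          Γ.minus (n + 1 - τ')),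
        (∀ h' z, g h' z = .skip (Var.ofMinus Γ _ z)) → iteInduction (c := n + 1 ≤ τ') (t := Ctx.mod Γ (τ' - (n + 1)))
          (e := Γ.minus (n + 1 - τ'))
          (motive := fun Δ => Var Δ X → Var (Γ.mod τ') X)
          f g (cast (congrArg (Var · X) h.symm) x) =
            .skip (Var.goBack rfl x) := by
      intro d f g h hfg
      cases d with
      | isTrue h' => omega
      | isFalse h' => exact hfg _ _
    exact (Var.ofMinus.eq_6 _ _ _ _ _).trans (key _ _ _ h fun _ _ => rfl)

theorem Ctx.minus_minus (Γ : Ctx B) : ∀ (τ τ' : ℕ), (Γ.minus τ).minus τ' = Γ.minus (τ + τ') := by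
  induction Γ with
  | nil =>
    intro τ τ'
    have h : ∀ τ, (Ctx.nil : Ctx B).minus τ = .nil := fun τ => by cases τ <;> rfl
    rw [h, h, h]
  | snoc Γ X ih =>
    intro τ τ'
    obtain rfl | hτ := Nat.eq_zero_or_pos τ
    · rw [Ctx.minus_zero, Nat.zero_add]
    · rw [Ctx.minus_snoc _ _ hτ, ih, Ctx.minus_snoc _ _ (by omega)]
  | mod Γ κ ih =>
    intro τ τ'
    obtain hτ | hτ := le_or_gt τ κ
    · obtain ⟨c, e₁⟩ := Nat.exists_eq_add_of_le hτ
      rw [Ctx.minus_mod_add Γ e₁]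
      obtain hc | hc := le_or_gt τ' c
      · obtain ⟨d, e₂⟩ := Nat.exists_eq_add_of_le hc
        rw [Ctx.minus_mod_add Γ e₂, Ctx.minus_mod_add Γ (c := d) (by omega)]
      · obtain ⟨d, e₂⟩ := Nat.exists_eq_add_of_lt hc
        rw [Ctx.minus_mod_sub Γ (c := d + 1) e₂ d.succ_pos,
          Ctx.minus_mod_sub Γ (c := d + 1) (by omega) d.succ_pos]
    · obtain ⟨c, e₁⟩ := Nat.exists_eq_add_of_lt hτ
      rw [Ctx.minus_mod_sub Γ (c := c + 1) e₁ c.succ_pos, ih,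
        Ctx.minus_mod_sub Γ (c := c + 1 + τ') (by omega) (by omega)]

theorem Var.goBack_goBack (Γ : Ctx B) : ∀ {Δ Θ : Ctx B} {τ τ' σ : ℕ} (_ : σ = τ + τ')
    (hΔ : Γ.minus τ = Δ) (hΘ : Δ.minus τ' = Θ) (hΘ' : Γ.minus σ = Θ) {X : Ty B} (x : Var Θ X),
    Var.goBack hΔ (Var.goBack hΘ x) = Var.goBack hΘ' x := by
  have zero : ∀ {Γ Δ Θ : Ctx B} {τ' σ : ℕ} (_ : σ = 0 + τ')
    (hΔ : Γ.minus 0 = Δ) (hΘ : Δ.minus τ' = Θ) (hΘ' : Γ.minus σ = Θ) {X : Ty B} (x : Var Θ X),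
    Var.goBack hΔ (Var.goBack hΘ x) = Var.goBack hΘ' x := by
    intro Γ Δ Θ τ' σ e hΔ hΘ hΘ' X x
    obtain rfl : σ = τ' := e.trans (Nat.zero_add τ')
    obtain rfl := (Ctx.minus_zero _).symm.trans hΔ
    rw [Var.goBack_zero]
  induction Γ with
  | nil =>
    intro Δ Θ τ τ' σ e hΔ hΘ hΘ' X x
    nomatch Var.goBack hΔ (Var.goBack hΘ x)
  | snoc Γ Y ih =>
    intro Δ Θ τ τ' σ e hΔ hΘ hΘ' X x
    obtain rfl | hτ := Nat.eq_zero_or_pos τ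
    · exact zero e hΔ hΘ hΘ' x
    · have hσ : 0 < σ := by omega
      have hΔ' := (Γ.minus_snoc Y hτ).symm.trans hΔ
      have hΘ'' := (Γ.minus_snoc Y hσ).symm.trans hΘ'
      rw [Var.goBack_snoc hτ hΔ hΔ', Var.goBack_snoc hσ hΘ' hΘ'', ih e hΔ' hΘ hΘ'']
  | mod Γ κ ih =>
    intro Δ Θ τ τ' σ e hΔ hΘ hΘ' X x
    obtain hτ | hτ := le_or_gt τ κ
    · obtain ⟨c, e₁⟩ := Nat.exists_eq_add_of_le hτ
      obtain rfl := (Ctx.minus_mod_add Γ e₁).symm.trans hΔ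
      obtain hc | hc := le_or_gt τ' c
      · obtain ⟨d, e₂⟩ := Nat.exists_eq_add_of_le hc
        obtain rfl := (Ctx.minus_mod_add Γ e₂).symm.trans hΘ
        cases x with | skip x => ?_
        rw [Var.goBack_mod_add e₂, Var.goBack_mod_add e₁, Var.goBack_mod_add (by omega)]
      · obtain ⟨d, e₂⟩ := Nat.exists_eq_add_of_lt hc
        replace e₂ : τ' = c + (d + 1) := e₂
        have hΘ₁ := (Ctx.minus_mod_sub Γ e₂ d.succ_pos).symm.trans hΘ
        rw [Var.goBack_mod_sub e₂ d.succ_pos hΘ hΘ₁, Var.goBack_mod_add e₁,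
          Var.goBack_mod_sub (by omega) d.succ_pos hΘ' hΘ₁]
    · obtain ⟨c, e₁⟩ := Nat.exists_eq_add_of_lt hτ
      replace e₁ : τ = κ + (c + 1) := e₁
      have hΔ₁ := (Ctx.minus_mod_sub Γ e₁ c.succ_pos).symm.trans hΔ
      have e₂ : σ = κ + (c + 1 + τ') := by omega
      have hc : 0 < c + 1 + τ' := by omega
      have hΘ₁ := (Ctx.minus_mod_sub Γ e₂ hc).symm.trans hΘ'
      rw [Var.goBack_mod_sub e₁ c.succ_pos hΔ hΔ₁, Var.goBack_mod_sub e₂ hc hΘ' hΘ₁,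
        ih rfl hΔ₁ hΘ hΘ₁]

theorem Var.goBack_injective : {Γ Δ : Ctx B} → {τ : ℕ} → (h : Γ.minus τ = Δ) → {X : Ty B} →
    Function.Injective (Var.goBack h (X := X))
  | Γ, Δ, 0, h, X, x, y, hxy => by
    obtain rfl : Γ = Δ := (Ctx.minus_zero Γ).symm.trans h
    rwa [Var.goBack_zero, Var.goBack_zero] at hxy
  | .nil, Δ, n + 1, h, X, x, y, hxy => by
    cases h
    nomatch x
  | .snoc Γ Y, Δ, n + 1, h, X, x, y, hxy => by
    rw [Var.goBack_snoc n.succ_pos h h, Var.goBack_snoc n.succ_pos h h] at hxy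
    exact Var.goBack_injective (Γ := Γ) h (Var.there.inj hxy)
  | .mod Γ τ', Δ, n + 1, h, X, x, y, hxy => by
    by_cases h' : n + 1 ≤ τ'
    · obtain ⟨c, e⟩ := Nat.exists_eq_add_of_le h'
      obtain rfl := h.symm.trans (Ctx.minus_mod_add Γ e)
      cases x; cases y
      rw [Var.goBack_mod_add e, Var.goBack_mod_add e] at hxy
      exact congrArg Var.skip (Var.skip.inj hxy)
    · obtain ⟨c, e⟩ := Nat.exists_eq_add_of_le (Nat.le_of_not_le h')
      have hc : 0 < c := by omega
      have h'' := (Ctx.minus_mod_sub Γ e hc).symm.trans h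
      rw [Var.goBack_mod_sub e hc h h'', Var.goBack_mod_sub e hc h h''] at hxy
      exact Var.goBack_injective h'' (Var.skip.inj hxy)

theorem Var.goBack_toMinus {Γ : Ctx B} {X : Ty B} (x : Var Γ X) (τ : ℕ) (hx : τ ≤ x.age) :
    Var.goBack rfl (x.toMinus τ hx) = x := by
  induction x generalizing τ with
  | here =>
    cases τ with
    | zero => rfl
    | succ n => exact absurd hx (Nat.not_succ_le_zero n)
  | there x ih =>
    cases τ with
    | zero => rfl
    | succ n => exact congrArg Var.there (ih (n + 1) hx)
  | @skip Γ X τ' x ih =>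
    cases τ with
    | zero => rfl
    | succ n =>
      have key : ∀ (d : Decidable (n + 1 ≤ τ')) (f : n + 1 ≤ τ' → Var (Γ.mod (τ' - (n + 1))) X → Var (Γ.mod τ') X)
        (g : ¬ n + 1 ≤ τ' → Var (Γ.minus (n + 1 - τ')) X → Var (Γ.mod τ') X),
          (∀ h' z, f h' (.skip z) = .skip z) → (∀ h' z, g h' z = .skip (Var.ofMinus Γ _ z)) →
          iteInduction (c := n + 1 ≤ τ') (t := Ctx.mod Γ (τ' - (n + 1)))
            (e := Γ.minus (n + 1 - τ'))
            (motive := fun Δ => Var Δ X → Var (Γ.mod τ') X)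
            f g
            (iteInduction (c := n + 1 ≤ τ') (t := Ctx.mod Γ (τ' - (n + 1)))
              (e := Γ.minus (n + 1 - τ'))
              (motive := fun Δ => Var Δ X)
              (fun _ => .skip x)
              (fun _ => x.toMinus (n + 1 - τ') (Nat.sub_le_of_le_add hx))) = Var.skip x := by
        intro d f g hf hg
        cases d with
        | isTrue h' => exact hf _ _
        | isFalse h' => exact (hg _ _).trans (congrArg Var.skip (ih (n + 1 - τ') (Nat.sub_le_of_le_add hx)))
      exact (Var.ofMinus.eq_6 _ _ _ _ _).trans
        ((congrArg _ (Var.toMinus.eq_6 _ _ _ _ _ _)).trans (key _ _ _ (fun _ _ => rfl) fun _ _ => rfl))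

@[ext]
theorem Ren.ext {Γ Δ : Ctx B} {ρ ρ' : Ren Γ Δ}
    (h : ∀ (X : Ty B) (x : Var Γ X), ρ.map x = ρ'.map x) : ρ = ρ' := by
  obtain ⟨f, _, _⟩ := ρ
  obtain ⟨g, _, _⟩ := ρ'
  obtain rfl : @f = @g := by funext X x; exact h X x
  rfl

namespace Ren

variable {Γ Δ Θ : Ctx B}

/-- The identity renaming. -/
def id (Γ : Ctx B) : Ren Γ Γ where
  map x := x
  age_le _ := le_rfl
  time_le := le_rfl

/-- `Γ ⇝ Δ - τ` from `Γ, ⟨τ⟩ ⇝ Δ`. -/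
def unmod {τ : ℕ} (ρ : Ren (Γ.mod τ) Δ) : Ren Γ (Δ.minus τ) where
  map x := (ρ.map (.skip x)).toMinus τ ((Nat.le_add_left _ _).trans (ρ.age_le (.skip x)))
  age_le x := by
    have : x.age + τ ≤ (ρ.map (.skip x)).age := ρ.age_le (.skip x)
    rw [Var.age_toMinus]
    omega
  time_le := by
    have : Γ.time + τ ≤ Δ.time := ρ.time_le
    rw [Ctx.time_minus]
    omega

theorem time_le_of_mod {τ : ℕ} (ρ : Ren (Γ.mod τ) Δ) : τ ≤ Δ.time :=
  (Nat.le_add_left _ _).trans ρ.time_le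

theorem goBack_unmod {τ : ℕ} (ρ : Ren (Γ.mod τ) Δ) {X : Ty B} (x : Var Γ X) :
    Var.goBack rfl (ρ.unmod.map x) = ρ.map (.skip x) :=
  Var.goBack_toMinus _ _ _

theorem goBack_minus (ρ : Ren Γ Δ) (τ : ℕ) {X : Ty B} (x : Var (Γ.minus τ) X) :
    Var.goBack rfl ((ρ.minus τ).map x) = ρ.map (Var.goBack rfl x) :=
  Var.goBack_toMinus _ _ _

end Ren

end TimeTravel

section

variable {C : Type u} [Category.{v} C] [CartesianMonoidalCategory C] [MonoidalClosed C]
variable {S : Signature.{w}} (N : TypeModel C S)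

namespace TypeModel

/-- The morphism `pra`, along an equation for the context `Γ - τ`. -/
def praTo {Γ Δ : Ctx S.Base} {τ : ℕ} (hΔ : Γ.minus τ = Δ) (h : τ ≤ Γ.time) (A : C) :
    N.ctx Γ A ⟶ (N.K.P τ).obj (N.ctx Δ A) :=
  hΔ ▸ N.pra A Γ τ h

theorem praTo_rfl {Γ : Ctx S.Base} {τ : ℕ} (h : τ ≤ Γ.time) (A : C) :
    N.praTo rfl h A = N.pra A Γ τ h := rfl

theorem praTo_zero {Γ : Ctx S.Base} (hΓ : Γ.minus 0 = Γ) (h : 0 ≤ Γ.time) (A : C) :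
    N.praTo hΓ h A = N.K.ηh (N.ctx Γ A) := by
  cases Γ <;> rfl

theorem praTo_snoc {Γ Δ : Ctx S.Base} {Y : Ty S.Base} {τ : ℕ} (hτ : 0 < τ)
    (hΔ : (Γ.snoc Y).minus τ = Δ) (hΔ' : Γ.minus τ = Δ) (h : τ ≤ (Γ.snoc Y).time) (A : C) :
    N.praTo hΔ h A = fst (N.ctx Γ A) (N.ty Y) ≫ N.praTo hΔ' h A := by
  cases τ with
  | zero => exact absurd hτ (lt_irrefl 0)
  | succ n => subst hΔ'; rfl

theorem praTo_mod_add {Γ : Ctx S.Base} {τ τ' c : ℕ} (e : τ' = τ + c)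
    (hΔ : (Γ.mod τ').minus τ = Γ.mod c) (h : τ ≤ (Γ.mod τ').time) (A : C) :
    N.praTo hΔ h A = N.K.past e.ge (N.ctx Γ A) ≫ N.K.μi τ c (N.ctx Γ A) := by
  cases τ with
  | zero =>
    obtain rfl : τ' = c := by omega
    have h₁ : N.praTo hΔ h A = N.K.ηh _ := rfl
    have h₂ : N.K.ηh _ = N.K.ηh _ ≫ N.K.μh 0 τ' (N.ctx Γ A) ≫ N.K.μi 0 τ' (N.ctx Γ A) := by
      rw [N.K.μh_μi, Category.comp_id]
    rw [N.K.μh_zero_left, Category.assoc, N.K.ηh_ηi_assoc] at h₂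
    exact h₁.trans h₂
  | succ n =>
    have key : ∀ (d : Decidable (n + 1 ≤ τ'))
        (hΔ : @ite _ (n + 1 ≤ τ') d (Ctx.mod Γ (τ' - (n + 1))) (Γ.minus (n + 1 - τ')) = Γ.mod c),
        (hΔ ▸ iteInduction (c := n + 1 ≤ τ') (t := Ctx.mod Γ (τ' - (n + 1)))
          (e := Γ.minus (n + 1 - τ'))
          (motive := fun Δ => (N.ctx (Γ.mod τ') A ⟶ (N.P (n + 1)).obj (N.ctx Δ A)))
          (fun h' =>
            pastLE N.K.Past (Nat.add_sub_of_le h').le (N.ctx Γ A) ≫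
              (N.K.μ (n + 1) (τ' - (n + 1))).inv.app (N.ctx Γ A))
          (fun h' =>
            (N.P τ').map (N.pra A Γ (n + 1 - τ') (Nat.sub_le_of_le_add h)) ≫
              (N.K.μ τ' (n + 1 - τ')).hom.app _ ≫
              pastLE N.K.Past (Nat.add_sub_of_le (Nat.le_of_not_le h')).ge _) :
          N.ctx (Γ.mod τ') A ⟶ (N.P (n + 1)).obj (N.ctx (Γ.mod c) A)) =
        N.K.past e.ge (N.ctx Γ A) ≫ N.K.μi (n + 1) c (N.ctx Γ A) := by
      intro d hΔ
      cases d with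
      | isTrue h' =>
        obtain rfl : τ' - (n + 1) = c := by omega
        rfl
      | isFalse h' => omega
    exact key _ hΔ

theorem praTo_mod_sub {Γ Δ : Ctx S.Base} {τ τ' c : ℕ} (e : τ = τ' + c) (hc : 0 < c)
    (hΔ : (Γ.mod τ').minus τ = Δ) (hΔ' : Γ.minus c = Δ) (h : τ ≤ (Γ.mod τ').time)
    (h' : c ≤ Γ.time) (A : C) :
    N.praTo hΔ h A = (N.K.P τ').map (N.praTo hΔ' h' A) ≫ N.K.μh τ' c (N.ctx Δ A) ≫
      N.K.past e.le (N.ctx Δ A) := by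
  cases τ with
  | zero => omega
  | succ n =>
    obtain rfl : c = n + 1 - τ' := by omega
    subst hΔ'
    have key : ∀ (d : Decidable (n + 1 ≤ τ'))
        (hΔ : @ite _ (n + 1 ≤ τ') d (Ctx.mod Γ (τ' - (n + 1))) (Γ.minus (n + 1 - τ')) =
          Γ.minus (n + 1 - τ')),
        (hΔ ▸ iteInduction (c := n + 1 ≤ τ') (t := Ctx.mod Γ (τ' - (n + 1)))
          (e := Γ.minus (n + 1 - τ'))
          (motive := fun Δ => (N.ctx (Γ.mod τ') A ⟶ (N.P (n + 1)).obj (N.ctx Δ A)))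
          (fun h' =>
            pastLE N.K.Past (Nat.add_sub_of_le h').le (N.ctx Γ A) ≫
              (N.K.μ (n + 1) (τ' - (n + 1))).inv.app (N.ctx Γ A))
          (fun h' =>
            (N.P τ').map (N.pra A Γ (n + 1 - τ') (Nat.sub_le_of_le_add h)) ≫
              (N.K.μ τ' (n + 1 - τ')).hom.app _ ≫
              pastLE N.K.Past (Nat.add_sub_of_le (Nat.le_of_not_le h')).ge _) :
          N.ctx (Γ.mod τ') A ⟶ (N.P (n + 1)).obj (N.ctx (Γ.minus (n + 1 - τ')) A)) =
        (N.K.P τ').map (N.praTo rfl h' A) ≫ N.K.μh τ' (n + 1 - τ') _ ≫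
          N.K.past e.le _ := by
      intro d hΔ
      cases d with
      | isTrue h' => omega
      | isFalse h' => rfl
    exact key _ hΔ

end TypeModel

end

section

variable {C : Type u} [Category.{v} C] [CartesianMonoidalCategory C] [MonoidalClosed C]
variable {S : Signature.{w}} (N : TypeModel C S)

namespace TypeModel


theorem ctx_nil_ext {D : C} (f g : D ⟶ N.ctx .nil (𝟙_ C)) : f = g :=
  CartesianMonoidalCategory.toUnit_unique f g

theorem praTo_praTo (Γ : Ctx S.Base) : ∀ {Δ Θ : Ctx S.Base} {τ τ' σ : ℕ} (e : σ = τ + τ')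
    (hΔ : Γ.minus τ = Δ) (hΘ : Δ.minus τ' = Θ) (hΘ' : Γ.minus σ = Θ) (h : τ ≤ Γ.time)
    (h' : τ' ≤ Δ.time) (h'' : σ ≤ Γ.time) (A : C),
    N.praTo hΔ h A ≫ (N.K.P τ).map (N.praTo hΘ h' A) ≫ N.K.μh τ τ' (N.ctx Θ A) ≫
      N.K.past e.le (N.ctx Θ A) = N.praTo hΘ' h'' A := by
  have left : ∀ {Γ Δ Θ : Ctx S.Base} {τ' σ : ℕ} (e : σ = 0 + τ')
    (hΔ : Γ.minus 0 = Δ) (hΘ : Δ.minus τ' = Θ) (hΘ' : Γ.minus σ = Θ) (h : 0 ≤ Γ.time)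
    (h' : τ' ≤ Δ.time) (h'' : σ ≤ Γ.time) (A : C),
    N.praTo hΔ h A ≫ (N.K.P 0).map (N.praTo hΘ h' A) ≫ N.K.μh 0 τ' (N.ctx Θ A) ≫
      N.K.past e.le (N.ctx Θ A) = N.praTo hΘ' h'' A := by
    intro Γ Δ Θ τ' σ e hΔ hΘ hΘ' h h' h'' A
    obtain rfl : σ = τ' := e.trans (Nat.zero_add τ')
    obtain rfl := (Ctx.minus_zero _).symm.trans hΔ
    rw [N.praTo_zero, ← reassoc_of% N.K.ηh_natural, N.K.μh_zero_left]
    simp [N.K.past_trans]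
  induction Γ with
  | nil =>
    intro Δ Θ τ τ' σ e hΔ hΘ hΘ' h h' h'' A
    obtain rfl : τ = 0 := Nat.le_zero.1 h
    exact left e hΔ hΘ hΘ' h h' h'' A
  | snoc Γ X ih =>
    intro Δ Θ τ τ' σ e hΔ hΘ hΘ' h h' h'' A
    obtain rfl | hτ := Nat.eq_zero_or_pos τ
    · exact left e hΔ hΘ hΘ' h h' h'' A
    · have hσ : 0 < σ := by omega
      have hΔ' := (Γ.minus_snoc X hτ).symm.trans hΔ
      have hΘ'' := (Γ.minus_snoc X hσ).symm.trans hΘ'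
      rw [N.praTo_snoc hτ hΔ hΔ', N.praTo_snoc hσ hΘ' hΘ'', Category.assoc,
        ih e hΔ' hΘ hΘ'' h h' h'' A]
  | mod Γ κ ih =>
    intro Δ Θ τ τ' σ e hΔ hΘ hΘ' h h' h'' A
    obtain hτ | hτ := le_or_gt τ κ
    · obtain ⟨c, e₁⟩ := Nat.exists_eq_add_of_le hτ
      obtain rfl := (Ctx.minus_mod_add Γ e₁).symm.trans hΔ
      rw [N.praTo_mod_add e₁]
      obtain hc | hc := le_or_gt τ' c
      · obtain ⟨d, e₂⟩ := Nat.exists_eq_add_of_le hc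
        obtain rfl := (Ctx.minus_mod_add Γ e₂).symm.trans hΘ
        have e₃ : κ = σ + d := by omega
        rw [N.praTo_mod_add e₂, N.praTo_mod_add e₃]
        subst e₂ e e₃
        have := N.K.μi_assoc τ τ' d (N.ctx Γ A)
        simpa using this
      · obtain ⟨d, e₂⟩ := Nat.exists_eq_add_of_lt hc
        replace e₂ : τ' = c + (d + 1) := e₂
        have hΘ₁ := (Ctx.minus_mod_sub Γ e₂ d.succ_pos).symm.trans hΘ
        have e₃ : σ = κ + (d + 1) := by omega
        have ht : d + 1 ≤ Γ.time := by
          change σ ≤ Γ.time + κ at h''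
          omega
        rw [N.praTo_mod_sub e₂ d.succ_pos hΘ hΘ₁ h' ht, N.praTo_mod_sub e₃ d.succ_pos hΘ' hΘ₁ h'' ht]
        subst e₁ e₂ e
        have h₂ := reassoc_of% N.K.μi_natural τ c (N.praTo hΘ₁ ht A)
        simp only [N.K.past_refl, Category.comp_id, Category.id_comp, Functor.map_comp,
          Category.assoc, ← h₂]
        rw [N.K.map_μh_μh, N.K.μi_μh_assoc]
    · obtain ⟨c, e₁⟩ := Nat.exists_eq_add_of_lt hτ
      replace e₁ : τ = κ + (c + 1) := e₁
      have hΔ₁ := (Ctx.minus_mod_sub Γ e₁ c.succ_pos).symm.trans hΔ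
      have e₂ : σ = κ + (c + 1 + τ') := by omega
      have hc : 0 < c + 1 + τ' := by omega
      have hΘ₁ := (Ctx.minus_mod_sub Γ e₂ hc).symm.trans hΘ'
      have ht : c + 1 ≤ Γ.time := by
        change τ ≤ Γ.time + κ at h
        omega
      have ht' : c + 1 + τ' ≤ Γ.time := by
        change σ ≤ Γ.time + κ at h''
        omega
      rw [N.praTo_mod_sub e₁ c.succ_pos hΔ hΔ₁ h ht, N.praTo_mod_sub e₂ hc hΘ' hΘ₁ h'' ht',
        ← ih rfl hΔ₁ hΘ hΘ₁ ht h' ht' A]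
      subst e₁ e
      have h₁ := N.K.μh_assoc κ (c + 1) τ' (N.ctx Θ A)
      have h₂ := reassoc_of% N.K.μh_natural κ (c + 1) (N.praTo hΘ h' A)
      simp only [N.K.past_refl, Category.comp_id, Functor.map_comp, Category.assoc, ← h₂]
      rw [h₁]

theorem var_here {Γ : Ctx S.Base} {X : Ty S.Base} :
    N.var (.here : Var (Γ.snoc X) X) = snd _ _ := by
  have : N.var (.here : Var (Γ.snoc X) X) =
    𝟙 _ ≫ N.K.ηh _ ≫ (N.K.past le_rfl _ ≫ N.K.ηi _) ≫ snd _ _ := rfl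
  rw [this]; simp

theorem var_there {Γ : Ctx S.Base} {X Y : Ty S.Base} (x : Var Γ X) :
    N.var (.there x : Var (Γ.snoc Y) X) = fst _ _ ≫ N.var x := by
  have : N.var (.there x : Var (Γ.snoc Y) X) =
    (N.split (𝟙_ C) x ▷ N.ty Y) ≫ (fst _ _ ≫ N.collapse _ x.after) ≫ N.K.epsPast x.after.time _ ≫ snd _ _ := rfl
  rw [this]; simp [TypeModel.var]

theorem var_skip {Γ : Ctx S.Base} {X : Ty S.Base} (τ : ℕ) (x : Var Γ X) :
    N.var (.skip x : Var (Γ.mod τ) X) = N.K.epsPast τ _ ≫ N.var x := by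
  have : N.var (.skip x : Var (Γ.mod τ) X) =
    (N.K.P τ).map (N.split (𝟙_ C) x) ≫
      ((N.K.P τ).map (N.collapse _ x.after) ≫ N.K.μh τ x.after.time _ ≫
        N.K.past (Nat.add_comm x.after.time τ).le _) ≫ N.K.epsPast (x.after.time + τ) _ ≫ snd _ _ := rfl
  rw [this]
  simp only [Category.assoc, reassoc_of% N.K.past_epsPast, reassoc_of% N.K.μh_epsPast,
    reassoc_of% N.K.epsPast_natural]
  rfl

theorem var_goBack (Γ : Ctx S.Base) : ∀ {Δ : Ctx S.Base} {τ : ℕ} (hΔ : Γ.minus τ = Δ)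
    (h : τ ≤ Γ.time) {X : Ty S.Base} (x : Var Δ X),
    N.var (Var.goBack hΔ x) = N.praTo hΔ h (𝟙_ C) ≫ N.K.epsPast τ _ ≫ N.var x := by
  have zero : ∀ {Γ Δ : Ctx S.Base} (hΔ : Γ.minus 0 = Δ) (h : 0 ≤ Γ.time) {X : Ty S.Base}
      (x : Var Δ X),
      N.var (Var.goBack hΔ x) = N.praTo hΔ h (𝟙_ C) ≫ N.K.epsPast 0 _ ≫ N.var x := by
    intro Γ Δ hΔ h X x
    obtain rfl := (Ctx.minus_zero _).symm.trans hΔ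
    rw [Var.goBack_zero, praTo_zero, Modalities.epsPast_zero, Modalities.ηh_ηi_assoc]
  induction Γ with
  | nil =>
    intro Δ τ hΔ h X x
    obtain rfl : τ = 0 := Nat.le_zero.1 h
    exact zero hΔ h x
  | snoc Γ Y ih =>
    intro Δ τ hΔ h X x
    obtain rfl | hτ := Nat.eq_zero_or_pos τ
    · exact zero hΔ h x
    · have hΔ' := (Γ.minus_snoc Y hτ).symm.trans hΔ
      rw [Var.goBack_snoc hτ hΔ hΔ', N.praTo_snoc hτ hΔ hΔ', var_there, ih hΔ' h, Category.assoc]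
  | mod Γ κ ih =>
    intro Δ τ hΔ h X x
    obtain hτ | hτ := le_or_gt τ κ
    · obtain ⟨c, e⟩ := Nat.exists_eq_add_of_le hτ
      obtain rfl := (Ctx.minus_mod_add Γ e).symm.trans hΔ
      cases x with | skip x => ?_
      rw [Var.goBack_mod_add e, praTo_mod_add N e, var_skip, var_skip]
      have h₁ := reassoc_of% N.K.μh_epsPast τ c (N.ctx Γ (𝟙_ C))
      simp only [Category.assoc, ← h₁, N.K.μi_μh_assoc, reassoc_of% N.K.past_epsPast]
    · obtain ⟨c, e⟩ := Nat.exists_eq_add_of_lt hτ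
      replace e : τ = κ + (c + 1) := e
      have hΔ' := (Ctx.minus_mod_sub Γ e c.succ_pos).symm.trans hΔ
      have ht : c + 1 ≤ Γ.time := by
        change τ ≤ Γ.time + κ at h
        omega
      rw [Var.goBack_mod_sub e c.succ_pos hΔ hΔ', N.praTo_mod_sub e c.succ_pos hΔ hΔ' h ht, var_skip,
        ih hΔ' ht]
      simp only [Category.assoc, reassoc_of% N.K.past_epsPast, reassoc_of% N.K.μh_epsPast,
        reassoc_of% N.K.epsPast_natural]

/-- The interpretation of renamings. -/
def renHom : (Γ : Ctx S.Base) → {Δ : Ctx S.Base} → Ren Γ Δ → (N.ctx Δ (𝟙_ C) ⟶ N.ctx Γ (𝟙_ C))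
  | .nil, _, _ => toUnit _
  | .snoc Γ X, _, ρ => lift (renHom Γ ((Ren.wk X).comp ρ)) (N.var (ρ.map .here))
  | .mod Γ τ, Δ, ρ => N.pra (𝟙_ C) Δ τ ρ.time_le_of_mod ≫ (N.K.P τ).map (renHom Γ ρ.unmod)

theorem renHom_snoc' {Γ Δ : Ctx S.Base} {X : Ty S.Base} (ρ : Ren (Γ.snoc X) Δ) :
    N.renHom _ ρ = lift (N.renHom Γ ((Ren.wk X).comp ρ)) (N.var (ρ.map .here)) := rfl

theorem renHom_mod' {Γ Δ Δ' : Ctx S.Base} {τ : ℕ} (ρ : Ren (Γ.mod τ) Δ) (hΔ : Δ.minus τ = Δ')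
    (ρ' : Ren Γ Δ') (h : ∀ (X : Ty S.Base) (x : Var Γ X),
      Var.goBack hΔ (ρ'.map x) = ρ.map (.skip x)) :
    N.renHom _ ρ = N.praTo hΔ ρ.time_le_of_mod (𝟙_ C) ≫ (N.K.P τ).map (N.renHom Γ ρ') := by
  subst hΔ
  obtain rfl : ρ' = ρ.unmod := by
    ext X x
    exact Var.goBack_injective rfl ((h X x).trans (ρ.goBack_unmod x).symm)
  rfl

theorem renHom_var {Γ : Ctx S.Base} {X : Ty S.Base} (x : Var Γ X) : ∀ {Δ : Ctx S.Base}
    (ρ : Ren Γ Δ), N.renHom Γ ρ ≫ N.var x = N.var (ρ.map x) := by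
  induction x with
  | here => intro Δ ρ; rw [renHom_snoc', var_here, lift_snd]
  | there x ih => intro Δ ρ; rw [renHom_snoc', var_there, lift_fst_assoc, ih]; rfl
  | skip x ih =>
    intro Δ ρ
    rw [N.renHom_mod' ρ rfl ρ.unmod fun _ => ρ.goBack_unmod, var_skip, Category.assoc,
      reassoc_of% N.K.epsPast_natural, ih, ← ρ.goBack_unmod, N.var_goBack]

theorem renHom_praTo (Γ : Ctx S.Base) : ∀ {Γ' Δ Δ' : Ctx S.Base} {τ : ℕ} (ρ : Ren Γ Δ)
    (ρ' : Ren Γ' Δ') (hΓ : Γ.minus τ = Γ') (hΔ : Δ.minus τ = Δ')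
    (_ : ∀ (X : Ty S.Base) (x : Var Γ' X),
      Var.goBack hΔ (ρ'.map x) = ρ.map (Var.goBack hΓ x)) (h : τ ≤ Γ.time) (h' : τ ≤ Δ.time),
    N.renHom Γ ρ ≫ N.praTo hΓ h (𝟙_ C) =
      N.praTo hΔ h' (𝟙_ C) ≫ (N.K.P τ).map (N.renHom Γ' ρ') := by
  have zero : ∀ {Γ Γ' Δ Δ' : Ctx S.Base} (ρ : Ren Γ Δ)
    (ρ' : Ren Γ' Δ') (hΓ : Γ.minus 0 = Γ') (hΔ : Δ.minus 0 = Δ')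
    (_ : ∀ (X : Ty S.Base) (x : Var Γ' X),
      Var.goBack hΔ (ρ'.map x) = ρ.map (Var.goBack hΓ x)) (h : 0 ≤ Γ.time) (h' : 0 ≤ Δ.time),
    N.renHom Γ ρ ≫ N.praTo hΓ h (𝟙_ C) =
      N.praTo hΔ h' (𝟙_ C) ≫ (N.K.P 0).map (N.renHom Γ' ρ') := by
    intro Γ Γ' Δ Δ' ρ ρ' hΓ hΔ H h h'
    obtain rfl := (Ctx.minus_zero _).symm.trans hΔ
    obtain rfl := (Ctx.minus_zero _).symm.trans hΓ
    obtain rfl : ρ' = ρ := by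
      ext X x
      have := H X x
      rwa [Var.goBack_zero, Var.goBack_zero] at this
    rw [praTo_zero, praTo_zero, Modalities.ηh_natural]
  induction Γ with
  | nil =>
    intro Γ' Δ Δ' τ ρ ρ' hΓ hΔ H h h'
    obtain rfl : τ = 0 := Nat.le_zero.1 h
    exact zero ρ ρ' hΓ hΔ H h h'
  | snoc Γ Y ih =>
    intro Γ' Δ Δ' τ ρ ρ' hΓ hΔ H h h'
    obtain rfl | hτ := Nat.eq_zero_or_pos τ
    · exact zero ρ ρ' hΓ hΔ H h h'
    · have hΓ' := (Γ.minus_snoc Y hτ).symm.trans hΓ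
      rw [N.praTo_snoc hτ hΓ hΓ', renHom_snoc', lift_fst_assoc]
      refine ih ((Ren.wk Y).comp ρ) ρ' hΓ' hΔ (fun X x => ?_) h h'
      rw [H, Var.goBack_snoc hτ hΓ hΓ']
      rfl
  | mod Γ κ ih =>
    intro Γ' Δ Δ' τ ρ ρ' hΓ hΔ H h h'
    obtain hτ | hτ := le_or_gt τ κ
    · obtain ⟨c, e⟩ := Nat.exists_eq_add_of_le hτ
      obtain rfl := (Ctx.minus_mod_add Γ e).symm.trans hΓ
      have hκ : Δ'.minus c = Δ.minus κ := by rw [← hΔ, Ctx.minus_minus, e]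
      have hc : c ≤ Δ'.time := by
        rw [← hΔ, Ctx.time_minus]
        have : κ ≤ Δ.time := ρ.time_le_of_mod
        omega
      have H' : ∀ (X : Ty S.Base) (x : Var Γ X),
          Var.goBack hκ (ρ.unmod.map x) = ρ'.map (.skip x) := fun X x => by
        apply Var.goBack_injective hΔ
        rw [H, Var.goBack_goBack Δ e hΔ hκ rfl, Var.goBack_mod_add e, ρ.goBack_unmod]
      rw [N.renHom_mod' ρ rfl ρ.unmod fun _ => ρ.goBack_unmod, N.renHom_mod' ρ' hκ ρ.unmod H',
        N.praTo_mod_add e, ← N.praTo_praTo Δ e hΔ hκ rfl h' hc ρ.time_le_of_mod]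
      subst e
      simp [N.K.μi_natural]
    · obtain ⟨c, e⟩ := Nat.exists_eq_add_of_lt hτ
      replace e : τ = κ + (c + 1) := e
      have hΓ' := (Ctx.minus_mod_sub Γ e c.succ_pos).symm.trans hΓ
      have hκ : (Δ.minus κ).minus (c + 1) = Δ' := by rw [← hΔ, Ctx.minus_minus, e]
      have ht : c + 1 ≤ Γ.time := by
        change τ ≤ Γ.time + κ at h
        omega
      have ht' : c + 1 ≤ (Δ.minus κ).time := by
        rw [Ctx.time_minus]
        omega
      have H' : ∀ (X : Ty S.Base) (x : Var Γ' X),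
          Var.goBack hκ (ρ'.map x) = ρ.unmod.map (Var.goBack hΓ' x) := fun X x => by
        apply Var.goBack_injective (rfl : Δ.minus κ = _)
        rw [Var.goBack_goBack Δ e rfl hκ hΔ, H, Var.goBack_mod_sub e c.succ_pos hΓ hΓ',
          ρ.goBack_unmod]
      have := ih ρ.unmod ρ' hΓ' hκ H' ht ht'
      rw [N.renHom_mod' ρ rfl ρ.unmod fun _ => ρ.goBack_unmod,
        N.praTo_mod_sub e c.succ_pos hΓ hΓ' h ht,
        ← N.praTo_praTo Δ e rfl hκ hΔ ρ.time_le_of_mod ht' h']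
      subst e
      simp only [Modalities.past_refl, Category.comp_id, Category.assoc, ← Functor.map_comp_assoc,
        this]
      simp [N.K.μh_natural]

theorem renHom_minus {Γ Δ : Ctx S.Base} (ρ : Ren Γ Δ) {τ : ℕ} (h : τ ≤ Γ.time) :
    N.renHom Γ ρ ≫ N.pra (𝟙_ C) Γ τ h =
      N.pra (𝟙_ C) Δ τ (h.trans ρ.time_le) ≫ (N.K.P τ).map (N.renHom _ (ρ.minus τ)) :=
  N.renHom_praTo Γ ρ (ρ.minus τ) rfl rfl (fun _ => ρ.goBack_minus τ) h (h.trans ρ.time_le)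

theorem renHom_comp (Γ : Ctx S.Base) : ∀ {Δ Θ : Ctx S.Base} (ρ : Ren Γ Δ) (ρ' : Ren Δ Θ),
    N.renHom Γ (ρ.comp ρ') = N.renHom Δ ρ' ≫ N.renHom Γ ρ := by
  induction Γ with
  | nil => intro Δ Θ ρ ρ'; exact N.ctx_nil_ext _ _
  | snoc Γ X ih =>
    intro Δ Θ ρ ρ'
    rw [renHom_snoc', renHom_snoc', comp_lift, renHom_var, ← ih]
    rfl
  | mod Γ τ ih =>
    intro Δ Θ ρ ρ'
    rw [N.renHom_mod' (ρ.comp ρ') rfl (ρ.unmod.comp (ρ'.minus τ)), ih,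
      N.renHom_mod' ρ rfl ρ.unmod fun _ => ρ.goBack_unmod, Functor.map_comp, N.praTo_rfl,
      N.praTo_rfl, ← reassoc_of% N.renHom_minus]
    intro X x
    exact (ρ'.goBack_minus τ _).trans (congrArg ρ'.map (ρ.goBack_unmod x))

theorem renHom_comp_wk (X : Ty S.Base) (Γ : Ctx S.Base) : ∀ {Δ : Ctx S.Base} (ρ : Ren Γ Δ),
    N.renHom Γ (ρ.comp (.wk X)) = fst (N.ctx Δ (𝟙_ C)) (N.ty X) ≫ N.renHom Γ ρ := by
  induction Γ with
  | nil => intro Δ ρ; exact N.ctx_nil_ext _ _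
  | snoc Γ Y ih =>
    intro Δ ρ
    rw [renHom_snoc', renHom_snoc', comp_lift, ← ih, ← var_there]
    rfl
  | mod Γ τ ih =>
    intro Δ ρ
    obtain rfl | hτ := Nat.eq_zero_or_pos τ
    · have h := Ctx.minus_zero Δ
      have h' := Ctx.minus_zero (Δ.snoc X)
      obtain ⟨ρ', hρ'⟩ : ∃ ρ' : Ren Γ Δ, ∀ (Y : Ty S.Base) (x : Var Γ Y),
          Var.goBack h (ρ'.map x) = ρ.map (.skip x) :=
        ⟨(Ren.toMod 0).comp ρ, fun _ _ => Var.goBack_zero _ _⟩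
      rw [N.renHom_mod' ρ h ρ' hρ', N.renHom_mod' (ρ.comp (.wk X)) h' (ρ'.comp (.wk X)), ih,
        praTo_zero, praTo_zero, ← N.K.ηh_natural, ← N.K.ηh_natural, Category.assoc]
      intro Y x
      have := hρ' Y x
      rw [Var.goBack_zero] at this ⊢
      exact congrArg Var.there this
    · have h := (Δ.minus_snoc X hτ)
      rw [N.renHom_mod' ρ rfl ρ.unmod fun _ => ρ.goBack_unmod,
        N.renHom_mod' (ρ.comp (.wk X)) h ρ.unmod, N.praTo_snoc hτ h rfl, Category.assoc]
      intro Y x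
      rw [Var.goBack_snoc hτ h rfl, ρ.goBack_unmod]
      rfl

theorem renHom_goBack (Γ : Ctx S.Base) : ∀ {Δ Δ' : Ctx S.Base} {τ : ℕ} (hΔ : Δ.minus τ = Δ')
    (ρ : Ren Γ Δ') (ρ' : Ren Γ Δ) (_ : ∀ (X : Ty S.Base) (x : Var Γ X),
      ρ'.map x = Var.goBack hΔ (ρ.map x)) (h : τ ≤ Δ.time),
    N.renHom Γ ρ' = N.praTo hΔ h (𝟙_ C) ≫ N.K.epsPast τ _ ≫ N.renHom Γ ρ := by
  induction Γ with
  | nil => intro Δ Δ' τ hΔ ρ ρ' H h; exact N.ctx_nil_ext _ _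
  | snoc Γ X ih =>
    intro Δ Δ' τ hΔ ρ ρ' H h
    rw [renHom_snoc', renHom_snoc', comp_lift, comp_lift,
      ← ih hΔ ((Ren.wk X).comp ρ) ((Ren.wk X).comp ρ') (fun Y x => H Y x.there) h, H,
      N.var_goBack Δ hΔ h]
  | mod Γ κ ih =>
    intro Δ Δ' τ hΔ ρ ρ' H h
    have hκ : (Δ.minus κ).minus τ = Δ'.minus κ := by
      rw [← hΔ, Ctx.minus_minus, Ctx.minus_minus, Nat.add_comm]
    have hσ : Δ.minus (κ + τ) = Δ'.minus κ := by rw [← hκ, Ctx.minus_minus]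
    have hκt : κ ≤ Δ'.time := ρ.time_le_of_mod
    have ht : κ + τ ≤ Δ.time := by
      rw [← hΔ, Ctx.time_minus] at hκt
      omega
    have ht' : τ ≤ (Δ.minus κ).time := by
      rw [Ctx.time_minus]
      omega
    have H' : ∀ (X : Ty S.Base) (x : Var Γ X),
        ρ'.unmod.map x = Var.goBack hκ (ρ.unmod.map x) := fun X x => by
      apply Var.goBack_injective (rfl : Δ.minus κ = _)
      rw [ρ'.goBack_unmod, H, Var.goBack_goBack Δ rfl rfl hκ hσ, ← ρ.goBack_unmod,
        Var.goBack_goBack Δ (Nat.add_comm κ τ) hΔ rfl hσ]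
    have h₁ := N.praTo_praTo Δ rfl rfl hκ hσ ρ'.time_le_of_mod ht' ht (𝟙_ C)
    have h₂ := N.praTo_praTo Δ (Nat.add_comm κ τ) hΔ rfl hσ h hκt ht (𝟙_ C)
    rw [Modalities.past_refl, Category.comp_id] at h₁
    rw [N.renHom_mod' ρ' rfl ρ'.unmod fun _ => ρ'.goBack_unmod,
      N.renHom_mod' ρ rfl ρ.unmod fun _ => ρ.goBack_unmod, ih hκ _ _ H' ht',
      ← reassoc_of% N.K.epsPast_natural, N.K.epsPast_left, Functor.map_comp, Functor.map_comp,
      N.K.epsPast_right]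
    have h₃ := h₁.trans h₂.symm
    have h₄ := congrArg (· ≫ N.K.past (Nat.le_add_right κ τ) _ ≫ (N.K.P κ).map (N.renHom Γ ρ.unmod)) h₃
    simpa [reassoc_of% N.K.past_trans] using h₄

theorem renHom_comp_toMod_zero (Γ : Ctx S.Base) : ∀ {Δ : Ctx S.Base} (ρ : Ren Γ Δ),
    N.renHom Γ (ρ.comp (.toMod 0)) = N.K.ηi _ ≫ N.renHom Γ ρ := by
  induction Γ with
  | nil => intro Δ ρ; exact N.ctx_nil_ext _ _
  | snoc Γ Y ih =>
    intro Δ ρ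
    rw [renHom_snoc', renHom_snoc', comp_lift, ← ih, ← N.K.epsPast_zero, ← var_skip]
    rfl
  | mod Γ τ ih =>
    intro Δ ρ
    obtain rfl | hτ := Nat.eq_zero_or_pos τ
    · have h := Ctx.minus_zero Δ
      have h' := Ctx.minus_zero (Δ.mod 0)
      obtain ⟨ρ', hρ'⟩ : ∃ ρ' : Ren Γ Δ, ∀ (Y : Ty S.Base) (x : Var Γ Y),
          Var.goBack h (ρ'.map x) = ρ.map (.skip x) :=
        ⟨(Ren.toMod 0).comp ρ, fun _ _ => Var.goBack_zero _ _⟩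
      rw [N.renHom_mod' ρ h ρ' hρ', N.renHom_mod' (ρ.comp (.toMod 0)) h' (ρ'.comp (.toMod 0)), ih,
        praTo_zero, praTo_zero, ← N.K.ηh_natural, ← N.K.ηh_natural, Category.assoc]
      intro Y x
      have := hρ' Y x
      rw [Var.goBack_zero] at this ⊢
      exact congrArg Var.skip this
    · have e := (Nat.zero_add τ).symm
      have h := Ctx.minus_mod_sub Δ e hτ
      rw [N.renHom_mod' ρ rfl ρ.unmod fun _ => ρ.goBack_unmod,
        N.renHom_mod' (ρ.comp (.toMod 0)) h ρ.unmod,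
        N.praTo_mod_sub e hτ h rfl _ ρ.time_le_of_mod, N.K.μh_zero_left]
      · simp [reassoc_of% N.K.past_trans, reassoc_of% N.K.ηi_natural]
      · intro Y x
        rw [Var.goBack_mod_sub e hτ h rfl, ρ.goBack_unmod]
        rfl

theorem renHom_comp_toMod (τ : ℕ) {Γ Δ : Ctx S.Base} (ρ : Ren Γ Δ) :
    N.renHom Γ (ρ.comp (.toMod τ)) = N.K.epsPast τ _ ≫ N.renHom Γ ρ := by
  have e : τ = τ + 0 := rfl
  have h := Ctx.minus_mod_add Δ e
  have ht : τ ≤ (Δ.mod τ).time := Nat.le_add_left _ _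
  rw [N.renHom_goBack Γ h (ρ.comp (.toMod 0)) (ρ.comp (.toMod τ))
    (fun X x => (Var.goBack_mod_add e h (ρ.map x)).symm) ht,
    N.renHom_comp_toMod_zero, N.praTo_mod_add e, N.K.μi_zero_right]
  simp [reassoc_of% N.K.epsPast_natural]

@[simp]
theorem renHom_id (Γ : Ctx S.Base) : N.renHom Γ (.id Γ) = 𝟙 _ := by
  induction Γ with
  | nil => exact N.ctx_nil_ext _ _
  | snoc Γ X ih =>
    have h := N.renHom_comp_wk X Γ (.id Γ)
    rw [ih, Category.comp_id] at h
    have h' : N.renHom (Γ.snoc X) (.id _) = lift (N.renHom Γ ((Ren.id Γ).comp (.wk X)))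
      (N.var (.here : Var (Γ.snoc X) X)) := rfl
    rw [h', h, var_here, lift_fst_snd]
  | mod Γ τ ih =>
    have e : τ = τ + 0 := rfl
    have h := Ctx.minus_mod_add Γ e
    rw [N.renHom_mod' (.id _) h (.toMod 0) fun X x => Var.goBack_mod_add e h x]
    have h' := N.renHom_comp_toMod_zero Γ (.id Γ)
    rw [ih, Category.comp_id] at h'
    have h'' : N.renHom Γ (.toMod 0) = N.renHom Γ ((Ren.id Γ).comp (.toMod 0)) := rfl
    rw [h'', h', N.praTo_mod_add e, N.K.μi_zero_right]
    simp [← Functor.map_comp]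

@[simp]
theorem renHom_wk (X : Ty S.Base) (Γ : Ctx S.Base) :
    N.renHom Γ (.wk X) = fst (N.ctx Γ (𝟙_ C)) (N.ty X) := by
  have h := N.renHom_comp_wk X Γ (.id Γ)
  rwa [renHom_id, Category.comp_id] at h

@[simp]
theorem renHom_toMod (τ : ℕ) (Γ : Ctx S.Base) :
    N.renHom Γ (.toMod τ) = N.K.epsPast τ (N.ctx Γ (𝟙_ C)) := by
  have h := N.renHom_comp_toMod τ (.id Γ)
  rwa [renHom_id, Category.comp_id] at h

@[simp]
theorem renHom_ofMinus (Γ : Ctx S.Base) (τ : ℕ) (h : τ ≤ Γ.time) :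
    N.renHom _ (.ofMinus τ) = N.pra (𝟙_ C) Γ τ h ≫ N.K.epsPast τ _ := by
  rw [N.renHom_goBack _ rfl (.id _) (.ofMinus τ) (fun _ _ => rfl) h, renHom_id, Category.comp_id,
    N.praTo_rfl]

@[simp]
theorem renHom_snoc {Γ Δ : Ctx S.Base} (ρ : Ren Γ Δ) (X : Ty S.Base) :
    N.renHom _ (ρ.snoc X) = N.renHom Γ ρ ▷ N.ty X := by
  have h : N.renHom _ (ρ.snoc X) = lift (N.renHom Γ (ρ.comp (.wk X)))
    (N.var (.here : Var (Δ.snoc X) X)) := rfl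
  rw [h, renHom_comp_wk, var_here]
  ext <;> simp

@[simp]
theorem renHom_mod {Γ Δ : Ctx S.Base} (ρ : Ren Γ Δ) (τ : ℕ) :
    N.renHom _ (ρ.mod τ) = (N.K.P τ).map (N.renHom Γ ρ) := by
  have e : τ = τ + 0 := rfl
  have h := Ctx.minus_mod_add Δ e
  rw [N.renHom_mod' (ρ.mod τ) h (ρ.comp (.toMod 0)) fun X x => Var.goBack_mod_add e h _,
    renHom_comp_toMod_zero, N.praTo_mod_add e, N.K.μi_zero_right]
  simp [← Functor.map_comp]

@[simp]
theorem renHom_eta (Γ : Ctx S.Base) : N.renHom (Γ.mod 0) .eta = N.K.ηh (N.ctx Γ (𝟙_ C)) := by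
  rw [N.renHom_mod' .eta (Ctx.minus_zero Γ) (.id Γ) fun X x => Var.goBack_zero _ _, praTo_zero,
    renHom_id, CategoryTheory.Functor.map_id, Category.comp_id]

@[simp]
theorem renHom_muInv (Γ : Ctx S.Base) (τ τ' : ℕ) :
    N.renHom ((Γ.mod τ).mod τ') (.muInv τ τ') =
      N.K.past (Nat.add_comm τ τ').ge _ ≫ N.K.μi τ' τ (N.ctx Γ (𝟙_ C)) := by
  have e := Nat.add_comm τ τ'
  rw [N.renHom_mod' (.muInv τ τ') (Ctx.minus_mod_add Γ e) (.id (Γ.mod τ)), renHom_id,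
    CategoryTheory.Functor.map_id, Category.comp_id, N.praTo_mod_add e]
  intro X x
  cases x
  exact Var.goBack_mod_add e _ _

@[simp]
theorem renHom_mu (Γ : Ctx S.Base) (τ τ' : ℕ) :
    N.renHom (Γ.mod (τ + τ')) (.mu τ τ') =
      N.K.μh τ' τ (N.ctx Γ (𝟙_ C)) ≫ N.K.past (Nat.add_comm τ τ').le _ := by
  have h : (Ren.mu τ τ').comp (.muInv τ τ') = .id (Γ.mod (τ + τ')) := by
    ext X x
    cases x
    rfl
  have h' := congrArg (N.renHom _) h
  rw [renHom_comp, renHom_id, renHom_muInv] at h'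
  have h'' := congrArg (fun f => N.K.μh τ' τ _ ≫ N.K.past (Nat.add_comm τ τ').le _ ≫ f) h'
  simpa [reassoc_of% N.K.past_trans] using h''

@[simp]
theorem renHom_under (Γ : Ctx S.Base) (τ τ' : ℕ) (X : Ty S.Base) :
    N.renHom (Γ.mod (τ + τ')) (.under τ τ' X) =
      (N.K.P τ').map (fst ((N.K.P τ).obj (N.ctx Γ (𝟙_ C))) (N.ty X)) ≫
        N.K.μh τ' τ (N.ctx Γ (𝟙_ C)) ≫ N.K.past (Nat.add_comm τ τ').le _ := by
  rw [Ren.under, renHom_comp, renHom_mod, renHom_wk, renHom_mu]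

@[simp]
theorem renHom_minusMod (Γ : Ctx S.Base) (τ : ℕ) (h : τ ≤ Γ.time) :
    N.renHom ((Γ.minus τ).mod τ) (.minusMod τ h) = N.pra (𝟙_ C) Γ τ h := by
  rw [N.renHom_mod' (.minusMod τ h) rfl (.id _) fun _ _ => rfl, renHom_id,
    CategoryTheory.Functor.map_id, Category.comp_id, N.praTo_rfl]

end TypeModel

end

section

variable {C : Type u} [Category.{v} C] [CartesianMonoidalCategory C]

/-! ## Components of the monad and of the operations -/

namespace StrongGradedMonad

variable {K : Modalities C} (G : StrongGradedMonad K)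

def ηT (A : C) : A ⟶ (G.T 0).obj A := G.η.app A

def μT (τ τ' : ℕ) (A : C) : (G.T τ).obj ((G.T τ').obj A) ⟶ (G.T (τ + τ')).obj A := (G.μ τ τ').app A

/-- A computation of duration `τ`, paired with its context seen from `τ` time steps later. -/
def seq (τ : ℕ) {D A : C} (m : D ⟶ (G.T τ).obj A) : D ⟶ (G.T τ).obj ((K.P τ).obj D ⊗ A) :=
  lift (K.un τ D) m ≫ G.str τ ((K.P τ).obj D) A

theorem comp_seq (τ : ℕ) {D D' A : C} (f : D' ⟶ D) (m : D ⟶ (G.T τ).obj A) :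
    f ≫ G.seq τ m = G.seq τ (f ≫ m) ≫ (G.T τ).map ((K.P τ).map f ▷ A) := by
  have h := G.str_natural τ ((K.P τ).map f) (𝟙 A)
  rw [seq, seq, Category.assoc, ← tensorHom_id, ← h, ← Category.assoc, ← Category.assoc, comp_lift,
    K.un_natural]
  congr 1
  ext <;> simp

end StrongGradedMonad

variable [MonoidalClosed C]

/-! ## Exponentials -/

@[simp]
theorem curryR_uncurryR {A X Y : C} (g : A ⟶ (ihom X).obj Y) : curryR (uncurryR g) = g := by
  rw [curryR, uncurryR, ← Category.assoc]
  have : lift (snd X A) (fst X A) ≫ lift (snd A X) (fst A X) = 𝟙 _ := by ext <;> simp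
  rw [this, Category.id_comp, MonoidalClosed.curry_uncurry]

@[simp]
theorem uncurryR_curryR {A X Y : C} (f : A ⊗ X ⟶ Y) : uncurryR (curryR f) = f := by
  rw [curryR, uncurryR, MonoidalClosed.uncurry_curry, ← Category.assoc]
  have : lift (snd A X) (fst A X) ≫ lift (snd X A) (fst X A) = 𝟙 _ := by ext <;> simp
  rw [this, Category.id_comp]

theorem curryR_injective {A X Y : C} {f g : A ⟶ (ihom X).obj Y} (h : uncurryR f = uncurryR g) :
    f = g := by
  rw [← curryR_uncurryR f, h, curryR_uncurryR]

theorem uncurryR_comp {A A' X Y : C} (f : A ⟶ A') (g : A' ⟶ (ihom X).obj Y) :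
    uncurryR (f ≫ g) = (f ▷ X) ≫ uncurryR g := by
  rw [uncurryR, uncurryR, MonoidalClosed.uncurry_natural_left, ← Category.assoc, ← Category.assoc]
  congr 1
  ext <;> simp

theorem comp_curryR {A A' X Y : C} (f : A ⟶ A') (g : A' ⊗ X ⟶ Y) :
    f ≫ curryR g = curryR ((f ▷ X) ≫ g) :=
  curryR_injective (by rw [uncurryR_comp, uncurryR_curryR, uncurryR_curryR])

theorem uncurryR_map {A X Y Y' : C} (f : A ⟶ (ihom X).obj Y) (g : Y ⟶ Y') :
    uncurryR (f ≫ (ihom X).map g) = uncurryR f ≫ g := by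
  rw [uncurryR, uncurryR, MonoidalClosed.uncurry_natural_right, Category.assoc]

theorem curryR_map {A X Y Y' : C} (f : A ⊗ X ⟶ Y) (g : Y ⟶ Y') :
    curryR f ≫ (ihom X).map g = curryR (f ≫ g) :=
  curryR_injective (by rw [uncurryR_map, uncurryR_curryR, uncurryR_curryR])

theorem lift_uncurryR {D A X Y : C} (f : D ⟶ A) (x : D ⟶ X) (g : A ⟶ (ihom X).obj Y) :
    lift f x ≫ uncurryR g = lift (f ≫ g) x ≫ uncurryR (𝟙 _) := by
  have h := uncurryR_comp g (𝟙 ((ihom X).obj Y))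
  rw [Category.comp_id] at h
  rw [h, ← Category.assoc]
  congr 1
  ext <;> simp

theorem lift_curryR_eval {D A B : C} (f : D ⊗ A ⟶ B) (x : D ⟶ A) :
    lift (curryR f) x ≫ uncurryR (𝟙 _) = lift (𝟙 D) x ≫ f := by
  have h := lift_uncurryR (𝟙 D) x (curryR f)
  rw [Category.id_comp, uncurryR_curryR] at h
  exact h.symm

variable {S : Signature.{w}}

namespace Model

variable [HasProductsOfShape S.Op C] [HasProductsOfShape ℕ C] (N : Model C S)

def opT (o : S.Op) (τ : ℕ) (A : C) : N.opDom o τ A ⟶ (N.T (S.dur o + τ)).obj A := (N.op o τ).app A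

def delayT (τ τ' : ℕ) (A : C) : (N.F τ).obj ((N.T τ').obj A) ⟶ (N.T (τ + τ')).obj A :=
  (N.delay τ τ').app A

/-- The uncurried handling morphism. -/
noncomputable def handleT (τ τ' : ℕ) (A : C) :
    N.handlerObj A ⊗ (N.T τ).obj ((N.T τ').obj A) ⟶ (N.T (τ + τ')).obj A :=
  uncurryR (N.χ τ τ' A)

/-- The interpretation of operation clauses. -/
noncomputable def clauses {Γ : Ctx S.Base} {Y : Ty S.Base} (H : Clauses S Γ Y) :
    N.ctx Γ (𝟙_ C) ⟶ N.handlerObj (N.ty Y) :=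
  Pi.lift fun o => Pi.lift fun τ =>
    (curryR ((α_ _ _ _).inv ≫ N.comp (H o τ)) : _ ⟶ N.clauseObj o τ (N.ty Y))

variable {Γ Δ : Ctx S.Base} {X Y Z : Ty S.Base}

theorem val_var (x : Var Γ X) : N.val (.var x) = N.var x := rfl

theorem val_const (f : S.Const) (V : (i : Fin (S.arity f)) → Val S Γ (S.dom f i).toTy) :
    N.val (.const f V) = Pi.lift (fun i => N.val (V i)) ≫ N.const f := rfl

theorem val_pair (V : Val S Γ X) (W : Val S Γ Y) : N.val (.pair V W) = lift (N.val V) (N.val W) := rfl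

theorem val_lam {τ : ℕ} (M : Comp S (Γ.snoc X) Y τ) : N.val (.lam M) = curryR (N.comp M) := rfl

theorem val_box (τ : ℕ) (V : Val S (Γ.mod τ) X) :
    N.val (.box τ V) = N.K.un τ (N.ctx Γ (𝟙_ C)) ≫ (N.K.F τ).map (N.val V) := rfl

theorem comp_ret (V : Val S Γ X) : N.comp (.ret V) = N.val V ≫ N.G.ηT (N.ty X) := rfl

theorem comp_letin {τ τ' σ : ℕ} (h : σ = τ + τ') (M : Comp S Γ X τ)
    (M' : Comp S ((Γ.mod τ).snoc X) Y τ') :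
    N.comp (.letin h M M') = N.G.seq τ (N.comp M) ≫ (N.G.T τ).map (N.comp M') ≫
      N.G.μT τ τ' (N.ty Y) ≫ castT N.G.T h.symm (N.ty Y) := by
  simp only [StrongGradedMonad.seq, Category.assoc]; rfl

theorem comp_app {τ : ℕ} (V : Val S Γ (.func X Y τ)) (W : Val S Γ X) :
    N.comp (.app V W) = lift (N.val V) (N.val W) ≫ uncurryR (𝟙 _) := rfl

theorem comp_pm {τ : ℕ} (V : Val S Γ (.prod X Y)) (M : Comp S ((Γ.snoc X).snoc Y) Z τ) :
    N.comp (.pm V M) = lift (𝟙 _) (N.val V) ≫ (α_ (N.ctx Γ (𝟙_ C)) (N.ty X) (N.ty Y)).inv ≫ N.comp M :=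
  rfl

theorem comp_opcall {τ σ : ℕ} (o : S.Op) (h : σ = S.dur o + τ) (V : Val S Γ (S.arg o).toTy)
    (M : Comp S ((Γ.mod (S.dur o)).snoc (S.res o).toTy) X τ) :
    N.comp (.opcall o h V M) =
      lift (N.val V) (N.K.un (S.dur o) (N.ctx Γ (𝟙_ C)) ≫
        (N.K.F (S.dur o)).map (curryR (N.comp M))) ≫ N.opT o τ (N.ty X) ≫ castT N.G.T h.symm (N.ty X) := by
  have h₁ : N.comp (.opcall o h V M) =
      lift (N.val V) (N.K.un (S.dur o) (N.ctx Γ (𝟙_ C))) ≫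
        (N.argObj o ◁ (N.K.F (S.dur o)).map (curryR (N.comp M))) ≫
        N.opT o τ (N.ty X) ≫ castT N.G.T h.symm (N.ty X) := rfl
  rw [h₁, lift_whiskerLeft_assoc]

theorem comp_delay {τ' σ : ℕ} (τ : ℕ) (h : σ = τ + τ') (M : Comp S (Γ.mod τ) X τ') :
    N.comp (.delay τ h M) = N.K.un τ (N.ctx Γ (𝟙_ C)) ≫ (N.K.F τ).map (N.comp M) ≫
      N.delayT τ τ' (N.ty X) ≫ castT N.G.T h.symm (N.ty X) := rfl

theorem comp_handle {τ τ' σ : ℕ} (h : σ = τ + τ') (M : Comp S Γ X τ) (H : Clauses S Γ Y)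
    (M' : Comp S ((Γ.mod τ).snoc X) Y τ') :
    N.comp (.handle h M H M') =
      lift (N.clauses H) (N.G.seq τ (N.comp M) ≫ (N.G.T τ).map (N.comp M')) ≫
        N.handleT τ τ' (N.ty Y) ≫ castT N.G.T h.symm (N.ty Y) := by
  have h₁ : N.comp (.handle h M H M') =
      lift (𝟙 _) (lift (N.K.un τ (N.ctx Γ (𝟙_ C))) (N.comp M)) ≫
        (_ ◁ N.G.str τ _ _) ≫ (_ ◁ (N.G.T τ).map (N.comp M')) ≫ (N.clauses H ▷ _) ≫
        N.handleT τ τ' (N.ty Y) ≫ castT N.G.T h.symm (N.ty Y) := rfl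
  rw [h₁, lift_whiskerLeft_assoc, lift_whiskerLeft_assoc, lift_whiskerRight_assoc, Category.id_comp]
  rfl

theorem comp_unbox {τ' : ℕ} (τ : ℕ) (h : τ ≤ Γ.time) (V : Val S (Γ.minus τ) (.box τ X))
    (M : Comp S (Γ.snoc X) Y τ') :
    N.comp (.unbox τ h V M) =
      lift (𝟙 _) (N.pra (𝟙_ C) Γ τ h ≫ (N.K.P τ).map (N.val V) ≫ N.K.co τ (N.ty X)) ≫ N.comp M := by
  have h₁ : N.comp (.unbox τ h V M) =
      lift (𝟙 _) (N.pra (𝟙_ C) Γ τ h) ≫ (_ ◁ (N.K.P τ).map (N.val V)) ≫ (_ ◁ N.K.co τ (N.ty X)) ≫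
        N.comp M := rfl
  rw [h₁, lift_whiskerLeft_assoc, lift_whiskerLeft_assoc, Category.assoc]

/-! ## Compatibility of the term formers with morphisms between contexts -/

section Transport

variable (f : N.ctx Δ (𝟙_ C) ⟶ N.ctx Γ (𝟙_ C))

theorem transport_const (c : S.Const) {V : (i : Fin (S.arity c)) → Val S Γ (S.dom c i).toTy}
    {V' : (i : Fin (S.arity c)) → Val S Δ (S.dom c i).toTy}
    (h : ∀ i, N.val (V' i) = f ≫ N.val (V i)) :
    N.val (.const c V') = f ≫ N.val (.const c V) := by
  rw [val_const, val_const, funext h, ← Category.assoc]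
  congr 1
  apply Pi.hom_ext
  intro i
  simp

theorem transport_pair {V : Val S Γ X} {W : Val S Γ Y} {V' : Val S Δ X} {W' : Val S Δ Y}
    (hV : N.val V' = f ≫ N.val V) (hW : N.val W' = f ≫ N.val W) :
    N.val (.pair V' W') = f ≫ N.val (.pair V W) := by
  rw [val_pair, val_pair, hV, hW, comp_lift]

theorem transport_lam {τ : ℕ} {M : Comp S (Γ.snoc X) Y τ} {M' : Comp S (Δ.snoc X) Y τ}
    (h : N.comp M' = (f ▷ N.ty X) ≫ N.comp M) :
    N.val (.lam M') = f ≫ N.val (.lam M) := by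
  rw [val_lam, val_lam, h, comp_curryR]

theorem transport_box (τ : ℕ) {V : Val S (Γ.mod τ) X} {V' : Val S (Δ.mod τ) X}
    (h : N.val V' = (N.K.P τ).map f ≫ N.val V) :
    N.val (.box τ V') = f ≫ N.val (.box τ V) := by
  rw [val_box, val_box, h, Functor.map_comp, ← reassoc_of% N.K.un_natural]

theorem transport_ret {V : Val S Γ X} {V' : Val S Δ X} (h : N.val V' = f ≫ N.val V) :
    N.comp (.ret V') = f ≫ N.comp (.ret V) := by
  rw [comp_ret, comp_ret, h, Category.assoc]

theorem transport_letin {τ τ' σ : ℕ} (h : σ = τ + τ') {M : Comp S Γ X τ} {M' : Comp S Δ X τ}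
    {P : Comp S ((Γ.mod τ).snoc X) Y τ'} {P' : Comp S ((Δ.mod τ).snoc X) Y τ'}
    (hM : N.comp M' = f ≫ N.comp M) (hP : N.comp P' = ((N.K.P τ).map f ▷ N.ty X) ≫ N.comp P) :
    N.comp (.letin h M' P') = f ≫ N.comp (.letin h M P) := by
  rw [comp_letin, comp_letin, hM, hP, Functor.map_comp, reassoc_of% N.G.comp_seq, Category.assoc]

theorem transport_app {τ : ℕ} {V : Val S Γ (.func X Y τ)} {W : Val S Γ X}
    {V' : Val S Δ (.func X Y τ)} {W' : Val S Δ X}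
    (hV : N.val V' = f ≫ N.val V) (hW : N.val W' = f ≫ N.val W) :
    N.comp (.app V' W') = f ≫ N.comp (.app V W) := by
  rw [comp_app, comp_app, hV, hW, ← Category.assoc, comp_lift]

theorem transport_pm {τ : ℕ} {V : Val S Γ (.prod X Y)} {V' : Val S Δ (.prod X Y)}
    {M : Comp S ((Γ.snoc X).snoc Y) Z τ} {M' : Comp S ((Δ.snoc X).snoc Y) Z τ}
    (hV : N.val V' = f ≫ N.val V) (hM : N.comp M' = ((f ▷ N.ty X) ▷ N.ty Y) ≫ N.comp M) :
    N.comp (.pm V' M') = f ≫ N.comp (.pm V M) := by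
  rw [comp_pm, comp_pm, hV, hM]
  simp only [← Category.assoc]
  congr 1
  ext <;> simp

theorem transport_opcall {τ σ : ℕ} (o : S.Op) (h : σ = S.dur o + τ) {V : Val S Γ (S.arg o).toTy}
    {V' : Val S Δ (S.arg o).toTy}
    {M : Comp S ((Γ.mod (S.dur o)).snoc (S.res o).toTy) X τ}
    {M' : Comp S ((Δ.mod (S.dur o)).snoc (S.res o).toTy) X τ}
    (hV : N.val V' = f ≫ N.val V)
    (hM : N.comp M' = ((N.K.P (S.dur o)).map f ▷ N.resObj o) ≫ N.comp M) :
    N.comp (.opcall o h V' M') = f ≫ N.comp (.opcall o h V M) := by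
  rw [comp_opcall, comp_opcall, hV, hM, ← comp_curryR, Functor.map_comp,
    ← reassoc_of% N.K.un_natural, ← comp_lift, Category.assoc]

theorem transport_delay {τ' σ : ℕ} (τ : ℕ) (h : σ = τ + τ') {M : Comp S (Γ.mod τ) X τ'}
    {M' : Comp S (Δ.mod τ) X τ'} (hM : N.comp M' = (N.K.P τ).map f ≫ N.comp M) :
    N.comp (.delay τ h M') = f ≫ N.comp (.delay τ h M) := by
  rw [comp_delay, comp_delay, hM, Functor.map_comp, Category.assoc, ← reassoc_of% N.K.un_natural]

theorem transport_clauses {H : Clauses S Γ Y} {H' : Clauses S Δ Y}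
    (hH : ∀ o τ, N.comp (H' o τ) = ((f ▷ N.argObj o) ▷ _) ≫ N.comp (H o τ)) :
    N.clauses H' = f ≫ N.clauses H := by
  apply Pi.hom_ext
  intro o
  apply Pi.hom_ext
  intro τ
  simp only [clauses, Category.assoc, limit.lift_π, Fan.mk_pt, Fan.mk_π_app]
  rw [comp_curryR, hH]
  congr 1
  simp only [← Category.assoc]
  congr 1
  ext <;> simp

theorem transport_handle {τ τ' σ : ℕ} (h : σ = τ + τ') {M : Comp S Γ X τ} {M' : Comp S Δ X τ}
    {H : Clauses S Γ Y} {H' : Clauses S Δ Y}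
    {P : Comp S ((Γ.mod τ).snoc X) Y τ'} {P' : Comp S ((Δ.mod τ).snoc X) Y τ'}
    (hM : N.comp M' = f ≫ N.comp M)
    (hH : ∀ o τ, N.comp (H' o τ) = ((f ▷ N.argObj o) ▷ _) ≫ N.comp (H o τ))
    (hP : N.comp P' = ((N.K.P τ).map f ▷ N.ty X) ≫ N.comp P) :
    N.comp (.handle h M' H' P') = f ≫ N.comp (.handle h M H P) := by
  rw [comp_handle, comp_handle, hM, hP, N.transport_clauses f hH, Functor.map_comp,
    ← reassoc_of% N.G.comp_seq, ← comp_lift, Category.assoc]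

theorem transport_unbox {τ' : ℕ} (τ : ℕ) (h : τ ≤ Γ.time) (h' : τ ≤ Δ.time)
    {V : Val S (Γ.minus τ) (.box τ X)} {V' : Val S (Δ.minus τ) (.box τ X)}
    {M : Comp S (Γ.snoc X) Y τ'} {M' : Comp S (Δ.snoc X) Y τ'}
    (g : N.ctx (Δ.minus τ) (𝟙_ C) ⟶ N.ctx (Γ.minus τ) (𝟙_ C))
    (hg : f ≫ N.pra (𝟙_ C) Γ τ h = N.pra (𝟙_ C) Δ τ h' ≫ (N.K.P τ).map g)
    (hV : N.val V' = g ≫ N.val V) (hM : N.comp M' = (f ▷ N.ty X) ≫ N.comp M) :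
    N.comp (.unbox τ h' V' M') = f ≫ N.comp (.unbox τ h V M) := by
  rw [comp_unbox, comp_unbox, hV, hM, Functor.map_comp, Category.assoc, ← reassoc_of% hg]
  simp only [← Category.assoc]
  congr 1
  ext <;> simp

end Transport

/-! ## Renaming -/

mutual

theorem val_ren {Γ Δ : Ctx S.Base} {X : Ty S.Base} (V : Val S Γ X) (ρ : Ren Γ Δ) :
    N.val (V.ren ρ) = N.renHom Γ ρ ≫ N.val V :=
  match V with
  | .var x => (N.renHom_var x ρ).symm
  | .const c V => N.transport_const _ c fun i => val_ren (V i) ρ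
  | .unit => toUnit_unique _ _
  | .pair V W => N.transport_pair _ (val_ren V ρ) (val_ren W ρ)
  | .lam M => N.transport_lam _ (by rw [comp_ren, N.renHom_snoc])
  | .box τ V => N.transport_box _ τ (by rw [val_ren, N.renHom_mod])

theorem comp_ren {Γ Δ : Ctx S.Base} {X : Ty S.Base} {σ : ℕ} (M : Comp S Γ X σ) (ρ : Ren Γ Δ) :
    N.comp (M.ren ρ) = N.renHom Γ ρ ≫ N.comp M :=
  match M with
  | .ret V => N.transport_ret _ (val_ren V ρ)
  | .letin h M P => N.transport_letin _ h (comp_ren M ρ)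
      (by rw [comp_ren, N.renHom_snoc, N.renHom_mod])
  | .app V W => N.transport_app _ (val_ren V ρ) (val_ren W ρ)
  | .pm V P => N.transport_pm _ (val_ren V ρ) (by rw [comp_ren, N.renHom_snoc, N.renHom_snoc])
  | .opcall o h V M => N.transport_opcall _ o h (val_ren V ρ)
      (by rw [comp_ren, N.renHom_snoc, N.renHom_mod])
  | .delay τ h M => N.transport_delay _ τ h (by rw [comp_ren, N.renHom_mod])
  | .handle h M H P => N.transport_handle _ h (comp_ren M ρ)
      (fun o τ => by rw [comp_ren (H o τ), N.renHom_snoc, N.renHom_snoc])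
      (by rw [comp_ren P, N.renHom_snoc, N.renHom_mod])
  | .unbox τ h V P => N.transport_unbox _ τ h (h.trans ρ.time_le) _ (N.renHom_minus ρ h)
      (val_ren V _) (by rw [comp_ren, N.renHom_snoc])

end

end Model

end

section

variable {C : Type u} [Category.{v} C] [CartesianMonoidalCategory C] [MonoidalClosed C]
variable {S : Signature.{w}}

namespace TypeModel

variable (N : TypeModel C S) {Γ₀ : Ctx S.Base} {X : Ty S.Base}

/-- The interpretation of the substitution of a value, interpreted by `w`, at a position. -/
def substHom (w : N.ctx Γ₀ (𝟙_ C) ⟶ N.ty X) : {Γ Δ : Ctx S.Base} → Pos Γ₀ X Γ Δ →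
    (N.ctx Δ (𝟙_ C) ⟶ N.ctx Γ (𝟙_ C))
  | _, _, .gone => 𝟙 _
  | _, _, .here => lift (𝟙 _) w
  | _, _, .snoc Y p => substHom w p ▷ N.ty Y
  | _, _, .mod τ p => (N.K.P τ).map (substHom w p)

variable (w : N.ctx Γ₀ (𝟙_ C) ⟶ N.ty X)

theorem substHom_atZero (h : 0 ≤ (Γ₀.snoc X).time) (h' : 0 ≤ Γ₀.time) :
    lift (𝟙 (N.ctx Γ₀ (𝟙_ C))) w ≫ N.pra (𝟙_ C) (Γ₀.snoc X) 0 h =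
      N.pra (𝟙_ C) Γ₀ 0 h' ≫ (N.K.P 0).map (N.substHom w (Pos.atZero X Γ₀)) := by
  have key : ∀ {D : C} (w : N.ctx Γ₀ (𝟙_ C) ⟶ D), lift (𝟙 (N.ctx Γ₀ (𝟙_ C))) w ≫ N.K.ηh _ =
      N.K.ηh _ ≫ (N.K.P 0).map (lift (𝟙 (N.ctx Γ₀ (𝟙_ C))) w) := fun w => N.K.ηh_natural _
  cases Γ₀ <;> exact key w

theorem substHom_minus {Γ Δ : Ctx S.Base} (p : Pos Γ₀ X Γ Δ) : ∀ (τ : ℕ) (h : τ ≤ Γ.time)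
    (h' : τ ≤ Δ.time),
    N.substHom w p ≫ N.pra (𝟙_ C) Γ τ h =
      N.pra (𝟙_ C) Δ τ h' ≫ (N.K.P τ).map (N.substHom w (p.minus τ)) := by
  induction p with
  | gone =>
    intro τ h h'
    have h₁ : ∀ Γ : Ctx S.Base, N.substHom w (.gone : Pos Γ₀ X Γ Γ) = 𝟙 _ := fun _ => rfl
    rw [h₁, Pos.minus, h₁, CategoryTheory.Functor.map_id, Category.id_comp]
    exact (Category.comp_id _).symm
  | here =>
    intro τ h h'
    cases τ with
    | zero => exact N.substHom_atZero w h h'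
    | succ n =>
      change lift (𝟙 _) w ≫ fst _ _ ≫ N.pra (𝟙_ C) Γ₀ (n + 1) h' =
        N.pra (𝟙_ C) Γ₀ (n + 1) h' ≫ (N.K.P (n + 1)).map (𝟙 (N.ctx (Γ₀.minus (n + 1)) (𝟙_ C)))
      rw [lift_fst_assoc, Category.id_comp, CategoryTheory.Functor.map_id, Category.comp_id]
  | @snoc Γ Δ Y p ih =>
    intro τ h h'
    cases τ with
    | zero => exact N.K.ηh_natural (N.substHom w p ▷ N.ty Y)
    | succ n =>
      have hΓ : n + 1 ≤ Γ.time := h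
      have hΔ : n + 1 ≤ Δ.time := h'
      change (N.substHom w p ▷ N.ty Y) ≫ fst _ _ ≫ N.pra (𝟙_ C) Γ (n + 1) hΓ =
        (fst (N.ctx Δ (𝟙_ C)) (N.ty Y) ≫ N.pra (𝟙_ C) Δ (n + 1) hΔ) ≫
          (N.K.P (n + 1)).map (N.substHom w (p.minus (n + 1)))
      rw [whiskerRight_fst_assoc, ih _ hΓ hΔ, Category.assoc]
  | @mod Γ Δ κ p ih =>
    intro τ h h'
    cases τ with
    | zero => exact N.K.ηh_natural ((N.K.P κ).map (N.substHom w p))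
    | succ n =>
      have key : ∀ d : Decidable (n + 1 ≤ κ),
        (N.K.P κ).map (N.substHom w p) ≫
          iteInduction (c := n + 1 ≤ κ) (t := Ctx.mod Γ (κ - (n + 1))) (e := Γ.minus (n + 1 - κ))
            (motive := fun Θ => (N.ctx (Γ.mod κ) (𝟙_ C) ⟶ (N.P (n + 1)).obj (N.ctx Θ (𝟙_ C))))
            (fun h' =>
              pastLE N.K.Past (Nat.add_sub_of_le h').le (N.ctx Γ (𝟙_ C)) ≫
                (N.K.μ (n + 1) (κ - (n + 1))).inv.app (N.ctx Γ (𝟙_ C)))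
            (fun h' =>
              (N.P κ).map (N.pra (𝟙_ C) Γ (n + 1 - κ) (Nat.sub_le_of_le_add h)) ≫
                (N.K.μ κ (n + 1 - κ)).hom.app _ ≫
                pastLE N.K.Past (Nat.add_sub_of_le (Nat.le_of_not_le h')).ge _) =
          iteInduction (c := n + 1 ≤ κ) (t := Ctx.mod Δ (κ - (n + 1))) (e := Δ.minus (n + 1 - κ))
            (motive := fun Θ => (N.ctx (Δ.mod κ) (𝟙_ C) ⟶ (N.P (n + 1)).obj (N.ctx Θ (𝟙_ C))))
            (fun h' =>
              pastLE N.K.Past (Nat.add_sub_of_le h').le (N.ctx Δ (𝟙_ C)) ≫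
                (N.K.μ (n + 1) (κ - (n + 1))).inv.app (N.ctx Δ (𝟙_ C)))
            (fun h'' =>
              (N.P κ).map (N.pra (𝟙_ C) Δ (n + 1 - κ) (Nat.sub_le_of_le_add h')) ≫
                (N.K.μ κ (n + 1 - κ)).hom.app _ ≫
                pastLE N.K.Past (Nat.add_sub_of_le (Nat.le_of_not_le h'')).ge _) ≫
          (N.K.P (n + 1)).map (N.substHom w
            (Pos.ite (c := n + 1 ≤ κ) (Γ := .mod Γ (κ - (n + 1))) (Δ := .mod Δ (κ - (n + 1)))
              d (fun _ => .mod _ p) (fun _ => p.minus (n + 1 - κ)))) := by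
        intro d
        cases d with
        | isTrue hd =>
          change (N.K.P κ).map (N.substHom w p) ≫ N.K.past (Nat.add_sub_of_le hd).le _ ≫
              N.K.μi (n + 1) (κ - (n + 1)) _ =
            (N.K.past (Nat.add_sub_of_le hd).le _ ≫ N.K.μi (n + 1) (κ - (n + 1)) _) ≫
              (N.K.P (n + 1)).map ((N.K.P (κ - (n + 1))).map (N.substHom w p))
          rw [reassoc_of% N.K.past_natural, N.K.μi_natural, Category.assoc]
        | isFalse hd =>
          change (N.K.P κ).map (N.substHom w p) ≫
              (N.K.P κ).map (N.pra (𝟙_ C) Γ (n + 1 - κ) (Nat.sub_le_of_le_add h)) ≫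
                N.K.μh κ (n + 1 - κ) _ ≫ N.K.past (Nat.add_sub_of_le (Nat.le_of_not_le hd)).ge _ =
            ((N.K.P κ).map (N.pra (𝟙_ C) Δ (n + 1 - κ) (Nat.sub_le_of_le_add h')) ≫
                N.K.μh κ (n + 1 - κ) _ ≫ N.K.past (Nat.add_sub_of_le (Nat.le_of_not_le hd)).ge _) ≫
              (N.K.P (n + 1)).map (N.substHom w (p.minus (n + 1 - κ)))
          rw [← Functor.map_comp_assoc, ih _ _ (Nat.sub_le_of_le_add h'), Functor.map_comp]
          simp only [Category.assoc, ← N.K.past_natural]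
          rw [reassoc_of% N.K.μh_natural]
      exact key _

end TypeModel

namespace Model

variable [HasProductsOfShape S.Op C] [HasProductsOfShape ℕ C] (N : Model C S)
variable {Γ₀ : Ctx S.Base} {X : Ty S.Base}

theorem var_subst (W : Val S Γ₀ X) {Γ Δ : Ctx S.Base} (p : Pos Γ₀ X Γ Δ) :
    ∀ {Y : Ty S.Base} (x : Var Γ Y), N.val (x.subst W p) = N.substHom (N.val W) p ≫ N.var x := by
  induction p with
  | gone =>
    intro Y x
    have h : ∀ Γ : Ctx S.Base, N.substHom (N.val W) (.gone : Pos Γ₀ X Γ Γ) = 𝟙 _ := fun _ => rfl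
    rw [h, Var.subst, val_var, Category.id_comp]
  | here =>
    intro Y x
    have h : N.substHom (N.val W) .here = lift (𝟙 _) (N.val W) := rfl
    cases x with
    | here => rw [h, N.var_here, lift_snd]; rfl
    | there x => rw [h, N.var_there, lift_fst_assoc, Category.id_comp]; rfl
  | @snoc Γ Δ Z p ih =>
    intro Y x
    have h : N.substHom (N.val W) (p.snoc Z) = N.substHom (N.val W) p ▷ N.ty Z := rfl
    cases x with
    | here => rw [h, N.var_here, whiskerRight_snd, Var.subst, val_var, N.var_here]
    | there x =>
      rw [h, N.var_there, whiskerRight_fst_assoc, Var.subst, val_ren, N.renHom_wk, ih]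
  | @mod Γ Δ τ p ih =>
    intro Y x
    have h : N.substHom (N.val W) (p.mod τ) = (N.K.P τ).map (N.substHom (N.val W) p) := rfl
    cases x with
    | skip x =>
      rw [h, N.var_skip, reassoc_of% N.K.epsPast_natural, Var.subst, val_ren, N.renHom_toMod, ih]

mutual

theorem val_subst {Γ Δ : Ctx S.Base} {Y : Ty S.Base} (V : Val S Γ Y) (W : Val S Γ₀ X)
    (p : Pos Γ₀ X Γ Δ) : N.val (V.subst W p) = N.substHom (N.val W) p ≫ N.val V :=
  match V with
  | .var x => N.var_subst W p x
  | .const c V => N.transport_const _ c fun i => val_subst (V i) W p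
  | .unit => toUnit_unique _ _
  | .pair V V' => N.transport_pair _ (val_subst V W p) (val_subst V' W p)
  | .lam M => N.transport_lam _ (comp_subst M W (p.snoc _))
  | .box τ V => N.transport_box _ τ (val_subst V W (p.mod τ))

theorem comp_subst {Γ Δ : Ctx S.Base} {Y : Ty S.Base} {σ : ℕ} (M : Comp S Γ Y σ)
    (W : Val S Γ₀ X) (p : Pos Γ₀ X Γ Δ) :
    N.comp (M.subst W p) = N.substHom (N.val W) p ≫ N.comp M :=
  match M with
  | .ret V => N.transport_ret _ (val_subst V W p)
  | .letin h M P => N.transport_letin _ h (comp_subst M W p) (comp_subst P W ((p.mod _).snoc _))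
  | .app V V' => N.transport_app _ (val_subst V W p) (val_subst V' W p)
  | .pm V P => N.transport_pm _ (val_subst V W p) (comp_subst P W ((p.snoc _).snoc _))
  | .opcall o h V M => N.transport_opcall _ o h (val_subst V W p)
      (comp_subst M W ((p.mod _).snoc _))
  | .delay τ h M => N.transport_delay _ τ h (comp_subst M W (p.mod τ))
  | .handle h M H P => N.transport_handle _ h (comp_subst M W p)
      (fun o τ => comp_subst (H o τ) W ((p.snoc _).snoc _)) (comp_subst P W ((p.mod _).snoc _))
  | .unbox τ h V P => N.transport_unbox _ τ h (h.trans p.time_eq.le) _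
      (N.substHom_minus (N.val W) p τ h _) (val_subst V W _) (comp_subst P W (p.snoc _))

end

variable {Γ : Ctx S.Base} {Y Z : Ty S.Base} {σ : ℕ}

theorem comp_subst₁ (M : Comp S (Γ.snoc X) Y σ) (V : Val S Γ X) :
    N.comp (M.subst₁ V) = lift (𝟙 _) (N.val V) ≫ N.comp M :=
  N.comp_subst M V .here

theorem comp_subst₂ (M : Comp S ((Γ.snoc X).snoc Y) Z σ) (V : Val S Γ X) (W : Val S Γ Y) :
    N.comp (M.subst₂ V W) = lift (lift (𝟙 _) (N.val V)) (N.val W) ≫ N.comp M := by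
  rw [Comp.subst₂, comp_subst₁, comp_subst₁, val_ren, N.renHom_wk, ← Category.assoc, comp_lift,
    lift_fst_assoc, Category.comp_id, Category.id_comp]

end Model

end

section

variable {C : Type u} [Category.{v} C]

@[simp]
theorem castT_refl (T : ℕ → C ⥤ C) {τ : ℕ} (h : τ = τ) (A : C) : castT T h A = 𝟙 _ := rfl

@[simp]
theorem castT_trans (T : ℕ → C ⥤ C) {τ τ' τ'' : ℕ} (h : τ = τ') (h' : τ' = τ'') (A : C) :
    castT T h A ≫ castT T h' A = castT T (h.trans h') A := by
  subst h h'
  simp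

variable [CartesianMonoidalCategory C]

@[simp]
theorem lift_swapMid {D A₁ A₂ A₃ : C} (a : D ⟶ A₁) (b : D ⟶ A₂) (c : D ⟶ A₃) :
    lift a (lift b c) ≫ swapMid A₁ A₂ A₃ = lift b (lift a c) := by
  rw [swapMid]
  ext <;> simp

namespace StrongGradedMonad

variable {K : Modalities C} (G : StrongGradedMonad K)

theorem ηT_natural {A B : C} (f : A ⟶ B) : f ≫ G.ηT B = G.ηT A ≫ (G.T 0).map f :=
  G.η.naturality f

theorem μT_natural (τ τ' : ℕ) {A B : C} (f : A ⟶ B) :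
    (G.T τ).map ((G.T τ').map f) ≫ G.μT τ τ' B = G.μT τ τ' A ≫ (G.T (τ + τ')).map f :=
  (G.μ τ τ').naturality f

theorem ηT_μT (τ : ℕ) (A : C) :
    G.ηT ((G.T τ).obj A) ≫ G.μT 0 τ A = castT G.T (Nat.zero_add τ).symm A :=
  G.η_μ τ A

theorem map_ηT_μT (τ : ℕ) (A : C) : (G.T τ).map (G.ηT A) ≫ G.μT τ 0 A = 𝟙 _ :=
  G.map_η_μ τ A

theorem μT_assoc (τ₁ τ₂ τ₃ : ℕ) (A : C) :
    (G.T τ₁).map (G.μT τ₂ τ₃ A) ≫ G.μT τ₁ (τ₂ + τ₃) A =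
      G.μT τ₁ τ₂ ((G.T τ₃).obj A) ≫ G.μT (τ₁ + τ₂) τ₃ A ≫
        castT G.T (Nat.add_assoc τ₁ τ₂ τ₃) A :=
  (G.μ_assoc τ₁ τ₂ τ₃ A).symm

/-- Changing the context that a computation has been paired with. -/
theorem lift_str (τ : ℕ) {D D' E A : C} (f : D ⟶ D') (c : (K.P τ).obj D' ⟶ E)
    (m : D ⟶ (G.T τ).obj A) :
    lift (f ≫ K.un τ D' ≫ (K.F τ).map c) m ≫ G.str τ E A =
      G.seq τ m ≫ (G.T τ).map (((K.P τ).map f ≫ c) ▷ A) := by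
  have h := G.str_natural τ ((K.P τ).map f ≫ c) (𝟙 A)
  rw [seq, Category.assoc, ← tensorHom_id, ← h, ← Category.assoc, ← Category.assoc,
    K.un_natural, Category.assoc, ← Functor.map_comp]
  congr 1
  ext <;> simp

theorem seq_ηT {D A : C} (v : D ⟶ A) :
    G.seq 0 (v ≫ G.ηT A) = lift (K.ηh D) v ≫ G.ηT _ := by
  have h : (K.εi ((K.P 0).obj D) ⊗ₘ G.ηT A) ≫ G.str 0 _ A = G.ηT _ := G.str_η _ A
  rw [seq, ← h, ← Category.assoc, lift_map, K.un_zero, ← K.εi_natural]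

theorem seq_snd (τ : ℕ) {D A : C} (m : D ⟶ (G.T τ).obj A) :
    G.seq τ m ≫ (G.T τ).map (snd ((K.P τ).obj D) A) = m := by
  rw [seq, Category.assoc, G.str_snd, lift_snd]

theorem lift_lift_str (τ : ℕ) {D A₁ A₂ A : C} (a : D ⟶ (K.F τ).obj A₁) (b : D ⟶ (K.F τ).obj A₂)
    (m : D ⟶ (G.T τ).obj A) :
    lift a (lift b m ≫ G.str τ A₂ A) ≫ G.str τ A₁ (A₂ ⊗ A) =
      lift (lift a b ≫ K.m τ A₁ A₂) m ≫ G.str τ (A₁ ⊗ A₂) A ≫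
        (G.T τ).map (α_ A₁ A₂ A).hom := by
  have h := lift a (lift b m) ≫= G.str_assoc τ A₁ A₂ A
  simp only [lift_lift_associator_inv_assoc, lift_whiskerRight_assoc, lift_whiskerLeft_assoc] at h
  exact h.symm

/-- The context that remains after `τ` and then `τ'` time steps. -/
theorem seq_seq (τ τ' : ℕ) {D A B : C} (m : D ⟶ (G.T τ).obj A)
    (n : (K.P τ).obj D ⊗ A ⟶ (G.T τ').obj B) :
    G.seq (τ + τ') (G.seq τ m ≫ (G.T τ).map n ≫ G.μT τ τ' B) =
      G.seq τ m ≫ (G.T τ).map (G.seq τ' n ≫ (G.T τ').map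
        (((K.P τ').map (fst _ _) ≫ K.μh τ' τ D ≫ K.past (Nat.add_comm τ τ').le D) ▷ B)) ≫
        G.μT τ τ' _ := by
  set q := K.un τ' _ ≫ (K.F τ').map (K.μh τ' τ D ≫ K.past (Nat.add_comm τ τ').le D) with hq
  have h₁ : ∀ x : D ⟶ (G.T τ).obj ((G.T τ').obj B), G.seq (τ + τ') (x ≫ G.μT τ τ' B) =
      lift (K.un τ D ≫ (K.F τ).map q) x ≫ G.str τ _ _ ≫
        (G.T τ).map (G.str τ' _ B) ≫ G.μT τ τ' _ := by
    intro x
    have h : G.str τ _ ((G.T τ').obj B) ≫ (G.T τ).map (G.str τ' ((K.P (τ + τ')).obj D) B) ≫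
        G.μT τ τ' _ = (K.δi τ τ' _ ⊗ₘ G.μT τ τ' B) ≫ G.str (τ + τ') _ B := G.str_μ τ τ' _ B
    rw [h, ← Category.assoc, lift_map, hq, Functor.map_comp, ← K.un_δh, Category.assoc, K.δh_δi,
      Category.comp_id, seq]
  have h₂ := G.str_natural τ q n
  have h₃ : lift (K.un τ D ≫ (K.F τ).map q) (G.seq τ m ≫ (G.T τ).map n) =
      lift (K.un τ D) (lift (K.un τ D) m ≫ G.str τ _ A) ≫ ((K.F τ).map q ⊗ₘ (G.T τ).map n) := by
    rw [lift_map, seq]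
  have h₄ := K.lift_map_m τ (K.un τ D) (𝟙 _) (𝟙 _)
  simp only [CategoryTheory.Functor.map_id, Category.comp_id] at h₄
  have h₅ := G.lift_str τ (𝟙 D) (lift (𝟙 ((K.P τ).obj D)) (𝟙 _)) m
  simp only [CategoryTheory.Functor.map_id, Category.id_comp] at h₅
  have h₆ := G.lift_str τ' (fst ((K.P τ).obj D) A)
    (K.μh τ' τ D ≫ K.past (Nat.add_comm τ τ').le D) n
  have h₇ : (lift (𝟙 ((K.P τ).obj D)) (𝟙 _) ▷ A) ≫ (α_ _ _ A).hom = lift (fst _ _) (𝟙 _) := by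
    ext <;> simp
  rw [← Category.assoc (G.seq τ m), h₁, h₃, Category.assoc, reassoc_of% h₂,
    reassoc_of% G.lift_lift_str, h₄, reassoc_of% h₅, ← h₆, ← hq]
  simp only [← Functor.map_comp_assoc]
  rw [reassoc_of% h₇, lift_map_assoc, Category.id_comp]

end StrongGradedMonad

end

section

variable {C : Type u} [Category.{v} C] [CartesianMonoidalCategory C] [MonoidalClosed C]

theorem lift_pushUnder {D A B Z : C} (a : D ⟶ A) (m : D ⊗ B ⟶ Z) :
    lift a (curryR m) ≫ pushUnder A B Z = curryR (lift (fst D B ≫ a) m) := by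
  rw [pushUnder, comp_curryR]
  congr 1
  have h : (lift a (curryR m) ▷ B) ≫ (α_ _ _ _).hom = lift (fst D B ≫ a) (curryR m ▷ B) := by
    ext <;> simp
  rw [reassoc_of% h, lift_whiskerLeft, ← uncurryR_comp, Category.comp_id, uncurryR_curryR]

namespace Model

variable {S : Signature.{w}} [HasProductsOfShape S.Op C] [HasProductsOfShape ℕ C]
variable (N : Model C S)

section

variable {D E A B : C} (o : S.Op) {τ τ' : ℕ}

theorem opT_map (v : D ⟶ N.argObj o) (q : D ⟶ (N.K.F (S.dur o)).obj E)
    (m : E ⊗ N.resObj o ⟶ (N.G.T τ).obj A) (f : A ⟶ B) :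
    lift v (q ≫ (N.K.F (S.dur o)).map (curryR m)) ≫ N.opT o τ A ≫ (N.G.T (S.dur o + τ)).map f =
      lift v (q ≫ (N.K.F (S.dur o)).map (curryR (m ≫ (N.G.T τ).map f))) ≫ N.opT o τ B := by
  have h : (N.argObj o ◁ (N.K.F (S.dur o)).map ((ihom (N.resObj o)).map ((N.G.T τ).map f))) ≫
      N.opT o τ B = N.opT o τ A ≫ (N.G.T (S.dur o + τ)).map f := (N.op o τ).naturality f
  rw [← h, lift_whiskerLeft_assoc, Category.assoc, ← Functor.map_comp, curryR_map]

theorem opT_μT (v : D ⟶ N.argObj o) (q : D ⟶ (N.K.F (S.dur o)).obj E)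
    (m : E ⊗ N.resObj o ⟶ (N.G.T τ).obj ((N.G.T τ').obj A)) :
    lift v (q ≫ (N.K.F (S.dur o)).map (curryR m)) ≫ N.opT o τ _ ≫ N.G.μT (S.dur o + τ) τ' A =
      lift v (q ≫ (N.K.F (S.dur o)).map (curryR (m ≫ N.G.μT τ τ' A))) ≫ N.opT o (τ + τ') A ≫
        castT N.G.T (Nat.add_assoc (S.dur o) τ τ').symm A := by
  have h : N.opT o τ _ ≫ N.G.μT (S.dur o + τ) τ' A =
    (N.argObj o ◁ (N.K.F (S.dur o)).map ((ihom (N.resObj o)).map (N.G.μT τ τ' A))) ≫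
      N.opT o (τ + τ') A ≫ castT N.G.T (Nat.add_assoc (S.dur o) τ τ').symm A := N.op_μ o τ τ' A
  rw [h, lift_whiskerLeft_assoc, Category.assoc, ← Functor.map_comp, curryR_map]

theorem seq_opT (v : D ⟶ N.argObj o)
    (m : (N.K.P (S.dur o)).obj D ⊗ N.resObj o ⟶ (N.G.T τ).obj A) :
    N.G.seq (S.dur o + τ)
        (lift v (N.K.un _ D ≫ (N.K.F (S.dur o)).map (curryR m)) ≫ N.opT o τ A) =
      lift v (N.K.un _ D ≫ (N.K.F (S.dur o)).map (curryR (N.G.seq τ m ≫ (N.G.T τ).map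
        (((N.K.P τ).map (fst _ _) ≫ N.K.μh τ (S.dur o) D ≫
          N.K.past (Nat.add_comm (S.dur o) τ).le D) ▷ A)))) ≫ N.opT o τ _ := by
  have h : ∀ E : C, ((N.K.F (S.dur o + τ)).obj E ◁ N.opT o τ A) ≫ N.G.str (S.dur o + τ) E A =
      swapMid _ _ _ ≫ (N.argObj o ◁ ((N.K.δh (S.dur o) τ E ▷ _) ≫
        N.K.m (S.dur o) ((N.K.F τ).obj E) ((ihom (N.resObj o)).obj ((N.G.T τ).obj A)) ≫
        (N.K.F (S.dur o)).map (pushUnder _ _ _) ≫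
        (N.K.F (S.dur o)).map ((ihom (N.resObj o)).map (N.G.str τ E A)))) ≫ N.opT o τ (E ⊗ A) :=
    fun E => N.op_str o τ E A
  rw [StrongGradedMonad.seq, ← lift_whiskerLeft_assoc, h, ← Category.assoc, lift_swapMid,
    lift_whiskerLeft_assoc, lift_whiskerRight_assoc, N.K.un_δh, ← Functor.map_comp,
    reassoc_of% N.K.lift_map_m, ← Functor.map_comp, ← Functor.map_comp, reassoc_of% lift_pushUnder,
    curryR_map, N.G.lift_str]

theorem delayT_map (m : D ⟶ (N.G.T τ').obj A) (f : A ⟶ B) :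
    (N.K.F τ).map m ≫ N.delayT τ τ' A ≫ (N.G.T (τ + τ')).map f =
      (N.K.F τ).map (m ≫ (N.G.T τ').map f) ≫ N.delayT τ τ' B := by
  have h : (N.K.F τ).map ((N.G.T τ').map f) ≫ N.delayT τ τ' B =
    N.delayT τ τ' A ≫ (N.G.T (τ + τ')).map f := (N.delay τ τ').naturality f
  rw [← h, Functor.map_comp_assoc]

theorem delayT_μT {τ'' : ℕ} (m : D ⟶ (N.G.T τ').obj ((N.G.T τ'').obj A)) :
    (N.K.F τ).map m ≫ N.delayT τ τ' _ ≫ N.G.μT (τ + τ') τ'' A =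
      (N.K.F τ).map (m ≫ N.G.μT τ' τ'' A) ≫ N.delayT τ (τ' + τ'') A ≫
        castT N.G.T (Nat.add_assoc τ τ' τ'').symm A := by
  have h : N.delayT τ τ' _ ≫ N.G.μT (τ + τ') τ'' A =
    (N.K.F τ).map (N.G.μT τ' τ'' A) ≫ N.delayT τ (τ' + τ'') A ≫
      castT N.G.T (Nat.add_assoc τ τ' τ'').symm A := N.delay_μ τ τ' τ'' A
  rw [h, Functor.map_comp_assoc]

theorem seq_delayT (m : (N.K.P τ).obj D ⟶ (N.G.T τ').obj A) :
    N.G.seq (τ + τ') (N.K.un τ D ≫ (N.K.F τ).map m ≫ N.delayT τ τ' A) =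
      N.K.un τ D ≫ (N.K.F τ).map (N.G.seq τ' m ≫ (N.G.T τ').map
        ((N.K.μh τ' τ D ≫ N.K.past (Nat.add_comm τ τ').le D) ▷ A)) ≫ N.delayT τ τ' _ := by
  have h : ∀ E : C, ((N.K.F (τ + τ')).obj E ◁ N.delayT τ τ' A) ≫ N.G.str (τ + τ') E A =
      (N.K.δh τ τ' E ▷ _) ≫ N.K.m τ ((N.K.F τ').obj E) ((N.G.T τ').obj A) ≫
        (N.K.F τ).map (N.G.str τ' E A) ≫ N.delayT τ τ' (E ⊗ A) :=
    fun E => N.delay_str τ τ' E A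
  have h' := N.G.lift_str τ' (𝟙 _) (N.K.μh τ' τ D ≫ N.K.past (Nat.add_comm τ τ').le D) m
  simp only [Category.id_comp, CategoryTheory.Functor.map_id] at h'
  rw [StrongGradedMonad.seq, ← Category.assoc (N.K.un τ D), ← lift_whiskerLeft_assoc, h,
    lift_whiskerRight_assoc, N.K.un_δh, ← Functor.map_comp, reassoc_of% N.K.lift_map_m,
    ← Functor.map_comp_assoc, h']

theorem lift_ηT_handleT (H : D ⟶ N.handlerObj A) (m : D ⟶ (N.G.T τ).obj A) :
    lift H (m ≫ N.G.ηT _) ≫ N.handleT 0 τ A = m ≫ castT N.G.T (Nat.zero_add τ).symm A := by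
  have h : (N.handlerObj A ◁ N.G.ηT ((N.G.T τ).obj A)) ≫ N.handleT 0 τ A =
    snd _ _ ≫ castT N.G.T (Nat.zero_add τ).symm A := N.χ_η τ A
  rw [← lift_whiskerLeft_assoc, h, lift_snd_assoc]

theorem lift_delayT_handleT {τ'' : ℕ} (H : D ⟶ N.handlerObj A)
    (m : (N.K.P τ).obj D ⟶ (N.G.T τ').obj ((N.G.T τ'').obj A)) :
    lift H (N.K.un τ D ≫ (N.K.F τ).map m ≫ N.delayT τ τ' _) ≫ N.handleT (τ + τ') τ'' A =
      N.K.un τ D ≫ (N.K.F τ).map (lift (N.K.epsPast τ D ≫ H) m ≫ N.handleT τ' τ'' A) ≫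
        N.delayT τ (τ' + τ'') A ≫ castT N.G.T (Nat.add_assoc τ τ' τ'').symm A := by
  have h : (N.handlerObj A ◁ N.delayT τ τ' ((N.G.T τ'').obj A)) ≫ N.handleT (τ + τ') τ'' A =
      (N.K.un τ (N.handlerObj A) ▷ _) ≫
        N.K.m τ ((N.K.P τ).obj (N.handlerObj A)) ((N.G.T τ').obj ((N.G.T τ'').obj A)) ≫
        (N.K.F τ).map (N.K.epsPast τ (N.handlerObj A) ▷ _) ≫
        (N.K.F τ).map (N.handleT τ' τ'' A) ≫
        N.delayT τ (τ' + τ'') A ≫ castT N.G.T (Nat.add_assoc τ τ' τ'').symm A := N.χ_delay τ τ' τ'' A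
  rw [← Category.assoc (N.K.un τ D), ← lift_whiskerLeft_assoc, h, lift_whiskerRight_assoc,
    N.K.un_natural, reassoc_of% N.K.lift_map_m, ← Functor.map_comp_assoc, ← Functor.map_comp_assoc,
    lift_whiskerRight, N.K.epsPast_natural]

theorem lift_opT_handleT (H : D ⟶ N.handlerObj A) (v : D ⟶ N.argObj o)
    (m : (N.K.P (S.dur o)).obj D ⊗ N.resObj o ⟶ (N.G.T τ).obj ((N.G.T τ').obj A)) :
    lift H (lift v (N.K.un _ D ≫ (N.K.F (S.dur o)).map (curryR m)) ≫ N.opT o τ _) ≫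
        N.handleT (S.dur o + τ) τ' A =
      lift (H ≫ Pi.π (fun o : S.Op => ∏ᶜ fun τ : ℕ => N.clauseObj o τ A) o ≫
          Pi.π (fun τ : ℕ => N.clauseObj o τ A) (τ + τ'))
        (lift v (N.K.un _ D ≫ (N.K.F (S.dur o)).map (curryR
          (lift (fst _ _ ≫ N.K.epsPast _ D ≫ H) m ≫ N.handleT τ τ' A)))) ≫
        uncurryR (𝟙 (N.clauseObj o (τ + τ') A)) ≫
        castT N.G.T (Nat.add_assoc (S.dur o) τ τ').symm A := by
  have h : (N.handlerObj A ◁ N.opT o τ ((N.G.T τ').obj A)) ≫ N.handleT (S.dur o + τ) τ' A =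
      lift (fst _ _ ≫ Pi.π (fun o : S.Op => ∏ᶜ fun τ : ℕ => N.clauseObj o τ A) o ≫
          Pi.π (fun τ : ℕ => N.clauseObj o τ A) (τ + τ')) (𝟙 _) ≫
        (N.clauseObj o (τ + τ') A ◁
          (swapMid _ _ _ ≫
            (N.argObj o ◁
              ((N.K.un (S.dur o) (N.handlerObj A) ▷ _) ≫
                N.K.m (S.dur o) ((N.K.P (S.dur o)).obj (N.handlerObj A))
                  ((ihom (N.resObj o)).obj ((N.G.T τ).obj ((N.G.T τ').obj A))) ≫
                (N.K.F (S.dur o)).map (N.K.epsPast (S.dur o) (N.handlerObj A) ▷ _) ≫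
                (N.K.F (S.dur o)).map (pushUnder _ _ _) ≫
                (N.K.F (S.dur o)).map
                  ((ihom (N.resObj o)).map (N.handleT τ τ' A)))))) ≫
        uncurryR (𝟙 (N.clauseObj o (τ + τ') A)) ≫
        castT N.G.T (Nat.add_assoc (S.dur o) τ τ').symm A := N.χ_op o τ τ' A
  rw [← lift_whiskerLeft_assoc, h, ← Category.assoc, comp_lift, lift_fst_assoc, Category.comp_id,
    lift_whiskerLeft_assoc, ← Category.assoc (lift H _), lift_swapMid, lift_whiskerLeft,
    lift_whiskerRight_assoc, N.K.un_natural, reassoc_of% N.K.lift_map_m, ← Functor.map_comp,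
    ← Functor.map_comp, ← Functor.map_comp, lift_whiskerRight_assoc, N.K.epsPast_natural,
    reassoc_of% lift_pushUnder, curryR_map]

end

end Model

end

section

variable {C : Type u} [Category.{v} C] [CartesianMonoidalCategory C] [MonoidalClosed C]
variable {S : Signature.{w}} [HasProductsOfShape S.Op C] [HasProductsOfShape ℕ C]

namespace Model

variable (N : Model C S) {Γ : Ctx S.Base} {X Y Z : Ty S.Base}

/-! ## Soundness of the individual equations -/

theorem sound_func_eta {τ : ℕ} (V : Val S Γ (.func X Y τ)) :
    N.val (.lam (.app (V.ren (.wk X)) (.var .here))) = N.val V := by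
  rw [val_lam, comp_app, val_ren, N.renHom_wk, val_var, N.var_here]
  apply curryR_injective
  have h := lift_uncurryR (fst (N.ctx Γ (𝟙_ C)) (N.ty X)) (snd _ _) (N.val V)
  rw [lift_fst_snd, Category.id_comp] at h
  rw [uncurryR_curryR, h]

theorem sound_func_beta {τ : ℕ} (M : Comp S (Γ.snoc X) Y τ) (V : Val S Γ X) :
    N.comp (.app (.lam M) V) = N.comp (M.subst₁ V) := by
  rw [comp_app, val_lam, comp_subst₁, lift_curryR_eval]

theorem sound_prod_beta {τ : ℕ} (V : Val S Γ X) (W : Val S Γ Y)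
    (M : Comp S ((Γ.snoc X).snoc Y) Z τ) :
    N.comp (.pm (.pair V W) M) = N.comp (M.subst₂ V W) := by
  rw [comp_pm, val_pair, comp_subst₂, lift_lift_associator_inv_assoc]

theorem sound_prod_eta {τ : ℕ} (V : Val S Γ (.prod X Y)) (M : Comp S (Γ.snoc (.prod X Y)) Z τ) :
    N.comp (.pm V ((M.ren (((Ren.wk X).comp (.wk Y)).snoc _)).subst₁
      (.pair (.var (.there .here)) (.var .here)))) = N.comp (M.subst₁ V) := by
  rw [comp_pm, comp_subst₁, comp_subst₁, comp_ren, N.renHom_snoc, N.renHom_comp, N.renHom_wk,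
    N.renHom_wk, val_pair, val_var, val_var, N.var_there, N.var_here, N.var_here]
  simp only [← Category.assoc]
  congr 1
  ext <;> simp

theorem sound_let_ret {τ : ℕ} (V : Val S Γ X) (M : Comp S ((Γ.mod 0).snoc X) Y τ) :
    N.comp (.letin (Nat.zero_add τ).symm (.ret V) M) =
      N.comp ((M.ren (Ren.eta.snoc X)).subst₁ V) := by
  rw [comp_letin, comp_ret, N.G.seq_ηT, comp_subst₁, comp_ren, N.renHom_snoc, N.renHom_eta,
    Category.assoc, ← reassoc_of% N.G.ηT_natural, reassoc_of% N.G.ηT_μT, castT_trans, castT_refl,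
    Category.comp_id, lift_whiskerRight_assoc, Category.id_comp]

theorem sound_let_let {τ₁ τ₂ τ₃ : ℕ} (M : Comp S Γ X τ₁)
    (M' : Comp S ((Γ.mod τ₁).snoc X) Y τ₂) (P : Comp S ((Γ.mod (τ₁ + τ₂)).snoc Y) Z τ₃) :
    N.comp (.letin rfl (.letin rfl M M') P) =
      N.comp (.letin (Nat.add_assoc τ₁ τ₂ τ₃) M
        (.letin rfl M' (P.ren ((Ren.under τ₁ τ₂ X).snoc Y)))) := by
  simp only [comp_letin, castT_refl, Category.comp_id]
  rw [N.G.seq_seq, comp_ren, N.renHom_snoc, N.renHom_under]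
  simp only [Functor.map_comp, Category.assoc]
  rw [reassoc_of% N.G.μT_assoc, castT_trans, castT_refl, Category.comp_id,
    reassoc_of% N.G.μT_natural τ₁ τ₂ (N.comp P),
    reassoc_of% N.G.μT_natural τ₁ τ₂ (B := N.ctx ((Γ.mod (τ₁ + τ₂)).snoc Y) (𝟙_ C)) (_ ▷ N.ty Y)]

theorem sound_let_eta {τ : ℕ} (M : Comp S Γ X τ) :
    N.comp (.letin rfl M (.ret (.var .here))) = N.comp M := by
  rw [comp_letin, comp_ret, val_var, N.var_here, castT_refl, Category.comp_id, Functor.map_comp,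
    Category.assoc, N.G.map_ηT_μT, Category.comp_id, N.G.seq_snd]

theorem sound_let_op {τ τ' : ℕ} (o : S.Op) (V : Val S Γ (S.arg o).toTy)
    (M : Comp S ((Γ.mod (S.dur o)).snoc (S.res o).toTy) X τ)
    (P : Comp S ((Γ.mod (S.dur o + τ)).snoc X) Y τ') :
    N.comp (.letin rfl (.opcall o rfl V M) P) =
      N.comp (.opcall o (Nat.add_assoc (S.dur o) τ τ') V
        (.letin rfl M (P.ren ((Ren.under (S.dur o) τ _).snoc X)))) := by
  simp only [comp_letin, comp_opcall, castT_refl, Category.comp_id]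
  rw [N.seq_opT, comp_ren, N.renHom_snoc, N.renHom_under, Category.assoc,
    reassoc_of% N.opT_map, N.opT_μT]
  simp only [Functor.map_comp, Category.assoc]

theorem sound_let_delay {τ τ' τ'' : ℕ} (M : Comp S (Γ.mod τ) X τ')
    (P : Comp S ((Γ.mod (τ + τ')).snoc X) Y τ'') :
    N.comp (.letin rfl (.delay τ rfl M) P) =
      N.comp (.delay τ (Nat.add_assoc τ τ' τ'') (.letin rfl M (P.ren ((Ren.mu τ τ').snoc X)))) := by
  simp only [comp_letin, comp_delay, castT_refl, Category.comp_id]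
  rw [N.seq_delayT, comp_ren, N.renHom_snoc, N.renHom_mu]
  simp only [Category.assoc]
  rw [reassoc_of% N.delayT_map, N.delayT_μT]
  simp only [Functor.map_comp, Category.assoc]

theorem sound_handle_ret {τ : ℕ} (V : Val S Γ X) (H : Clauses S Γ Y)
    (M : Comp S ((Γ.mod 0).snoc X) Y τ) :
    N.comp (.handle (Nat.zero_add τ).symm (.ret V) H M) =
      N.comp ((M.ren (Ren.eta.snoc X)).subst₁ V) := by
  rw [comp_handle, comp_ret, N.G.seq_ηT, comp_subst₁, comp_ren, N.renHom_snoc, N.renHom_eta,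
    Category.assoc, ← N.G.ηT_natural, ← Category.assoc (lift (N.K.ηh _) _),
    reassoc_of% N.lift_ηT_handleT, castT_trans, castT_refl,
    Category.comp_id, lift_whiskerRight_assoc, Category.id_comp]

theorem clauses_ren {Γ Δ : Ctx S.Base} (H : Clauses S Γ Y) (ρ : Ren Γ Δ) :
    N.clauses (H.ren ρ) = N.renHom Γ ρ ≫ N.clauses H :=
  N.transport_clauses _ fun o τ => by
    rw [Clauses.ren, comp_ren, N.renHom_snoc, N.renHom_snoc]

theorem clauses_π (H : Clauses S Γ Y) (o : S.Op) (τ : ℕ) :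
    N.clauses H ≫ Pi.π (fun o : S.Op => ∏ᶜ fun τ : ℕ => N.clauseObj o τ (N.ty Y)) o ≫
      Pi.π (fun τ : ℕ => N.clauseObj o τ (N.ty Y)) τ =
      curryR ((α_ _ _ _).inv ≫ N.comp (H o τ)) := by
  simp [clauses]

theorem sound_handle_op {τ τ' : ℕ} (o : S.Op)
    (V : Val S Γ (S.arg o).toTy) (M : Comp S ((Γ.mod (S.dur o)).snoc (S.res o).toTy) X τ)
    (H : Clauses S Γ Y) (P : Comp S ((Γ.mod (S.dur o + τ)).snoc X) Y τ') :
    N.comp (.handle (Nat.add_assoc (S.dur o) τ τ').symm (.opcall o rfl V M) H P) =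
      N.comp ((H o (τ + τ')).subst₂ V (.box (S.dur o) (.lam
        (.handle rfl M (Clauses.ren H ((Ren.toMod (S.dur o)).comp (.wk _)))
          (P.ren ((Ren.under (S.dur o) τ _).snoc X)))))) := by
  rw [comp_subst₂, val_box, val_lam]
  simp only [comp_handle, comp_opcall, castT_refl, Category.comp_id]
  rw [N.seq_opT, comp_ren, N.renHom_snoc, N.renHom_under, clauses_ren, N.renHom_comp, N.renHom_wk,
    N.renHom_toMod, Category.assoc, N.opT_map, reassoc_of% N.lift_opT_handleT, castT_trans,
    castT_refl, Category.comp_id, clauses_π, lift_curryR_eval, lift_lift_associator_inv_assoc]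
  simp only [Functor.map_comp, Category.assoc]

theorem sound_handle_delay {τ τ' τ'' : ℕ} (M : Comp S (Γ.mod τ) X τ')
    (H : Clauses S Γ Y) (P : Comp S ((Γ.mod (τ + τ')).snoc X) Y τ'') :
    N.comp (.handle rfl (.delay τ rfl M) H P) =
      N.comp (.delay τ (Nat.add_assoc τ τ' τ'')
        (.handle rfl M (Clauses.ren H (.toMod τ)) (P.ren ((Ren.mu τ τ').snoc X)))) := by
  simp only [comp_handle, comp_delay, castT_refl, Category.comp_id]
  rw [N.seq_delayT, comp_ren, N.renHom_snoc, N.renHom_mu, clauses_ren, N.renHom_toMod]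
  simp only [Category.assoc]
  rw [N.delayT_map, N.lift_delayT_handleT]
  simp only [Functor.map_comp, Category.assoc]

theorem sound_box_beta {σ : ℕ} (τ : ℕ) (h : τ ≤ Γ.time)
    (V : Val S ((Γ.minus τ).mod τ) X) (M : Comp S (Γ.snoc X) Y σ) :
    N.comp (.unbox τ h (.box τ V) M) = N.comp (M.subst₁ (V.ren (.minusMod τ h))) := by
  rw [comp_unbox, val_box, comp_subst₁, val_ren, N.renHom_minusMod, Functor.map_comp, Category.assoc,
    N.K.co_natural, reassoc_of% N.K.map_un_co]

theorem sound_box_eta {σ : ℕ} (τ : ℕ) (h : τ ≤ Γ.time)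
    (V : Val S (Γ.minus τ) (.box τ X)) (M : Comp S (Γ.snoc (.box τ X)) Y σ) :
    N.comp (.unbox τ h V ((M.ren ((Ren.wk X).snoc _)).subst₁ (.box τ (.var (.skip .here))))) =
      N.comp (M.subst₁ (V.ren (.ofMinus τ))) := by
  rw [comp_unbox, comp_subst₁, comp_subst₁, comp_ren, N.renHom_snoc, N.renHom_wk, val_box, val_var,
    N.var_skip, N.var_here, val_ren, N.renHom_ofMinus Γ τ h]
  have h₁ : N.K.un τ (N.ctx Γ (𝟙_ C) ⊗ N.ty X) ≫ (N.K.F τ).map (N.K.epsPast τ _ ≫ snd _ _) =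
      snd _ _ ≫ N.K.un τ _ ≫ (N.K.F τ).map (N.K.epsPast τ (N.ty X)) := by
    rw [← N.K.epsPast_natural, Functor.map_comp, ← reassoc_of% N.K.un_natural]
  simp only [h₁, ← Category.assoc]
  congr 1
  ext
  · simp
  · simp only [Category.assoc, lift_snd, comp_lift, lift_snd_assoc, N.K.co_un_epsPast,
      N.K.epsPast_natural, whiskerRight_snd]

theorem sound_delay_zero
    (delay_zero : ∀ (τ : ℕ) (A : C), (N.delay 0 τ).app A =
      N.K.ε.hom.app ((N.T τ).obj A) ≫ castT N.T (Nat.zero_add τ).symm A)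
    {σ : ℕ} (M : Comp S (Γ.mod 0) X σ) :
    N.comp (.delay 0 (Nat.zero_add σ).symm M) = N.comp (M.ren .eta) := by
  have h : ∀ A, N.delayT 0 σ A = N.K.εh ((N.G.T σ).obj A) ≫ castT N.G.T (Nat.zero_add σ).symm A :=
    delay_zero σ
  rw [comp_delay, h, comp_ren, N.renHom_eta, Category.assoc, castT_trans, castT_refl,
    Category.comp_id, N.K.εh_natural, N.K.un_zero, Category.assoc, reassoc_of% N.K.εh_natural,
    N.K.εi_εh_assoc]

theorem sound_delay_add
    (delay_add : ∀ (τ τ' τ'' : ℕ) (A : C),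
      (N.F τ).map ((N.delay τ' τ'').app A) ≫ (N.delay τ (τ' + τ'')).app A =
        (N.K.δ τ τ').inv.app ((N.T τ'').obj A) ≫ (N.delay (τ + τ') τ'').app A ≫
          castT N.T (Nat.add_assoc τ τ' τ'') A)
    (τ τ' : ℕ) {σ : ℕ} (M : Comp S ((Γ.mod τ).mod τ') X σ) :
    N.comp (.delay τ rfl (.delay τ' rfl M)) =
      N.comp (.delay (τ + τ') (Nat.add_assoc τ τ' σ).symm (M.ren (.muInv τ τ'))) := by
  have h : ∀ A, (N.K.F τ).map (N.delayT τ' σ A) ≫ N.delayT τ (τ' + σ) A =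
      N.K.δi τ τ' _ ≫ N.delayT (τ + τ') σ A ≫ castT N.G.T (Nat.add_assoc τ τ' σ) A :=
    delay_add τ τ' σ
  have h' := N.K.un_δh τ τ' (N.ctx Γ (𝟙_ C)) =≫ N.K.δi τ τ' _
  simp only [Category.assoc, N.K.δh_δi, Category.comp_id, N.K.δi_natural] at h'
  have h'' : N.K.un (τ + τ') (N.ctx Γ (𝟙_ C)) ≫ (N.K.F (τ + τ')).map
      (N.K.past (Nat.add_comm τ τ').ge _ ≫ N.K.μi τ' τ _) =
        N.K.un τ _ ≫ (N.K.F τ).map (N.K.un τ' _) ≫ N.K.δi τ τ' _ := by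
    rw [h']
    simp only [Category.assoc, ← Functor.map_comp]
    rw [reassoc_of% N.K.past_trans, N.K.past_refl, Category.id_comp, N.K.μh_μi,
      CategoryTheory.Functor.map_id, Category.comp_id]
  simp only [comp_delay, castT_refl, Category.comp_id]
  simp only [Functor.map_comp] at h''
  rw [comp_ren, N.renHom_muInv]
  simp only [Functor.map_comp, Category.assoc, h]
  rw [reassoc_of% h'']
  rw [reassoc_of% N.K.δi_natural]

/-! ## Soundness -/

mutual

theorem val_sound {Ax : Axioms S}
    (sound_ax : ∀ {Γ : Ctx S.Base} {X : Ty S.Base} {σ : ℕ} {M M' : Comp S Γ X σ},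
      Ax Γ X σ M M' → N.comp M = N.comp M')
    {Γ : Ctx S.Base} {X : Ty S.Base} {V W : Val S Γ X} (h : ValEq Ax V W) :
    N.val V = N.val W :=
  match h with
  | .refl _ => rfl
  | .symm h => (val_sound sound_ax h).symm
  | .trans h h' => (val_sound sound_ax h).trans (val_sound sound_ax h')
  | .const f h => by
      rw [val_const, val_const, funext fun i => val_sound sound_ax (h i)]
  | .pair h h' => by rw [val_pair, val_pair, val_sound sound_ax h, val_sound sound_ax h']
  | .lam h => by rw [val_lam, val_lam, comp_sound sound_ax h]
  | .box τ h => by rw [val_box, val_box, val_sound sound_ax h]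
  | .subst p h h' => by rw [val_subst, val_subst, val_sound sound_ax h, val_sound sound_ax h']
  | .unit_eta V => toUnit_unique _ _
  | .func_eta V => N.sound_func_eta V

theorem comp_sound {Ax : Axioms S}
    (sound_ax : ∀ {Γ : Ctx S.Base} {X : Ty S.Base} {σ : ℕ} {M M' : Comp S Γ X σ},
      Ax Γ X σ M M' → N.comp M = N.comp M')
    {Γ : Ctx S.Base} {X : Ty S.Base} {σ : ℕ}
    {M M' : Comp S Γ X σ} (h : CompEq Ax M M') : N.comp M = N.comp M' :=
  match h with
  | .ax h => sound_ax h
  | .refl _ => rfl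
  | .symm h => (comp_sound sound_ax h).symm
  | .trans h h' => (comp_sound sound_ax h).trans (comp_sound sound_ax h')
  | .ret h => by rw [comp_ret, comp_ret, val_sound sound_ax h]
  | .letin e h h' => by rw [comp_letin, comp_letin, comp_sound sound_ax h, comp_sound sound_ax h']
  | .app h h' => by rw [comp_app, comp_app, val_sound sound_ax h, val_sound sound_ax h']
  | .pm h h' => by rw [comp_pm, comp_pm, val_sound sound_ax h, comp_sound sound_ax h']
  | .opcall o e h h' => by rw [comp_opcall, comp_opcall, val_sound sound_ax h, comp_sound sound_ax h']
  | .delay τ e h => by rw [comp_delay, comp_delay, comp_sound sound_ax h]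
  | .handle e h hH h' => by
      rw [comp_handle, comp_handle, comp_sound sound_ax h, comp_sound sound_ax h', clauses, clauses,
        funext fun o => congrArg Pi.lift (funext fun τ =>
          congrArg (fun f => curryR ((α_ _ _ _).inv ≫ f)) (comp_sound sound_ax (hH o τ)))]
  | .unbox τ e h h' => by rw [comp_unbox, comp_unbox, val_sound sound_ax h, comp_sound sound_ax h']
  | .subst p h h' => by rw [comp_subst, comp_subst, comp_sound sound_ax h, val_sound sound_ax h']
  | .func_beta M V => N.sound_func_beta M V
  | .prod_beta V W P => N.sound_prod_beta V W P
  | .prod_eta V P => N.sound_prod_eta V P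
  | .let_ret V P => N.sound_let_ret V P
  | .let_let M P Q => N.sound_let_let M P Q
  | .let_eta M => N.sound_let_eta M
  | .let_op o V M P => N.sound_let_op o V M P
  | .let_delay M P => N.sound_let_delay M P
  | .handle_ret V H P => N.sound_handle_ret V H P
  | .handle_op o V M H P => N.sound_handle_op o V M H P
  | .handle_delay M H P => N.sound_handle_delay M H P
  | .box_beta τ e V P => N.sound_box_beta τ e V P
  | .box_eta τ e V P => N.sound_box_eta τ e V P

end

end Model

end

end LambdaTau

theorem theorem4 {C : Type u} [Category.{v} C] [CartesianMonoidalCategory C] [MonoidalClosed C]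
    {S : LambdaTau.Signature.{w}} [HasProductsOfShape S.Op C] [HasProductsOfShape ℕ C]
    (N : LambdaTau.Model C S)
    (delay_zero : ∀ (τ : ℕ) (A : C),
      (N.delay 0 τ).app A =
        N.K.ε.hom.app ((N.T τ).obj A) ≫ LambdaTau.castT N.T (Nat.zero_add τ).symm A)
    (delay_add : ∀ (τ τ' τ'' : ℕ) (A : C),
      (N.F τ).map ((N.delay τ' τ'').app A) ≫ (N.delay τ (τ' + τ'')).app A =
        (N.K.δ τ τ').inv.app ((N.T τ'').obj A) ≫ (N.delay (τ + τ') τ'').app A ≫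
          LambdaTau.castT N.T (Nat.add_assoc τ τ' τ'') A) :
    (∀ (Γ : LambdaTau.Ctx S.Base) (X : LambdaTau.Ty S.Base) (V W : LambdaTau.Val S Γ X),
      LambdaTau.ValEq LambdaTau.DelayAx V W → N.val V = N.val W) ∧
    (∀ (Γ : LambdaTau.Ctx S.Base) (X : LambdaTau.Ty S.Base) (σ : ℕ)
      (M M' : LambdaTau.Comp S Γ X σ),
      LambdaTau.CompEq LambdaTau.DelayAx M M' → N.comp M = N.comp M') := by
  have sound_ax : ∀ {Γ : LambdaTau.Ctx S.Base} {X : LambdaTau.Ty S.Base} {σ : ℕ}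
      {M M' : LambdaTau.Comp S Γ X σ}, LambdaTau.DelayAx Γ X σ M M' → N.comp M = N.comp M' := by
    rintro Γ X σ M M' (M | ⟨τ, τ', M⟩)
    · exact N.sound_delay_zero delay_zero M
    · exact N.sound_delay_add delay_add τ τ' M
  exact ⟨fun _ _ _ _ h => N.val_sound sound_ax h, fun _ _ _ _ _ h => N.comp_sound sound_ax h⟩
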